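/- Let $\Omega\subset\mathbb R^2$ be a nonempty, open, connected, bounded set with Lipschitz boundary, let $m>2$ and $K\ge 1$ be integers, and let $\alpha,\beta,\nu>0$. Let $\mathcal A$ be the set of $\varphi\in (W^{m,2}(\Omega))^2$ (identified with their representatives that are continuous on $\overline\Omega$) such that $\det(D\varphi)>0$ a.e. in $\Omega$ and $\varphi(x)=x$ for all $x\in\partial\Omega$. For $I\in L^2(\Omega)$ and $\varphi\in\mathcal A$ let $(I\circ\varphi^{-1})(y):= I(x)$ if $y$ has exactly one preimage $x$ under $\varphi$ in $\overline\Omega$, and $(I\circ\varphi^{-1})(y):=0$ otherwise. Let $$TV(I):=\sup\Big\{\int_\Omega I\,\operatorname{div}\eta\,dx:\ \eta\in (C_c^\infty(\Omega))^2,\ |\eta|\le 1\Big\}\in[0,\infty].$$ Let $A\colon L^2(\Omega)\to\mathcal Y$ be a continuous linear operator into a real Hilbert space $\mathcal Y$ with $Ac\neq 0$ for every constant function $c\ne 0$, let $B\in\mathcal Y$ and $R\in L^2(\Omega)$, and let $W\colon\mathbb R^{2\times 2}\to[0,\infty]$ be lower semicontinuous. For $\mathbf I=(I_0,\dots,I_{K-1})\in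 (L^2(\Omega))^K$ and $\boldsymbol\varphi=(\varphi_0,\dots,\varphi_{K-1})\in\mathcal A^K$ put $I_K:=R$ and $$\mathcal J(\mathbf I,\boldsymbol\varphi):=\tfrac12\|AI_0-B\|_{\mathcal Y}^2+\alpha\,TV(I_0)+\beta\sum_{k=0}^{K-1}\int_\Omega W(D\varphi_k)+\nu|D^m\varphi_k|^2+\big|I_k\circ\varphi_k^{-1}-I_{k+1}\big|^2\,dx\ \in[0,\infty],$$ where $|D^m\varphi|^2=\sum_{i=1}^{2}\sum_{|\gamma|=m}|D^\gamma\varphi_i|^2$ is formed with weak derivatives. Then for every fixed $\boldsymbol\varphi\in\mathcal A^K$ with $\int_\Omega W(D\varphi_k)\,dx<\infty$ for $k=0,\dots,K-1$, there exists a unique image sequence $\mathbf I\in(L^2(\Omega))^K$ which minimizes $\mathcal J(\cdot,\boldsymbol\varphi)$ over $(L^2(\Omega))^K$. -/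

import Mathlib

open MeasureTheory
open scoped ENNReal ContDiff

noncomputable section

namespace TDM

/-- The Euclidean plane `ℝ²`. -/
abbrev Plane : Type := EuclideanSpace ℝ (Fin 2)

/-- The space `L²(Ω)` of real-valued images on `Ω` (with respect to Lebesgue measure). -/
abbrev L2 (Ω : Set Plane) : Type := Lp ℝ 2 (volume.restrict Ω)

/-- `Ω` has a Lipschitz boundary: near each boundary point, and in suitable Cartesian coordinates,
`Ω` is the set of points that lie strictly below the graph of a Lipschitz function. -/
def HasLipschitzBoundary (Ω : Set Plane) : Prop :=
  ∀ p ∈ frontier Ω, ∃ (r : ℝ) (T : Plane ≃ₗᵢ[ℝ] Plane) (L : NNReal) (γ : ℝ → ℝ),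
    0 < r ∧ LipschitzWith L γ ∧
      ∀ x ∈ Metric.ball p r, (x ∈ Ω ↔ (T x) 1 < γ ((T x) 0))

/-- The classical partial derivative `∂ᵢ f`. -/
def pderiv (i : Fin 2) (f : Plane → ℝ) : Plane → ℝ :=
  fun x => fderiv ℝ f x (EuclideanSpace.single i 1)

/-- The classical partial derivative `D^β f = ∂₀^(β 0) ∂₁^(β 1) f` for a multi-index `β`. -/
def mderiv (β : Fin 2 → ℕ) (f : Plane → ℝ) : Plane → ℝ :=
  (pderiv 0)^[β 0] ((pderiv 1)^[β 1] f)

/-- The order `|β|` of a multi-index. -/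
def order (β : Fin 2 → ℕ) : ℕ := β 0 + β 1

/-- `η ∈ C_c^∞(Ω; F)`. -/
def IsTest {F : Type*} [NormedAddCommGroup F] [NormedSpace ℝ F] (Ω : Set Plane)
    (η : Plane → F) : Prop :=
  ContDiff ℝ ∞ η ∧ HasCompactSupport η ∧ tsupport η ⊆ Ω

/-- `g` is a weak derivative `D^β f` of `f` on `Ω`. -/
def HasWeakDeriv (Ω : Set Plane) (β : Fin 2 → ℕ) (f g : Plane → ℝ) : Prop :=
  LocallyIntegrableOn f Ω ∧ LocallyIntegrableOn g Ω ∧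
    ∀ η : Plane → ℝ, IsTest Ω η →
      ∫ x in Ω, f x * mderiv β η x = (-1) ^ order β * ∫ x in Ω, g x * η x

/-- `f ∈ W^{m,2}(Ω)`: `f` has weak derivatives up to order `m` in `L²(Ω)`
(the case `β = 0` says that `f` itself is in `L²(Ω)`). -/
def MemSobolev (Ω : Set Plane) (m : ℕ) (f : Plane → ℝ) : Prop :=
  ∀ β : Fin 2 → ℕ, order β ≤ m →
    ∃ g : Plane → ℝ, MemLp g 2 (volume.restrict Ω) ∧ HasWeakDeriv Ω β f g

open Classical in
/-- The weak derivative `D^β f` on `Ω` (a representative; it is unique a.e. in `Ω`), and `0` if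
there is none. -/
def weakDeriv (Ω : Set Plane) (β : Fin 2 → ℕ) (f : Plane → ℝ) : Plane → ℝ :=
  if h : ∃ g, HasWeakDeriv Ω β f g then h.choose else 0

/-- The (weak) Jacobian matrix `Dφ(x) = (∂_j φ_i(x))_{i,j}`. -/
def jacobian (Ω : Set Plane) (φ : Plane → Plane) (x : Plane) : Matrix (Fin 2) (Fin 2) ℝ :=
  Matrix.of fun i j => weakDeriv Ω (Pi.single j 1) (fun y => φ y i) x

/-- `|D^m φ(x)|² = ∑_i ∑_{|β| = m} |D^β φ_i(x)|²`. -/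
def normSqDm (Ω : Set Plane) (m : ℕ) (φ : Plane → Plane) (x : Plane) : ℝ :=
  ∑ i : Fin 2, ∑ j ∈ Finset.range (m + 1), (weakDeriv Ω ![j, m - j] (fun y => φ y i) x) ^ 2

/-- The admissible deformations: maps `φ` with components in `W^{m,2}(Ω)`, with `det Dφ > 0` a.e. in
`Ω` and `φ(x) = x` on `∂Ω`. For `m > 2`, elements of `W^{m,2}(Ω)` have a representative that is
continuous on the closure of `Ω`; this is the one that is used. Values of `φ` outside the closure
of `Ω` play no role. -/
structure IsAdmissible (Ω : Set Plane) (m : ℕ) (φ : Plane → Plane) : Prop where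
  continuousOn : ContinuousOn φ (closure Ω)
  memSobolev : ∀ i : Fin 2, MemSobolev Ω m (fun x => φ x i)
  det_pos : ∀ᵐ x ∂(volume.restrict Ω), 0 < (jacobian Ω φ x).det
  eq_on_frontier : ∀ x ∈ frontier Ω, φ x = x

open Classical in
/-- The image `I ∘ φ⁻¹`: its value at `y` is `I x` if `x` is the only preimage of `y` under `φ` in
the closure of `Ω`, and `0` if `y` does not have exactly one preimage. -/
def compInv (Ω : Set Plane) (I : Plane → ℝ) (φ : Plane → Plane) (y : Plane) : ℝ :=
  if h : ∃! x, x ∈ closure Ω ∧ φ x = y then I h.choose else 0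

/-- The divergence of a vector field. -/
def divergence (η : Plane → Plane) (x : Plane) : ℝ :=
  ∑ i : Fin 2, pderiv i (fun y => η y i) x

/-- The total variation of `I` on `Ω`; for `I ∈ L²(Ω)` with `Ω` bounded it is finite
if and only if `I ∈ BV(Ω)`. -/
def TV (Ω : Set Plane) (I : Plane → ℝ) : ℝ≥0∞ :=
  ⨆ (η : Plane → Plane) (_ : IsTest Ω η) (_ : ∀ x, ‖η x‖ ≤ 1),
    ENNReal.ofReal (∫ x in Ω, I x * divergence η x)

/-- The reconstruction functional `𝓔(I; B) = ½ ‖A I - B‖² + α TV(I)`. -/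
def reconstructionEnergy {Y : Type*} [NormedAddCommGroup Y] [InnerProductSpace ℝ Y]
    (Ω : Set Plane) (A : L2 Ω →L[ℝ] Y) (α : ℝ) (I : L2 Ω) (B : Y) : ℝ≥0∞ :=
  ENNReal.ofReal (1 / 2 * ‖A I - B‖ ^ 2) + ENNReal.ofReal α * TV Ω I

/-- The sequence `(I_0, …, I_{K-1}, R)`, that is, `I` extended by `I_K = R`. -/
def extend {Ω : Set Plane} {K : ℕ} (I : Fin K → L2 Ω) (R : L2 Ω) : Fin (K + 1) → L2 Ω :=
  Fin.snoc (α := fun _ => L2 Ω) I R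

/-- The time discrete path functional
`𝓕(I, φ) = ∑_k ∫_Ω W(Dφ_k) + ν |D^m φ_k|² + |I_k ∘ φ_k⁻¹ - I_{k+1}|² dx`, with `I_K = R`. -/
def pathEnergy (Ω : Set Plane) (W : Matrix (Fin 2) (Fin 2) ℝ → ℝ≥0∞) (ν : ℝ) (m : ℕ) {K : ℕ}
    (R : L2 Ω) (I : Fin K → L2 Ω) (φ : Fin K → Plane → Plane) : ℝ≥0∞ :=
  ∑ k : Fin K, ∫⁻ x in Ω,
    (W (jacobian Ω (φ k) x) + ENNReal.ofReal (ν * normSqDm Ω m (φ k) x) +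
      ENNReal.ofReal
        (|compInv Ω (extend I R k.castSucc) (φ k) x - extend I R k.succ x| ^ 2))

/-- The functional `𝓙(I, φ) = 𝓔(I_0; B) + β 𝓕(I, φ)`, subject to `I_K = R`. -/
def totalEnergy {Y : Type*} [NormedAddCommGroup Y] [InnerProductSpace ℝ Y]
    (Ω : Set Plane) (A : L2 Ω →L[ℝ] Y) (B : Y) (W : Matrix (Fin 2) (Fin 2) ℝ → ℝ≥0∞)
    (α β ν : ℝ) (m : ℕ) {K : ℕ} (R : L2 Ω) (I : Fin K → L2 Ω) (φ : Fin K → Plane → Plane) :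
    ℝ≥0∞ :=
  reconstructionEnergy Ω A α (extend I R 0) B +
    ENNReal.ofReal β * pathEnergy Ω W ν m R I φ

end TDM

end

/-!
For fixed deformations `φ_k` the functional is convex in the images, and almost quadratic: it is the
sum of `½‖A I₀ - B‖² + α TV(I₀)`, a finite constant, and `β` times the squared norm of the transport
defects `(I_k ∘ φ_k⁻¹ - I_{k+1})_k`, which are affine in `(I_0, …, I_{K-1})`. A minimiser exists in
a Hilbert space if the sublevel sets are bounded, and it is unique if the linear part of the defects
is injective (`IsConvexLsc.existsUnique_minimiser`). Two analytic facts are behind this.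

*The operators `I ↦ I ∘ φ⁻¹` are bounded and injective on `L²(Ω)`.* Since `m ≥ 3`, the embedding of
`W^{3,2}` into `W^{1,∞}` on Lipschitz domains (`exists_locally_lipschitz`, by integrating mixed
second derivatives of the gradient over parallelograms in `Ω`) shows that `φ`, extended by the
identity, is a Lipschitz map `Φ` of the plane (`IsAdmissible.exists_lipschitzWith_extendId`). The
image of a set under `Φ` is at most a constant times as large as the set, which makes the operator
bounded. As `Φ` is the identity off `Ω` and the Jacobian determinant is a null Lagrangian
(`integral_lineDeriv_mul_lineDeriv_comm`), `Φ` pushes the measure `det DΦ dx` on `Ω` forward to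
Lebesgue measure on `Ω` (`map_withDensity_det_eq`). With `det DΦ > 0` and the area formula on the
pieces of `exists_injOn_partition`, almost every point of `Ω` has exactly one preimage and `Φ` maps
no set of positive measure to a null set, so `I ∘ φ⁻¹ = 0` forces `I = 0`
(`ae_eq_zero_of_compInv_ae_eq_zero`).

*The reconstruction functional controls `‖I₀‖_{L²}`.* On a connected bounded Lipschitz domain
`‖u - c‖_{L²} ≤ C TV(u)` for a suitable constant `c` (`exists_poincare_sobolev`). The local version
near a point of the closure comes from a ball in `Ω` by a shift, local versions are glued along
overlaps, and the exponent is raised from one to two by the Gagliardo–Nirenberg argument. As `A`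
does not annihilate constants, `TV(I₀)` and `‖A I₀‖` bound `I₀` (`exists_norm_le_of_TV_le`), and
the transport defects then bound the other images in turn.
-/

namespace TDM

open MeasureTheory Filter Topology Set
open scoped ENNReal ContDiff

/-! ### The Jacobian as a null Lagrangian -/

section LineDeriv

variable {E : Type*} [NormedAddCommGroup E] [NormedSpace ℝ E]

theorem lineDeriv_eq_zero_of_notMem_tsupport (a : E → ℝ) (z : E) {x : E} (hx : x ∉ tsupport a) :
    lineDeriv ℝ a x z = 0 := by
  have h0 : a =ᶠ[𝓝 x] fun _ => 0 := notMem_tsupport_iff_eventuallyEq.1 hx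
  rw [h0.lineDeriv_eq]
  simp [lineDeriv]

variable [FiniteDimensional ℝ E] [MeasurableSpace E] [BorelSpace E] {μ : Measure E}
  [μ.IsAddHaarMeasure] {C D : NNReal} {a b : E → ℝ}

theorem integrable_lineDeriv (ha : LipschitzWith C a) (hac : HasCompactSupport a) (v : E) :
    Integrable (fun x => lineDeriv ℝ a x v) μ := by
  have : (fun x => lineDeriv ℝ a x v) = (tsupport a).indicator fun x => lineDeriv ℝ a x v := by
    ext x
    by_cases hx : x ∈ tsupport a
    · rw [indicator_of_mem hx]
    · rw [indicator_of_notMem hx, lineDeriv_eq_zero_of_notMem_tsupport _ _ hx]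
  rw [this, integrable_indicator_iff (isClosed_tsupport a).measurableSet]
  exact (ha.locallyIntegrable_lineDeriv v).integrableOn_isCompact hac

theorem integrable_lineDeriv_mul_lineDeriv (ha : LipschitzWith C a) (hac : HasCompactSupport a)
    (hb : LipschitzWith D b) (v w : E) :
    Integrable (fun x => lineDeriv ℝ a x v * lineDeriv ℝ b x w) μ :=
  (integrable_lineDeriv ha hac v).smul_of_top_left (hb.memLp_lineDeriv w)

/-- The integral of the null Lagrangian `∂_v a ∂_w b - ∂_w a ∂_v b` vanishes if `a` has compact
support. Only first derivatives of Lipschitz functions are available, so the second integration by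
parts is performed on difference quotients in the direction `w`. -/
theorem integral_lineDeriv_mul_lineDeriv_comm
    (ha : LipschitzWith C a) (hac : HasCompactSupport a) (hb : LipschitzWith D b) (v w : E) :
    ∫ x, lineDeriv ℝ a x v * lineDeriv ℝ b x w ∂μ
      = ∫ x, lineDeriv ℝ a x w * lineDeriv ℝ b x v ∂μ := by
  -- `K` contains the supports of the difference quotients of `a` with steps at most one; cutting
  -- `∂_v b` off outside `K` makes it integrable
  set K := Metric.cthickening ‖w‖ (tsupport a) with hK
  have hKc : IsCompact K := IsCompact.cthickening hac
  have hint : ∀ (S : Set E) (_ : IsCompact S) (z : E),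
      Integrable (S.indicator fun x => lineDeriv ℝ b x z) μ := fun S hS z => by
    rw [integrable_indicator_iff hS.measurableSet]
    exact (hb.locallyIntegrable_lineDeriv z).integrableOn_isCompact hS
  have hinta := integrable_lineDeriv ha hac v (μ := μ)
  have hL := hb.integral_inv_smul_sub_mul_tendsto_integral_lineDeriv_mul hinta w (μ := μ)
  have hR := ha.integral_inv_smul_sub_mul_tendsto_integral_lineDeriv_mul (hint K hKc v) (-w)
    (μ := μ)
  have hlimR : ∫ x, lineDeriv ℝ a x (-w) * K.indicator (fun x => lineDeriv ℝ b x v) x ∂μ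
      = - ∫ x, lineDeriv ℝ a x w * lineDeriv ℝ b x v ∂μ := by
    rw [← integral_neg]
    congr 1
    ext x
    rw [lineDeriv_neg]
    by_cases hx : x ∈ K
    · rw [indicator_of_mem hx]; ring
    · rw [indicator_of_notMem hx, lineDeriv_eq_zero_of_notMem_tsupport a w
        fun h => hx (Metric.self_subset_cthickening _ h)]
      ring
  -- integrate by parts in `v`, then move the difference quotient in `w` from `b` to `a` by a shift
  have key : ∀ t ∈ Ioc (0 : ℝ) 1,
      ∫ x, (t⁻¹ • (b (x + t • w) - b x)) * lineDeriv ℝ a x v ∂μ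
        = - ∫ x, (t⁻¹ • (a (x + t • (-w)) - a x))
            * K.indicator (fun x => lineDeriv ℝ b x v) x ∂μ := by
    intro t ht
    have hbt : LipschitzWith D (fun x => b (x + t • w)) := by
      simpa [Function.comp_def] using hb.comp (LipschitzWith.id.add (LipschitzWith.const (t • w)))
    have hft : LipschitzWith (‖t⁻¹‖₊ * (D + D)) (fun x => t⁻¹ • (b (x + t • w) - b x)) :=
      (lipschitzWith_smul t⁻¹).comp (hbt.sub hb)
    have h1 := hft.integral_lineDeriv_mul_eq ha hac (-v) (μ := μ)
    rw [neg_neg] at h1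
    have h2 : ∀ᵐ x ∂μ, lineDeriv ℝ (fun x => t⁻¹ • (b (x + t • w) - b x)) x (-v)
        = - (t⁻¹ * (lineDeriv ℝ b (x + t • w) v - lineDeriv ℝ b x v)) := by
      have e1 : ∀ᵐ x ∂μ, LineDifferentiableAt ℝ (fun x => b (x + t • w)) x (-v) :=
        hbt.ae_lineDifferentiableAt _
      filter_upwards [e1, hb.ae_lineDifferentiableAt (-v) (μ := μ)] with x hx1 hx2
      have h3 : HasLineDerivAt ℝ (fun x => t⁻¹ • (b (x + t • w) - b x))
          (t⁻¹ • (lineDeriv ℝ (fun x => b (x + t • w)) x (-v) - lineDeriv ℝ b x (-v))) x (-v) :=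
        HasDerivAt.const_smul t⁻¹ (HasDerivAt.sub hx1.hasLineDerivAt hx2.hasLineDerivAt)
      rw [h3.lineDeriv]
      have h4 : lineDeriv ℝ (fun x => b (x + t • w)) x (-v) = lineDeriv ℝ b (x + t • w) (-v) := by
        simp only [lineDeriv]
        congr 1
        ext s
        congr 1
        abel
      rw [h4, lineDeriv_neg, lineDeriv_neg, smul_eq_mul]
      ring
    set β : E → ℝ := fun x => lineDeriv ℝ b x v with hβ
    have hβm : MemLp β ∞ μ := hb.memLp_lineDeriv v
    have hai : Integrable a μ := ha.continuous.integrable_of_hasCompactSupport hac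
    have hi1 : Integrable (fun x => β x * a x) μ := by
      exact hai.smul_of_top_right hβm
    have hβt : MemLp (fun x => β (x + t • w)) ∞ μ :=
      hβm.comp_measurePreserving (measurePreserving_add_right μ (t • w))
    have hi2 : Integrable (fun x => β (x + t • w) * a x) μ := by
      exact hai.smul_of_top_right hβt
    have hat : Integrable (fun x => a (x + t • (-w))) μ := hai.comp_add_right (t • (-w))
    have hi3 : Integrable (fun x => β x * a (x + t • (-w))) μ := by
      exact hat.smul_of_top_right hβm
    have hshift : ∫ x, β (x + t • w) * a x ∂μ = ∫ x, β x * a (x + t • (-w)) ∂μ := by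
      rw [← integral_add_right_eq_self _ (t • (-w))]
      simp
    calc ∫ x, (t⁻¹ • (b (x + t • w) - b x)) * lineDeriv ℝ a x v ∂μ
        = ∫ x, lineDeriv ℝ (fun x => t⁻¹ • (b (x + t • w) - b x)) x (-v) * a x ∂μ := by
          rw [h1]; congr 1; ext x; ring
      _ = ∫ x, -t⁻¹ * (β (x + t • w) * a x - β x * a x) ∂μ := by
          refine integral_congr_ae ?_
          filter_upwards [h2] with x hx
          rw [hx]; ring
      _ = -t⁻¹ * (∫ x, β x * a (x + t • (-w)) ∂μ - ∫ x, β x * a x ∂μ) := by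
          rw [integral_const_mul, integral_sub hi2 hi1, hshift]
      _ = ∫ x, -((t⁻¹ • (a (x + t • (-w)) - a x)) * K.indicator β x) ∂μ := by
          rw [← integral_sub hi3 hi1, ← integral_const_mul]
          congr 1
          ext x
          by_cases hx : x ∈ K
          · rw [indicator_of_mem hx, smul_eq_mul]; ring
          · have e1 : a x = 0 := by
              by_contra h
              exact hx (Metric.self_subset_cthickening _ (subset_tsupport _ h))
            have e2 : a (x + t • (-w)) = 0 := by
              by_contra h
              refine hx (Metric.mem_cthickening_of_dist_le _ _ _ _ (subset_tsupport _ h) ?_)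
              simp only [dist_eq_norm, sub_add_cancel_left, norm_smul, smul_neg, neg_neg,
                Real.norm_eq_abs, abs_of_nonneg ht.1.le]
              exact mul_le_of_le_one_left (norm_nonneg _) ht.2
            rw [e1, e2]; ring
      _ = _ := integral_neg _
  have heq : (fun t : ℝ => ∫ x, (t⁻¹ • (b (x + t • w) - b x)) * lineDeriv ℝ a x v ∂μ)
      =ᶠ[𝓝[>] 0] fun t => - ∫ x, (t⁻¹ • (a (x + t • (-w)) - a x))
            * K.indicator (fun x => lineDeriv ℝ b x v) x ∂μ := by
    filter_upwards [Ioc_mem_nhdsGT zero_lt_one] with t ht using key t ht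
  have := tendsto_nhds_unique (hL.congr' heq) hR.neg
  rw [hlimR, neg_neg] at this
  rw [← this]
  congr 1
  ext x
  ring

end LineDeriv

/-! ### Coordinates of the plane -/

/-- The `i`-th standard basis vector of the plane. -/
noncomputable abbrev basisVec (i : Fin 2) : Plane := EuclideanSpace.single i 1

theorem eq_basisVec_sum (x : Plane) : x = x 0 • basisVec 0 + x 1 • basisVec 1 := by
  ext i; fin_cases i <;> simp [basisVec]

theorem continuousLinearMap_det_eq (F : Plane →L[ℝ] Plane) :
    F.det = F (basisVec 0) 0 * F (basisVec 1) 1 - F (basisVec 1) 0 * F (basisVec 0) 1 := by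
  rw [ContinuousLinearMap.det, ← LinearMap.det_toMatrix (EuclideanSpace.basisFun (Fin 2) ℝ).toBasis,
    Matrix.det_fin_two]
  simp [LinearMap.toMatrix_apply, basisVec]

theorem abs_apply_le_norm (x : Plane) (i : Fin 2) : |x i| ≤ ‖x‖ := by
  simpa using PiLp.norm_apply_le x i

theorem abs_det_le (F : Plane →L[ℝ] Plane) : |F.det| ≤ 2 * ‖F‖ ^ 2 := by
  have h : ∀ i j, |F (basisVec i) j| ≤ ‖F‖ := fun i j =>
    (abs_apply_le_norm _ j).trans (by simpa [basisVec] using F.le_opNorm (basisVec i))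
  rw [continuousLinearMap_det_eq]
  have h1 : |F (basisVec 0) 0 * F (basisVec 1) 1| ≤ ‖F‖ * ‖F‖ := by
    rw [abs_mul]; gcongr <;> exact h _ _
  have h2 : |F (basisVec 1) 0 * F (basisVec 0) 1| ≤ ‖F‖ * ‖F‖ := by
    rw [abs_mul]; gcongr <;> exact h _ _
  have h3 := norm_sub_le (F (basisVec 0) 0 * F (basisVec 1) 1) (F (basisVec 1) 0 * F (basisVec 0) 1)
  simp only [Real.norm_eq_abs] at h3
  nlinarith

/-! ### The change of variables formula -/

section Degree

variable {Ω : Set Plane} {Φ : Plane → Plane} {L : NNReal}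

theorem hasCompactSupport_of_forall_notMem (hΩb : Bornology.IsBounded Ω) {a : Plane → ℝ}
    (h : ∀ x, x ∉ Ω → a x = 0) : HasCompactSupport a :=
  HasCompactSupport.intro hΩb.isCompact_closure fun x hx => h x fun hx' => hx (subset_closure hx')

/-- A Lipschitz map that is the identity off `Ω` has degree one over `Ω`, in the form of a change
of variables for ridge functions: the Jacobian is a null Lagrangian, so that the integral only sees
the boundary values. -/
theorem setIntegral_comp_mul_det_eq (hΩb : Bornology.IsBounded Ω)
    (hfr : volume (frontier Ω) = 0) (hΦ : LipschitzWith L Φ) (hid : ∀ x, x ∉ Ω → Φ x = x)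
    {p p' : ℝ → ℝ} {C : NNReal} (hp : ∀ t, HasDerivAt p (p' t) t) (hpL : LipschitzWith C p)
    {ξ η : Plane} (hξη : ξ 0 * η 1 - ξ 1 * η 0 ≠ 0) :
    ∫ x in Ω, (p' (inner ℝ ξ (Φ x)) * (fderiv ℝ Φ x).det - p' (inner ℝ ξ x)) = 0 := by
  set lξ : Plane →L[ℝ] ℝ := innerSL ℝ ξ
  set lη : Plane →L[ℝ] ℝ := innerSL ℝ η
  set u : Plane → ℝ := fun x => p (lξ x) with hu
  have huL : LipschitzWith (C * ‖lξ‖₊) u := hpL.comp lξ.lipschitz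
  set a : Plane → ℝ := fun x => u (Φ x) - u x with ha
  set b : Plane → ℝ := fun x => lη (Φ x) with hb
  set a' : Plane → ℝ := fun x => lη (Φ x) - lη x with ha'
  have hbL : LipschitzWith (‖lη‖₊ * L) b := lη.lipschitz.comp hΦ
  have haL : LipschitzWith _ a := (huL.comp hΦ).sub huL
  have ha'L : LipschitzWith _ a' := hbL.sub lη.lipschitz
  have hac : HasCompactSupport a :=
    hasCompactSupport_of_forall_notMem hΩb fun x hx => by simp [ha, hid x hx]
  have ha'c : HasCompactSupport a' :=
    hasCompactSupport_of_forall_notMem hΩb fun x hx => by simp [ha', hid x hx]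
  -- with `d(u ∘ Φ) ∧ db` and `du ∧ d(lη)` as the two sides of the formula, the difference of the
  -- two forms is `da ∧ db - da' ∧ du`, in which `a` and `a'` have compact support
  have key1 := integral_lineDeriv_mul_lineDeriv_comm (μ := volume) haL hac hbL
    (basisVec 0) (basisVec 1)
  have key2 := integral_lineDeriv_mul_lineDeriv_comm (μ := volume) ha'L ha'c huL
    (basisVec 0) (basisVec 1)
  have I1 := integrable_lineDeriv_mul_lineDeriv (μ := volume) haL hac hbL
  have I2 := integrable_lineDeriv_mul_lineDeriv (μ := volume) ha'L ha'c huL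
  set d : ℝ := ξ 0 * η 1 - ξ 1 * η 0 with hd
  set g : Plane → ℝ := fun x => d * (p' (inner ℝ ξ (Φ x)) * (fderiv ℝ Φ x).det - p' (inner ℝ ξ x))
    with hg
  have hinner : ∀ (ζ : Plane) (y : Plane), inner ℝ ζ y = ζ 0 * y 0 + ζ 1 * y 1 := fun ζ y => by
    simp [PiLp.inner_apply, Fin.sum_univ_two, mul_comm]
  have hae : ∀ᵐ x : Plane, g x =
      (lineDeriv ℝ a x (basisVec 0) * lineDeriv ℝ b x (basisVec 1)
        - lineDeriv ℝ a x (basisVec 1) * lineDeriv ℝ b x (basisVec 0))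
      - (lineDeriv ℝ a' x (basisVec 0) * lineDeriv ℝ u x (basisVec 1)
        - lineDeriv ℝ a' x (basisVec 1) * lineDeriv ℝ u x (basisVec 0)) := by
    filter_upwards [hΦ.ae_differentiableAt] with x hx
    have hF := hx.hasFDerivAt
    set F := fderiv ℝ Φ x with hFdef
    have hlin : ∀ (l : Plane →L[ℝ] ℝ), HasFDerivAt (fun x => l x) l x := fun l => l.hasFDerivAt
    have huF : HasFDerivAt u (p' (lξ x) • lξ) x := (hp (lξ x)).comp_hasFDerivAt x (hlin lξ)
    have hbF : HasFDerivAt b (lη.comp F) x := lη.hasFDerivAt.comp x hF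
    have haF : HasFDerivAt a (p' (lξ (Φ x)) • (lξ.comp F) - p' (lξ x) • lξ) x :=
      ((hp (lξ (Φ x))).comp_hasFDerivAt x (lξ.hasFDerivAt.comp x hF)).sub huF
    have ha'F : HasFDerivAt a' (lη.comp F - lη) x := hbF.sub (hlin lη)
    rw [(haF.hasLineDerivAt _).lineDeriv, (haF.hasLineDerivAt _).lineDeriv,
      (ha'F.hasLineDerivAt _).lineDeriv, (ha'F.hasLineDerivAt _).lineDeriv,
      (hbF.hasLineDerivAt _).lineDeriv, (hbF.hasLineDerivAt _).lineDeriv,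
      (huF.hasLineDerivAt _).lineDeriv, (huF.hasLineDerivAt _).lineDeriv]
    simp only [hg, hd, continuousLinearMap_det_eq, sub_apply,
      smul_apply, ContinuousLinearMap.comp_apply, lξ, lη, innerSL_apply_apply,
      smul_eq_mul]
    have e1 : ∀ ζ : Plane, inner ℝ ζ (basisVec 0) = ζ 0 := fun ζ => by simp [hinner, basisVec]
    have e2 : ∀ ζ : Plane, inner ℝ ζ (basisVec 1) = ζ 1 := fun ζ => by simp [hinner, basisVec]
    simp only [e1, e2]
    rw [hinner ξ (F _), hinner ξ (F _), hinner η (F _), hinner η (F _)]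
    ring
  have hg0 : ∫ x, g x = 0 := by
    rw [integral_congr_ae hae, integral_sub, integral_sub (I1 _ _) (I1 _ _),
      integral_sub (I2 _ _) (I2 _ _), key1, key2]
    · ring
    · exact (I1 _ _).sub (I1 _ _)
    · exact (I2 _ _).sub (I2 _ _)
  have hgΩ : ∫ x in Ω, g x = ∫ x, g x := by
    refine setIntegral_eq_integral_of_ae_compl_eq_zero ?_
    have : ∀ᵐ x : Plane, x ∉ frontier Ω := measure_eq_zero_iff_ae_notMem.1 hfr
    filter_upwards [this] with x hx hxΩ
    have hxc : x ∉ closure Ω := fun h => hx ⟨h, fun h' => hxΩ (interior_subset h')⟩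
    have hloc : Φ =ᶠ[𝓝 x] id := by
      filter_upwards [isClosed_closure.isOpen_compl.mem_nhds hxc] with y hy
      exact hid y fun h => hy (subset_closure h)
    simp only [hg, hloc.fderiv_eq, hloc.eq_of_nhds, fderiv_id]
    simp [ContinuousLinearMap.det]
  rw [hg0, hg, integral_const_mul] at hgΩ
  exact (mul_eq_zero.1 hgΩ).resolve_left hξη

theorem aestronglyMeasurable_det_fderiv (μ : Measure Plane) :
    AEStronglyMeasurable (fun x => (fderiv ℝ Φ x).det) μ :=
  (ContinuousLinearMap.continuous_det.measurable.comp (measurable_fderiv ℝ Φ)).aestronglyMeasurable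

theorem integrableOn_mul_det_fderiv (hΩb : Bornology.IsBounded Ω) (hΦ : LipschitzWith L Φ)
    {f : Plane → ℝ} {C : ℝ} (hf : AEStronglyMeasurable f (volume.restrict Ω))
    (hfC : ∀ x, |f x| ≤ C) :
    IntegrableOn (fun x => f x * (fderiv ℝ Φ x).det) Ω := by
  have : IsFiniteMeasure (volume.restrict Ω) := ⟨by simpa using hΩb.measure_lt_top⟩
  refine Integrable.of_bound (C := C * (2 * (L : ℝ) ^ 2))
    (hf.mul (aestronglyMeasurable_det_fderiv _)) (.of_forall fun x => ?_)
  rw [Real.norm_eq_abs, abs_mul]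
  have h1 : ‖fderiv ℝ Φ x‖ ≤ L := norm_fderiv_le_of_lipschitz ℝ hΦ
  have h2 := abs_det_le (fderiv ℝ Φ x)
  have h3 : 0 ≤ C := (abs_nonneg _).trans (hfC x)
  exact mul_le_mul (hfC x) (h2.trans (by gcongr)) (abs_nonneg _) h3

/-- The measure `det DΦ dx` on `Ω`, pushed forward by `Φ`, is Lebesgue measure on `Ω`. The two
finite measures have the same characteristic function. -/
theorem map_withDensity_det_eq (hΩb : Bornology.IsBounded Ω)
    (hfr : volume (frontier Ω) = 0) (hΦ : LipschitzWith L Φ) (hid : ∀ x, x ∉ Ω → Φ x = x)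
    (hpos : ∀ᵐ x ∂(volume.restrict Ω), 0 < (fderiv ℝ Φ x).det) :
    ((volume.restrict Ω).withDensity fun x => ENNReal.ofReal (fderiv ℝ Φ x).det).map Φ
      = volume.restrict Ω := by
  have hfin : IsFiniteMeasure (volume.restrict Ω) := ⟨by simpa using hΩb.measure_lt_top⟩
  set J : Plane → ℝ := fun x => (fderiv ℝ Φ x).det with hJ
  have hJm : Measurable J :=
    ContinuousLinearMap.continuous_det.measurable.comp (measurable_fderiv ℝ Φ)
  have hJi : IntegrableOn J Ω := by
    simpa using integrableOn_mul_det_fderiv (f := fun _ => 1) (C := 1) hΩb hΦ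
      aestronglyMeasurable_const (by simp)
  set ν := (volume.restrict Ω).withDensity fun x => ENNReal.ofReal (J x) with hν
  have hνfin : IsFiniteMeasure ν := isFiniteMeasure_withDensity_ofReal hJi.2
  have hΦm : Measurable Φ := hΦ.continuous.measurable
  have hνmap : IsFiniteMeasure (ν.map Φ) := Measure.isFiniteMeasure_map _ _
  -- the real and imaginary parts of the characters are ridge functions
  have real_case : ∀ (ξ : Plane) (p p' : ℝ → ℝ) (η : Plane), (∀ t, HasDerivAt p (p' t) t) →
      Continuous p' → (∀ t, |p' t| ≤ 1) → ξ 0 * η 1 - ξ 1 * η 0 ≠ 0 →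
      ∫ x in Ω, p' (inner ℝ ξ (Φ x)) * J x = ∫ x in Ω, p' (inner ℝ ξ x) := by
    intro ξ p p' η hp hc hb hne
    have hL : LipschitzWith 1 p := lipschitzWith_of_nnnorm_deriv_le
      (fun t => (hp t).differentiableAt) fun t => by
        rw [(hp t).deriv, ← NNReal.coe_le_coe]; simpa using hb t
    have h := setIntegral_comp_mul_det_eq hΩb hfr hΦ hid hp hL hne
    have hc1 : Continuous fun x => p' (inner ℝ ξ (Φ x)) :=
      hc.comp (continuous_const.inner hΦ.continuous)
    have hc2 : Continuous fun x : Plane => p' (inner ℝ ξ x) :=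
      hc.comp (continuous_const.inner continuous_id)
    rw [integral_sub] at h
    · linarith
    · exact integrableOn_mul_det_fderiv hΩb hΦ hc1.aestronglyMeasurable fun x => hb _
    · exact Measure.integrableOn_of_bounded (M := 1) hΩb.measure_lt_top.ne
        hc2.aestronglyMeasurable (.of_forall fun x => hb _)
  have lhs : ∀ ξ : Plane, charFun (ν.map Φ) ξ
      = ∫ x in Ω, (J x : ℂ) * Complex.exp ((inner ℝ (Φ x) ξ : ℝ) * Complex.I) := by
    intro ξ
    rw [charFun_apply, integral_map hΦm.aemeasurable
      (Continuous.aestronglyMeasurable (by fun_prop)), hν,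
      integral_withDensity_eq_integral_toReal_smul (by fun_prop)
        (.of_forall fun _ => ENNReal.ofReal_lt_top)]
    refine integral_congr_ae ?_
    filter_upwards [hpos] with x hx
    rw [ENNReal.toReal_ofReal hx.le, Complex.real_smul]
  refine Measure.ext_of_charFun (funext fun ξ => ?_)
  rw [lhs, charFun_apply]
  by_cases hξ : ξ = 0
  · subst hξ
    have h := real_case (basisVec 0) (fun t => t) (fun _ => 1) (basisVec 1)
      (fun t => hasDerivAt_id t) continuous_const (by simp) (by simp [basisVec])
    simp only [one_mul] at h
    simp only [inner_zero_right, Complex.ofReal_zero, zero_mul, Complex.exp_zero, mul_one]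
    rw [integral_complex_ofReal, h]
    simp
  · set η : Plane := !₂[-ξ 1, ξ 0]
    have hne : ξ 0 * η 1 - ξ 1 * η 0 ≠ 0 := by
      intro h0
      apply hξ
      have h0' : ξ 0 ^ 2 + ξ 1 ^ 2 = 0 := by simp [η] at h0; nlinarith
      ext i
      fin_cases i <;> simp <;> nlinarith [sq_nonneg (ξ 0), sq_nonneg (ξ 1)]
    have hcos := real_case ξ Real.sin Real.cos η Real.hasDerivAt_sin Real.continuous_cos
      Real.abs_cos_le_one hne
    have hsin := real_case ξ (fun t => -Real.cos t) Real.sin η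
      (fun t => by simpa using (Real.hasDerivAt_cos t).fun_neg) Real.continuous_sin
      Real.abs_sin_le_one hne
    have hc1 : Continuous fun x => (inner ℝ ξ (Φ x) : ℝ) := continuous_const.inner hΦ.continuous
    have hc2 : Continuous fun x : Plane => (inner ℝ ξ x : ℝ) := continuous_const.inner continuous_id
    have ib : ∀ {q : ℝ → ℝ}, Continuous q → (∀ t, |q t| ≤ 1) →
        IntegrableOn (fun x : Plane => q (inner ℝ ξ x)) Ω := fun hq hq1 =>
      Measure.integrableOn_of_bounded (M := 1) hΩb.measure_lt_top.ne
        (hq.comp hc2).aestronglyMeasurable (.of_forall fun x => hq1 _)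
    have ia : ∀ {q : ℝ → ℝ}, Continuous q → (∀ t, |q t| ≤ 1) →
        IntegrableOn (fun x : Plane => q (inner ℝ ξ (Φ x)) * J x) Ω := fun hq hq1 =>
      integrableOn_mul_det_fderiv hΩb hΦ (hq.comp hc1).aestronglyMeasurable fun x => hq1 _
    have e1 : ∀ x, (J x : ℂ) * Complex.exp ((inner ℝ (Φ x) ξ : ℝ) * Complex.I)
        = ((Real.cos (inner ℝ ξ (Φ x)) * J x : ℝ) : ℂ)
          + ((Real.sin (inner ℝ ξ (Φ x)) * J x : ℝ) : ℂ) * Complex.I := fun x => by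
      rw [Complex.exp_mul_I, real_inner_comm]; push_cast; ring
    have e2 : ∀ x : Plane, Complex.exp ((inner ℝ x ξ : ℝ) * Complex.I)
        = ((Real.cos (inner ℝ ξ x) : ℝ) : ℂ)
          + ((Real.sin (inner ℝ ξ x) : ℝ) : ℂ) * Complex.I := fun x => by
      rw [Complex.exp_mul_I, real_inner_comm]; push_cast; ring
    simp_rw [e1, e2]
    rw [integral_add (ia Real.continuous_cos Real.abs_cos_le_one).ofReal
        ((ia Real.continuous_sin Real.abs_sin_le_one).ofReal.mul_const _),
      integral_add (ib Real.continuous_cos Real.abs_cos_le_one).ofReal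
        ((ib Real.continuous_sin Real.abs_sin_le_one).ofReal.mul_const _),
      integral_mul_const, integral_mul_const]
    simp only [integral_complex_ofReal, hcos, hsin]

end Degree

/-! ### Lipschitz maps and Lebesgue measure -/

/-- The plane carries its two-dimensional Hausdorff measure as a multiple of Lebesgue measure, and
Hausdorff measures behave well under Lipschitz maps. -/
theorem volume_image_le_of_lipschitzWith {Φ : Plane → Plane} {L : NNReal} (hΦ : LipschitzWith L Φ)
    (S : Set Plane) : volume (Φ '' S) ≤ (L : ℝ≥0∞) ^ (2 : ℝ) * volume S := by
  have hH : (Measure.hausdorffMeasure (Module.finrank ℝ Plane) : Measure Plane).IsAddHaarMeasure :=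
    isAddHaarMeasure_hausdorffMeasure
  have hfr : ((Module.finrank ℝ Plane : ℕ) : ℝ) = 2 := by simp [Plane]
  rw [hfr] at hH
  have h := Measure.isAddLeftInvariant_eq_smul (volume : Measure Plane)
    (Measure.hausdorffMeasure 2 : Measure Plane)
  rw [h]
  simp only [Measure.smul_apply, ENNReal.smul_def, smul_eq_mul]
  rw [mul_left_comm]
  gcongr
  exact hΦ.hausdorffMeasure_image_le (by norm_num) S

/-- The set where a Lipschitz map has positive Jacobian splits into countably many measurable
pieces on which the map is injective. -/
theorem exists_injOn_partition {Ω : Set Plane} (hΩ : MeasurableSet Ω) (Φ : Plane → Plane) :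
    ∃ G : ℕ → Set Plane, (∀ n, MeasurableSet (G n)) ∧ Pairwise (Function.onFun Disjoint G) ∧
      (∀ n, InjOn Φ (G n)) ∧
      (⋃ n, G n) = {x ∈ Ω | DifferentiableAt ℝ Φ x ∧ 0 < (fderiv ℝ Φ x).det} := by
  classical
  set S := {x ∈ Ω | DifferentiableAt ℝ Φ x ∧ 0 < (fderiv ℝ Φ x).det} with hS
  have hSm : MeasurableSet S := hΩ.inter ((measurableSet_of_differentiableAt ℝ Φ).inter
    (measurableSet_lt measurable_const
      (ContinuousLinearMap.continuous_det.measurable.comp (measurable_fderiv ℝ Φ))))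
  -- a map that is `r A`-close to an invertible linear map `A` is injective
  let r : (Plane →L[ℝ] Plane) → NNReal := fun A =>
    if h : A.det ≠ 0 then
      ‖((A.toContinuousLinearEquivOfDetNeZero h).symm : Plane →L[ℝ] Plane)‖₊⁻¹ / 2
    else 1
  have hr : ∀ (A : Plane →L[ℝ] Plane) (h : A.det ≠ 0),
      0 < ‖((A.toContinuousLinearEquivOfDetNeZero h).symm : Plane →L[ℝ] Plane)‖₊⁻¹ := by
    intro A h
    rw [inv_pos]
    exact ContinuousLinearEquiv.nnnorm_symm_pos _
  have hr0 : ∀ A, r A ≠ 0 := by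
    intro A
    by_cases h : A.det ≠ 0
    · simp only [r, dif_pos h]
      exact (half_pos (hr A h)).ne'
    · simp only [r, dif_neg h]; exact one_ne_zero
  obtain ⟨t, A, htd, htm, hst, happ, hA⟩ :=
    exists_partition_approximatesLinearOn_of_hasFDerivWithinAt Φ S (fderiv ℝ Φ)
      (fun x hx => hx.2.1.hasFDerivAt.hasFDerivWithinAt) r hr0
  refine ⟨fun n => S ∩ t n, fun n => hSm.inter (htm n), fun i j hij =>
    (htd hij).mono inter_subset_right inter_subset_right, fun n => ?_, ?_⟩
  · rcases S.eq_empty_or_nonempty with h | h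
    · simp [h]
    · obtain ⟨y, hy, hAy⟩ := hA h n
      have hd : (A n).det ≠ 0 := by rw [hAy]; exact hy.2.2.ne'
      have h1 := happ n
      have h2 : ((((A n).toContinuousLinearEquivOfDetNeZero hd) : Plane →L[ℝ] Plane)) = A n := by
        ext x; simp
      rw [← h2] at h1
      refine h1.injOn (Or.inr ?_)
      rw [h2]
      simp only [r, dif_pos hd]
      exact half_lt_self (hr _ hd)
  · rw [← inter_iUnion]
    exact inter_eq_left.2 hst

/-! ### Composition with the inverse deformation -/

section Inverse

variable {Ω : Set Plane} {Φ : Plane → Plane} {L : NNReal}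

/-- The points with exactly one preimage under `Φ` in the closure of `Ω`. -/
def uniqueValues (Ω : Set Plane) (Φ : Plane → Plane) : Set Plane :=
  {y | ∃! x, x ∈ closure Ω ∧ Φ x = y}

open Classical in
/-- The inverse of `Φ` on `uniqueValues Ω Φ`, extended by the identity. The values off
`uniqueValues Ω Φ` play no role. -/
noncomputable def partialInverse (Ω : Set Plane) (Φ : Plane → Plane) (y : Plane) : Plane :=
  if h : ∃! x, x ∈ closure Ω ∧ Φ x = y then h.choose else y

theorem partialInverse_spec {y : Plane} (h : y ∈ uniqueValues Ω Φ) :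
    partialInverse Ω Φ y ∈ closure Ω ∧ Φ (partialInverse Ω Φ y) = y := by
  have h' : ∃! x, x ∈ closure Ω ∧ Φ x = y := h
  rw [partialInverse, dif_pos h']
  exact h'.choose_spec.1

theorem partialInverse_eq {x y : Plane} (h : y ∈ uniqueValues Ω Φ) (hx : x ∈ closure Ω)
    (hxy : Φ x = y) : partialInverse Ω Φ y = x :=
  ExistsUnique.unique h (partialInverse_spec h) ⟨hx, hxy⟩

theorem compInv_eq_indicator (I : Plane → ℝ) :
    compInv Ω I Φ = (uniqueValues Ω Φ).indicator fun y => I (partialInverse Ω Φ y) := by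
  ext y
  by_cases h : y ∈ uniqueValues Ω Φ
  · have h' : ∃! x, x ∈ closure Ω ∧ Φ x = y := h
    rw [indicator_of_mem h, compInv, dif_pos h', partialInverse, dif_pos h']
  · have h' : ¬ ∃! x, x ∈ closure Ω ∧ Φ x = y := h
    rw [indicator_of_notMem h, compInv, dif_neg h']

theorem compInv_congr {φ : Plane → Plane} (h : EqOn φ Φ (closure Ω)) (I : Plane → ℝ) :
    compInv Ω I φ = compInv Ω I Φ := by
  have h' : ∀ y x, (x ∈ closure Ω ∧ φ x = y) ↔ (x ∈ closure Ω ∧ Φ x = y) := fun y x =>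
    and_congr_right fun hx => by rw [h hx]
  have hU : uniqueValues Ω φ = uniqueValues Ω Φ := by
    ext y; exact existsUnique_congr fun x => h' y x
  rw [compInv_eq_indicator, compInv_eq_indicator, hU]
  ext y
  by_cases hy : y ∈ uniqueValues Ω Φ
  · rw [indicator_of_mem hy, indicator_of_mem hy]
    have hs := partialInverse_spec hy
    rw [partialInverse_eq (hU ▸ hy : y ∈ uniqueValues Ω φ) hs.1 ((h hs.1).trans hs.2)]
  · rw [indicator_of_notMem hy, indicator_of_notMem hy]

theorem measurableSet_uniqueValues (hΩb : Bornology.IsBounded Ω) (hΦ : Continuous Φ) :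
    MeasurableSet (uniqueValues Ω Φ) := by
  have hK : IsCompact (closure Ω) := hΩb.isCompact_closure
  -- the values with two preimages at distance at least `1 / (n + 1)` form a compact set
  let D : ℕ → Set (Plane × Plane) := fun n =>
    (closure Ω ×ˢ closure Ω) ∩ {q | 1 / ((n : ℝ) + 1) ≤ dist q.1 q.2 ∧ Φ q.1 = Φ q.2}
  have hD : ∀ n, IsCompact (D n) := fun n => (hK.prod hK).inter_right <| by
    rw [Set.ofPred_and]
    exact (isClosed_le continuous_const (by fun_prop)).inter
      (isClosed_eq (by fun_prop) (by fun_prop))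
  have h : uniqueValues Ω Φ = Φ '' closure Ω \ ⋃ n, (fun q : Plane × Plane => Φ q.1) '' D n := by
    ext y
    constructor
    · rintro ⟨x, ⟨hx, hxy⟩, hu⟩
      refine ⟨⟨x, hx, hxy⟩, ?_⟩
      simp only [mem_iUnion, not_exists]
      rintro n ⟨⟨a, b⟩, ⟨⟨ha, hb⟩, hd, hab⟩, hy⟩
      have e1 := hu a ⟨ha, hy⟩
      have e2 := hu b ⟨hb, hab ▸ hy⟩
      simp only [e1, e2, dist_self] at hd
      have : (0 : ℝ) < 1 / ((n : ℝ) + 1) := by positivity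
      linarith
    · rintro ⟨⟨x, hx, hxy⟩, hn⟩
      refine ⟨x, ⟨hx, hxy⟩, fun z hz => ?_⟩
      by_contra hne
      obtain ⟨n, hn'⟩ := exists_nat_one_div_lt (dist_pos.2 hne)
      exact hn (mem_iUnion.2 ⟨n, (z, x), ⟨⟨hz.1, hx⟩, hn'.le, hz.2.trans hxy.symm⟩, hz.2⟩)
  rw [h]
  exact (hK.image hΦ).measurableSet.diff
    (MeasurableSet.iUnion fun n => ((hD n).image (by fun_prop)).measurableSet)

theorem measurable_partialInverse (hΩb : Bornology.IsBounded Ω) (hΦ : Continuous Φ) :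
    Measurable (partialInverse Ω Φ) := by
  have hU := measurableSet_uniqueValues hΩb hΦ
  refine measurable_of_isClosed fun C hC => ?_
  have : partialInverse Ω Φ ⁻¹' C =
      (uniqueValues Ω Φ ∩ Φ '' (closure Ω ∩ C)) ∪ ((uniqueValues Ω Φ)ᶜ ∩ C) := by
    ext y
    by_cases hy : y ∈ uniqueValues Ω Φ
    · have hs := partialInverse_spec hy
      simp only [mem_preimage, mem_union, mem_inter_iff, hy, true_and, mem_compl_iff, not_true,
        false_and, or_false]
      constructor
      · exact fun h => ⟨_, ⟨hs.1, h⟩, hs.2⟩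
      · rintro ⟨x, ⟨hx, hxC⟩, hxy⟩
        rwa [partialInverse_eq hy hx hxy]
    · have h' : ¬ ∃! x, x ∈ closure Ω ∧ Φ x = y := hy
      simp only [mem_preimage, mem_union, mem_inter_iff, hy, false_and, mem_compl_iff,
        not_false_iff, true_and, false_or, partialInverse, dif_neg h']
  rw [this]
  exact (hU.inter ((hΩb.isCompact_closure.inter_right hC).image hΦ).measurableSet).union
    (hU.compl.inter hC.measurableSet)

/-- A point of `Ω` has its preimages in `Ω`, because boundary points are fixed. -/
theorem mem_of_apply_mem (hid : ∀ x, x ∉ Ω → Φ x = x) {x : Plane} (h : Φ x ∈ Ω) : x ∈ Ω := by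
  by_contra hx
  exact hx (hid x hx ▸ h)

/-- A set `S` is the preimage under `partialInverse` of a subset of the Lipschitz image `Φ '' S`. -/
theorem map_partialInverse_le (hΩb : Bornology.IsBounded Ω)
    (hΦ : LipschitzWith L Φ) (hid : ∀ x, x ∉ Ω → Φ x = x) :
    (volume.restrict (uniqueValues Ω Φ ∩ Ω)).map (partialInverse Ω Φ)
      ≤ ((L : ℝ≥0∞) ^ (2 : ℝ)) • volume.restrict Ω := by
  refine Measure.le_iff.2 fun S hS => ?_
  have hm := measurable_partialInverse hΩb hΦ.continuous
  rw [Measure.map_apply hm hS, Measure.restrict_apply (hm hS), Measure.smul_apply,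
    Measure.restrict_apply hS, smul_eq_mul]
  refine le_trans (measure_mono ?_) (volume_image_le_of_lipschitzWith hΦ (S ∩ Ω))
  rintro y ⟨hyS, hyU, hyΩ⟩
  have hs := partialInverse_spec hyU
  exact ⟨_, ⟨hyS, mem_of_apply_mem hid (hs.2.symm ▸ hyΩ)⟩, hs.2⟩

/-- Composition with the inverse deformation is well defined on classes of functions that agree
almost everywhere. -/
theorem compInv_ae_congr (hΩb : Bornology.IsBounded Ω)
    (hΦ : LipschitzWith L Φ) (hid : ∀ x, x ∉ Ω → Φ x = x) {I I' : Plane → ℝ}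
    (h : I =ᵐ[volume.restrict Ω] I') :
    compInv Ω I Φ =ᵐ[volume.restrict Ω] compInv Ω I' Φ := by
  have hm := measurable_partialInverse hΩb hΦ.continuous
  have hac : (volume.restrict (uniqueValues Ω Φ ∩ Ω)).map (partialInverse Ω Φ)
      ≪ volume.restrict Ω :=
    (Measure.absolutelyContinuous_of_le (map_partialInverse_le hΩb hΦ hid)).trans
      Measure.smul_absolutelyContinuous
  have h1 := ae_of_ae_map hm.aemeasurable (hac.ae_le h)
  rw [compInv_eq_indicator, compInv_eq_indicator]
  have hU := measurableSet_uniqueValues hΩb hΦ.continuous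
  rw [← Measure.restrict_restrict hU, ae_restrict_iff' hU] at h1
  filter_upwards [h1] with y hy
  by_cases hyU : y ∈ uniqueValues Ω Φ
  · rw [indicator_of_mem hyU, indicator_of_mem hyU, hy hyU]
  · rw [indicator_of_notMem hyU, indicator_of_notMem hyU]

theorem eLpNorm_compInv_le (hΩb : Bornology.IsBounded Ω)
    (hΦ : LipschitzWith L Φ) (hid : ∀ x, x ∉ Ω → Φ x = x) {I : Plane → ℝ}
    (hI : Measurable I) :
    eLpNorm (compInv Ω I Φ) 2 (volume.restrict Ω) ≤ L * eLpNorm I 2 (volume.restrict Ω) := by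
  have hm := measurable_partialInverse hΩb hΦ.continuous
  have hU := measurableSet_uniqueValues hΩb hΦ.continuous
  rw [compInv_eq_indicator, eLpNorm_indicator_eq_eLpNorm_restrict hU, Measure.restrict_restrict hU]
  calc _ = eLpNorm I 2 ((volume.restrict (uniqueValues Ω Φ ∩ Ω)).map (partialInverse Ω Φ)) :=
        (eLpNorm_map_measure hI.aestronglyMeasurable hm.aemeasurable).symm
    _ ≤ eLpNorm I 2 (((L : ℝ≥0∞) ^ (2 : ℝ)) • volume.restrict Ω) :=
        eLpNorm_mono_measure _ (map_partialInverse_le hΩb hΦ hid)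
    _ ≤ _ := by
        rw [eLpNorm_smul_measure_of_ne_top (by norm_num), smul_eq_mul, ← ENNReal.rpow_mul]
        norm_num

theorem measurable_compInv (hΩb : Bornology.IsBounded Ω)
    (hΦ : Continuous Φ) {I : Plane → ℝ} (hI : Measurable I) : Measurable (compInv Ω I Φ) := by
  rw [compInv_eq_indicator]
  exact (hI.comp (measurable_partialInverse hΩb hΦ)).indicator (measurableSet_uniqueValues hΩb hΦ)

/-- A non-zero image stays non-zero under composition with the inverse deformation: almost every
point of `Ω` has exactly one preimage, since the pieces of `exists_injOn_partition` have images
that tile `Ω` by `map_withDensity_det_eq`. -/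
theorem ae_eq_zero_of_compInv_ae_eq_zero (hΩ : IsOpen Ω) (hΩb : Bornology.IsBounded Ω)
    (hfr : volume (frontier Ω) = 0) (hΦ : LipschitzWith L Φ) (hid : ∀ x, x ∉ Ω → Φ x = x)
    (hpos : ∀ᵐ x ∂(volume.restrict Ω), 0 < (fderiv ℝ Φ x).det) {I : Plane → ℝ}
    (hI : Measurable I) (h0 : ∀ᵐ y ∂(volume.restrict Ω), compInv Ω I Φ y = 0) :
    ∀ᵐ x ∂(volume.restrict Ω), I x = 0 := by
  obtain ⟨G, hGm, hGd, hGi, hGU⟩ := exists_injOn_partition hΩ.measurableSet Φ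
  have hG : ∀ n, ∀ x ∈ G n, x ∈ Ω ∧ DifferentiableAt ℝ Φ x ∧ 0 < (fderiv ℝ Φ x).det :=
    fun n x hx => by
      have : x ∈ ⋃ n, G n := mem_iUnion.2 ⟨n, hx⟩
      rw [hGU] at this
      exact this
  have hrest : volume (Ω \ ⋃ n, G n) = 0 := by
    rw [hGU, measure_eq_zero_iff_ae_notMem]
    filter_upwards [hΦ.ae_differentiableAt, (ae_restrict_iff' hΩ.measurableSet).1 hpos]
      with x hx1 hx2 hx
    exact hx.2 ⟨hx.1, hx1, hx2 hx.1⟩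
  have hΦm : Measurable Φ := hΦ.continuous.measurable
  set ν := (volume.restrict Ω).withDensity fun x => ENNReal.ofReal (fderiv ℝ Φ x).det with hν
  have hνG : ∀ n S, MeasurableSet S → S ⊆ G n → ν S = volume (Φ '' S) := by
    intro n S hS hSG
    rw [hν, withDensity_apply _ hS, Measure.restrict_restrict hS,
      inter_eq_left.2 fun x hx => (hG n x (hSG hx)).1,
      ← lintegral_abs_det_fderiv_eq_addHaar_image volume hS
        (fun x hx => (hG n x (hSG hx)).2.1.hasFDerivAt.hasFDerivWithinAt) ((hGi n).mono hSG)]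
    refine setLIntegral_congr_fun hS fun x hx => ?_
    simp only [abs_of_pos (hG n x (hSG hx)).2.2]
  have hνac : ν ≪ volume.restrict Ω := withDensity_absolutelyContinuous _ _
  -- the images of the pieces tile `Ω`
  have htile : ∀ Q, MeasurableSet Q → volume (Q ∩ Ω) = ∑' n, volume (Q ∩ Φ '' G n) := by
    intro Q hQ
    have h1 : volume (Q ∩ Ω) = ν (Φ ⁻¹' Q) := by
      rw [← Measure.restrict_apply hQ, ← map_withDensity_det_eq hΩb hfr hΦ hid hpos,
        Measure.map_apply hΦm hQ]
    have h2 : ν (Φ ⁻¹' Q) = ν (⋃ n, (Φ ⁻¹' Q ∩ G n)) := by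
      rw [← inter_iUnion]
      refine (measure_inter_conull' ?_).symm
      apply hνac
      rw [Measure.restrict_apply ((hΦm hQ).diff (MeasurableSet.iUnion hGm))]
      exact measure_mono_null (t := Ω \ ⋃ n, G n) (fun x hx => ⟨hx.2, hx.1.2⟩) hrest
    rw [h1, h2, measure_iUnion (fun i j hij => (hGd hij).mono inter_subset_right inter_subset_right)
      fun n => (hΦm hQ).inter (hGm n)]
    refine tsum_congr fun n => ?_
    rw [hνG n _ ((hΦm hQ).inter (hGm n)) inter_subset_right]
    congr 1
    ext y
    constructor
    · rintro ⟨x, ⟨hx1, hx2⟩, rfl⟩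
      exact ⟨hx1, x, hx2, rfl⟩
    · rintro ⟨hy, x, hx, rfl⟩
      exact ⟨x, ⟨hy, hx⟩, rfl⟩
  have himg : ∀ n, MeasurableSet (Φ '' G n) := fun n =>
    (hGm n).image_of_continuousOn_injOn hΦ.continuous.continuousOn (hGi n)
  have hout : ∀ n, volume (Φ '' G n \ Ω) = 0 := by
    intro n
    have h := htile Ωᶜ hΩ.measurableSet.compl
    rw [compl_inter_self, measure_empty] at h
    have := (ENNReal.tsum_eq_zero.1 h.symm) n
    rwa [inter_comm] at this
  have hover : ∀ n k, n ≠ k → volume (Φ '' G n ∩ Φ '' G k) = 0 := by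
    intro n k hnk
    set Q := Φ '' G n ∩ Φ '' G k with hQ
    have hQfin : volume Q ≠ ⊤ := by
      refine ((measure_mono inter_subset_left).trans_lt
        ((volume_image_le_of_lipschitzWith hΦ _).trans_lt ?_)).ne
      refine ENNReal.mul_lt_top (ENNReal.rpow_lt_top_of_nonneg (by norm_num) ENNReal.coe_ne_top) ?_
      exact (measure_mono fun x hx => (hG n x hx).1).trans_lt hΩb.measure_lt_top
    have h := htile Q ((himg n).inter (himg k))
    have h1 := ENNReal.sum_le_tsum (f := fun i => volume (Q ∩ Φ '' G i)) {n, k}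
    rw [← h, Finset.sum_pair hnk, inter_eq_left.2 inter_subset_left,
      inter_eq_left.2 inter_subset_right] at h1
    have h2 : volume Q + volume Q ≤ volume Q + 0 := by
      rw [add_zero]; exact h1.trans (measure_mono inter_subset_left)
    exact le_zero_iff.1 ((ENNReal.add_le_add_iff_left hQfin).1 h2)
  -- almost every image point of a piece has no other preimage
  have hmult : ∀ n, volume (Φ '' G n \ uniqueValues Ω Φ) = 0 := by
    intro n
    have hsub : Φ '' G n \ uniqueValues Ω Φ ⊆
        (Φ '' G n \ Ω) ∪ (Φ '' (Ω \ ⋃ n, G n)) ∪ ⋃ k, ⋃ (_ : n ≠ k), Φ '' G n ∩ Φ '' G k := by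
      rintro y ⟨⟨x, hx, rfl⟩, hyU⟩
      by_cases hyΩ : Φ x ∈ Ω
      swap
      · exact Or.inl (Or.inl ⟨⟨x, hx, rfl⟩, hyΩ⟩)
      have : ∃ z ∈ closure Ω, Φ z = Φ x ∧ z ≠ x := by
        by_contra hcon
        push Not at hcon
        exact hyU ⟨x, ⟨subset_closure (hG n x hx).1, rfl⟩, fun z hz => hcon z hz.1 hz.2⟩
      obtain ⟨z, -, hzx, hne⟩ := this
      have hzΩ : z ∈ Ω := mem_of_apply_mem hid (hzx ▸ hyΩ)
      by_cases hz : z ∈ ⋃ n, G n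
      · obtain ⟨k, hk⟩ := mem_iUnion.1 hz
        have hnk : n ≠ k := by
          rintro rfl
          exact hne (hGi n hk hx hzx)
        exact Or.inr (mem_iUnion₂.2 ⟨k, hnk, ⟨x, hx, rfl⟩, ⟨z, hk, hzx⟩⟩)
      · exact Or.inl (Or.inr ⟨z, ⟨hzΩ, hz⟩, hzx⟩)
    refine measure_mono_null hsub (measure_union_null (measure_union_null (hout n) ?_)
      (measure_iUnion_null fun k => measure_iUnion_null fun hnk => hover n k hnk))
    refine le_zero_iff.1 ((volume_image_le_of_lipschitzWith hΦ _).trans ?_)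
    rw [hrest, mul_zero]
  have hnull : volume {y ∈ Ω | compInv Ω I Φ y ≠ 0} = 0 := by
    rw [measure_eq_zero_iff_ae_notMem]
    filter_upwards [(ae_restrict_iff' hΩ.measurableSet).1 h0] with y hy hy'
    exact hy'.2 (hy hy'.1)
  set S := {x | I x ≠ 0} with hS
  have hSm : MeasurableSet S := hI (measurableSet_singleton 0).compl
  have himS : ∀ n, volume (Φ '' (S ∩ G n)) = 0 := by
    intro n
    refine measure_mono_null (t := (Φ '' G n \ Ω) ∪ (Φ '' G n \ uniqueValues Ω Φ) ∪
      {y ∈ Ω | compInv Ω I Φ y ≠ 0}) ?_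
      (measure_union_null (measure_union_null (hout n) (hmult n)) hnull)
    rintro y ⟨x, ⟨hxS, hx⟩, rfl⟩
    by_cases hyΩ : Φ x ∈ Ω
    swap
    · exact Or.inl (Or.inl ⟨⟨x, hx, rfl⟩, hyΩ⟩)
    by_cases hyU : Φ x ∈ uniqueValues Ω Φ
    swap
    · exact Or.inl (Or.inr ⟨⟨x, hx, rfl⟩, hyU⟩)
    refine Or.inr ⟨hyΩ, ?_⟩
    rw [compInv_eq_indicator, indicator_of_mem hyU,
      partialInverse_eq hyU (subset_closure (hG n x hx).1) rfl]
    exact hxS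
  have hSG : ∀ n, volume (S ∩ G n) = 0 := by
    intro n
    have hm := hSm.inter (hGm n)
    have h1 := hνG n _ hm inter_subset_right
    rw [himS, hν, withDensity_apply _ hm, Measure.restrict_restrict hm,
      inter_eq_left.2 fun x hx => (hG n x hx.2).1] at h1
    by_contra hne
    refine absurd h1 (ne_of_gt ?_)
    rw [setLIntegral_pos_iff (by
      exact ENNReal.measurable_ofReal.comp
        (ContinuousLinearMap.continuous_det.measurable.comp (measurable_fderiv ℝ Φ)))]
    refine lt_of_lt_of_le (pos_iff_ne_zero.2 hne) (measure_mono fun x hx => ⟨?_, hx⟩)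
    simpa using (hG n x hx.2).2.2
  rw [ae_restrict_iff' hΩ.measurableSet]
  have h2 : volume (⋃ n, S ∩ G n) = 0 := measure_iUnion_null hSG
  filter_upwards [measure_eq_zero_iff_ae_notMem.1 h2, measure_eq_zero_iff_ae_notMem.1 hrest]
    with x hx1 hx2 hxΩ
  by_contra hne
  have hxG : x ∈ ⋃ n, G n := by
    by_contra h
    exact hx2 ⟨hxΩ, h⟩
  exact hx1 (by rw [← inter_iUnion]; exact ⟨hne, hxG⟩)

theorem memLp_compInv (hΩb : Bornology.IsBounded Ω)
    (hΦ : LipschitzWith L Φ) (hid : ∀ x, x ∉ Ω → Φ x = x) (I : L2 Ω) :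
    MemLp (compInv Ω I Φ) 2 (volume.restrict Ω) :=
  ⟨(measurable_compInv hΩb hΦ.continuous (Lp.stronglyMeasurable I).measurable).aestronglyMeasurable,
    (eLpNorm_compInv_le hΩb hΦ hid (Lp.stronglyMeasurable I).measurable).trans_lt
      (ENNReal.mul_lt_top ENNReal.coe_lt_top (Lp.eLpNorm_lt_top I))⟩

/-- Composition with the inverse deformation, as a bounded operator on `L²(Ω)`. -/
noncomputable def compInvL (hΩb : Bornology.IsBounded Ω)
    (hΦ : LipschitzWith L Φ) (hid : ∀ x, x ∉ Ω → Φ x = x) : L2 Ω →L[ℝ] L2 Ω :=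
  LinearMap.mkContinuous
    { toFun := fun I => (memLp_compInv hΩb hΦ hid I).toLp _
      map_add' := fun I J => by
        rw [← MemLp.toLp_add]
        refine MemLp.toLp_congr _ _ ((compInv_ae_congr hΩb hΦ hid (Lp.coeFn_add I J)).trans ?_)
        refine .of_forall fun y => ?_
        simp only [compInv_eq_indicator, Pi.add_apply]
        by_cases hy : y ∈ uniqueValues Ω Φ <;> simp [hy]
      map_smul' := fun c I => by
        rw [← MemLp.toLp_const_smul]
        refine MemLp.toLp_congr _ _ ((compInv_ae_congr hΩb hΦ hid (Lp.coeFn_smul c I)).trans ?_)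
        refine .of_forall fun y => ?_
        simp only [compInv_eq_indicator, Pi.smul_apply, RingHom.id_apply]
        by_cases hy : y ∈ uniqueValues Ω Φ <;> simp [hy] }
    L fun I => by
      have h := eLpNorm_compInv_le hΩb hΦ hid (Lp.stronglyMeasurable I).measurable
      rw [LinearMap.coe_mk, AddHom.coe_mk, Lp.norm_toLp, Lp.norm_def]
      have := ENNReal.toReal_mono (ENNReal.mul_ne_top ENNReal.coe_ne_top (Lp.eLpNorm_ne_top I)) h
      simpa [ENNReal.toReal_mul] using this

theorem coeFn_compInvL (hΩb : Bornology.IsBounded Ω)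
    (hΦ : LipschitzWith L Φ) (hid : ∀ x, x ∉ Ω → Φ x = x) (I : L2 Ω) :
    compInvL hΩb hΦ hid I =ᵐ[volume.restrict Ω] compInv Ω I Φ :=
  MemLp.coeFn_toLp (memLp_compInv hΩb hΦ hid I)

theorem compInvL_injective (hΩ : IsOpen Ω) (hΩb : Bornology.IsBounded Ω)
    (hfr : volume (frontier Ω) = 0) (hΦ : LipschitzWith L Φ) (hid : ∀ x, x ∉ Ω → Φ x = x)
    (hpos : ∀ᵐ x ∂(volume.restrict Ω), 0 < (fderiv ℝ Φ x).det) {I : L2 Ω}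
    (h : compInvL hΩb hΦ hid I = 0) : I = 0 := by
  have h1 := coeFn_compInvL hΩb hΦ hid I
  rw [h] at h1
  refine (Lp.eq_zero_iff_ae_eq_zero).2 ?_
  refine ae_eq_zero_of_compInv_ae_eq_zero hΩ hΩb hfr hΦ hid hpos
    (Lp.stronglyMeasurable I).measurable ?_
  filter_upwards [h1, Lp.coeFn_zero ℝ 2 (volume.restrict Ω)] with y hy hy0
  rw [← hy, hy0]; rfl

end Inverse

/-! ### Lipschitz domains -/

section Geometry

variable {Ω : Set Plane}

theorem norm_le_add_abs (x : Plane) : ‖x‖ ≤ |x 0| + |x 1| := by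
  calc ‖x‖ = ‖x 0 • basisVec 0 + x 1 • basisVec 1‖ := by rw [← eq_basisVec_sum]
    _ ≤ _ := norm_add_le _ _
    _ = _ := by simp [norm_smul, basisVec]

theorem linearIndependent_pair_of_det_ne_zero {v w : Plane} (h : v 0 * w 1 - v 1 * w 0 ≠ 0) :
    LinearIndependent ℝ ![v, w] := by
  rw [LinearIndependent.pair_iff]
  intro s t hst
  have h0 := congrArg (fun z : Plane => z 0) hst
  have h1 := congrArg (fun z : Plane => z 1) hst
  simp at h0 h1
  constructor
  · have : s * (v 0 * w 1 - v 1 * w 0) = 0 := by linear_combination w 1 * h0 - w 0 * h1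
    exact (mul_eq_zero.1 this).resolve_right h
  · have : t * (v 0 * w 1 - v 1 * w 0) = 0 := by linear_combination v 0 * h1 - v 1 * h0
    exact (mul_eq_zero.1 this).resolve_right h

/-- A Lipschitz domain has the uniform cone property, with parallelograms in place of cones. -/
theorem HasLipschitzBoundary.exists_parallelogram (hlip : HasLipschitzBoundary Ω) (hΩ : IsOpen Ω)
    {p : Plane} (hp : p ∈ closure Ω) :
    ∃ r > 0, ∃ v w : Plane, LinearIndependent ℝ ![v, w] ∧
      ∀ x ∈ Ω ∩ Metric.ball p r, ∀ s ∈ Icc (0 : ℝ) 1, ∀ t ∈ Icc (0 : ℝ) 1,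
        x + s • v + t • w ∈ Ω := by
  by_cases hpΩ : p ∈ Ω
  · obtain ⟨ρ, hρ, hball⟩ := Metric.isOpen_iff.1 hΩ p hpΩ
    refine ⟨ρ / 2, by positivity, (ρ / 4) • basisVec 0, (ρ / 4) • basisVec 1,
      linearIndependent_pair_of_det_ne_zero ?_, ?_⟩
    · simp [basisVec, hρ.ne']
    · rintro x ⟨-, hx⟩ s hs t ht
      apply hball
      rw [Metric.mem_ball, dist_eq_norm] at *
      have h1 : ‖s • (ρ / 4) • basisVec 0‖ ≤ ρ / 4 := by
        rw [norm_smul, norm_smul, Real.norm_of_nonneg hs.1, Real.norm_of_nonneg (by positivity)]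
        simp only [basisVec, PiLp.norm_single, norm_one, mul_one]
        nlinarith [hs.2]
      have h2 : ‖t • (ρ / 4) • basisVec 1‖ ≤ ρ / 4 := by
        rw [norm_smul, norm_smul, Real.norm_of_nonneg ht.1, Real.norm_of_nonneg (by positivity)]
        simp only [basisVec, PiLp.norm_single, norm_one, mul_one]
        nlinarith [ht.2]
      calc ‖x + s • (ρ / 4) • basisVec 0 + t • (ρ / 4) • basisVec 1 - p‖
          = ‖(x - p) + s • (ρ / 4) • basisVec 0 + t • (ρ / 4) • basisVec 1‖ := by congr 1; abel
        _ ≤ ‖x - p‖ + ‖s • (ρ / 4) • basisVec 0‖ + ‖t • (ρ / 4) • basisVec 1‖ := norm_add₃_le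
        _ < ρ := by linarith
  · obtain ⟨r, T, L, γ, hr, hγ, hg⟩ := hlip p ⟨hp, fun h => hpΩ (interior_subset h)⟩
    have hL : (0 : ℝ) ≤ L := L.2
    -- `v'` and `w'` point downwards more steeply than the graph of `γ`, and they are short enough
    -- for the parallelogram to stay in the ball where `Ω` is a subgraph
    set δ : ℝ := r / (8 * (L + 2)) with hδ
    have hδ0 : 0 < δ := by positivity
    have hδr : (L + 2) * δ = r / 8 := by rw [hδ]; field_simp
    set v' : Plane := !₂[δ, -((L + 1) * δ)] with hv'
    set w' : Plane := !₂[-δ, -((L + 1) * δ)] with hw'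
    have hli : LinearIndependent ℝ ![v', w'] := linearIndependent_pair_of_det_ne_zero (by
      simp only [hv', hw', PiLp.toLp_apply, Matrix.cons_val_zero, Matrix.cons_val_one]
      have : 0 < (L + 1) * δ * δ := by positivity
      intro h
      nlinarith)
    have hv'n : ‖v'‖ ≤ r / 8 := by
      refine (norm_le_add_abs _).trans ?_
      simp only [hv', PiLp.toLp_apply, Matrix.cons_val_zero, Matrix.cons_val_one, abs_neg]
      rw [abs_of_pos hδ0, abs_of_pos (by positivity)]
      linarith
    have hw'n : ‖w'‖ ≤ r / 8 := by
      refine (norm_le_add_abs _).trans ?_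
      simp only [hw', PiLp.toLp_apply, Matrix.cons_val_zero, Matrix.cons_val_one, abs_neg]
      rw [abs_of_pos hδ0, abs_of_pos (by positivity)]
      linarith
    refine ⟨r / 2, by positivity, T.symm v', T.symm w', ?_, ?_⟩
    · have := hli.map' (T.symm.toLinearEquiv : Plane →ₗ[ℝ] Plane) T.symm.toLinearEquiv.ker
      have e : (T.symm.toLinearEquiv : Plane →ₗ[ℝ] Plane) ∘ ![v', w']
          = ![T.symm v', T.symm w'] := by
        ext i; fin_cases i <;> simp
      rw [e] at this
      exact this
    · rintro x ⟨hxΩ, hx⟩ s hs t ht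
      have hb : ∀ {c : ℝ} {z : Plane}, c ∈ Icc (0 : ℝ) 1 → ‖z‖ ≤ r / 8 →
          ‖c • T.symm z‖ ≤ r / 8 := fun hc hz => by
        rw [norm_smul, Real.norm_of_nonneg hc.1, LinearIsometryEquiv.norm_map]
        exact (mul_le_of_le_one_left (norm_nonneg _) hc.2).trans hz
      have hmem : x + s • T.symm v' + t • T.symm w' ∈ Metric.ball p r := by
        rw [Metric.mem_ball, dist_eq_norm] at *
        calc ‖x + s • T.symm v' + t • T.symm w' - p‖
            = ‖(x - p) + s • T.symm v' + t • T.symm w'‖ := by congr 1; abel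
          _ ≤ ‖x - p‖ + ‖s • T.symm v'‖ + ‖t • T.symm w'‖ := norm_add₃_le
          _ < r := by linarith [hb hs hv'n, hb ht hw'n]
      rw [hg _ hmem]
      have h0 := (hg x (Metric.ball_subset_ball (by linarith) hx)).1 hxΩ
      have hγ' := hγ.dist_le_mul ((T x) 0 + (s - t) * δ) ((T x) 0)
      rw [Real.dist_eq, Real.dist_eq, add_sub_cancel_left, abs_mul, abs_of_pos hδ0] at hγ'
      have hst : |s - t| ≤ s + t := abs_le.2 ⟨by linarith [hs.1, ht.1], by linarith [hs.1, ht.1]⟩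
      have e0 : (T (x + s • T.symm v' + t • T.symm w')) 0 = (T x) 0 + (s - t) * δ := by
        simp [hv', hw']; ring
      have e1 : (T (x + s • T.symm v' + t • T.symm w')) 1
          = (T x) 1 - (s + t) * ((L + 1) * δ) := by
        simp [hv', hw']; ring
      rw [e0, e1]
      have h2 : L * (|s - t| * δ) ≤ (s + t) * ((L + 1) * δ) := by
        have : |s - t| * δ ≤ (s + t) * δ := by gcongr
        have h3 : 0 ≤ (s + t) * δ := by have := hs.1; have := ht.1; positivity
        nlinarith
      have h3 := (abs_le.1 hγ').1
      linarith

/-- The boundary is locally a graph, and infinitely many vertical translates of a graph that stay in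
a bounded set are disjoint. -/
theorem HasLipschitzBoundary.volume_frontier (hlip : HasLipschitzBoundary Ω) (hΩ : IsOpen Ω) :
    volume (frontier Ω) = 0 := by
  refine measure_null_of_locally_null _ fun p hp => ?_
  obtain ⟨r, T, L, γ, hr, hγ, hg⟩ := hlip p hp
  refine ⟨frontier Ω ∩ Metric.ball p r,
    inter_mem self_mem_nhdsWithin (mem_nhdsWithin_of_mem_nhds (Metric.ball_mem_nhds p hr)), ?_⟩
  set Z : Set Plane := {x | (T x) 1 = γ ((T x) 0)} with hZ
  have hc0 : Continuous fun x : Plane => (T x) 0 := by fun_prop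
  have hc1 : Continuous fun x : Plane => (T x) 1 := by fun_prop
  have hcγ : Continuous fun x : Plane => γ ((T x) 0) := hγ.continuous.comp hc0
  have hsub : frontier Ω ∩ Metric.ball p r ⊆ Z := by
    rintro x ⟨hx, hxb⟩
    refine le_antisymm ?_ ?_
    · have hx' : x ∈ closure (Ω ∩ Metric.ball p r) := by
        rw [mem_closure_iff]
        intro o ho hxo
        obtain ⟨y, hy, hyΩ⟩ := mem_closure_iff.1 hx.1 (o ∩ Metric.ball p r)
          (ho.inter Metric.isOpen_ball) ⟨hxo, hxb⟩
        exact ⟨y, hy.1, hyΩ, hy.2⟩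
      exact closure_minimal (fun y hy => ((hg y hy.2).1 hy.1).le) (isClosed_le hc1 hcγ) hx'
    · by_contra h
      push Not at h
      exact (hΩ.frontier_eq ▸ hx).2 ((hg x hxb).2 h)
  refine measure_mono_null hsub ?_
  refine Measure.addHaar_eq_zero_of_disjoint_translates (u := fun n : ℕ =>
      ((1 : ℝ) / (n + 1)) • T.symm (basisVec 1)) volume ?_ ?_ ?_
  · refine (Metric.isBounded_closedBall (x := (0 : Plane)) (r := 1)).subset ?_
    rintro _ ⟨n, rfl⟩
    rw [mem_closedBall_zero_iff, norm_smul, LinearIsometryEquiv.norm_map]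
    simp only [basisVec, PiLp.norm_single, norm_one, mul_one]
    rw [Real.norm_of_nonneg (by positivity)]
    rw [div_le_one (by positivity)]
    linarith [(Nat.cast_nonneg n : (0 : ℝ) ≤ n)]
  · intro m n hmn
    refine Set.disjoint_left.2 ?_
    rintro _ ⟨_, rfl, z, hz, rfl⟩ ⟨_, rfl, y, hy, h⟩
    have hh := congrArg T h
    simp only [map_add, map_smul, LinearIsometryEquiv.apply_symm_apply] at hh
    have h0 := congrArg (fun z : Plane => z 0) hh
    have h1 := congrArg (fun z : Plane => z 1) hh
    simp [basisVec] at h0 h1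
    have hz' : (T z) 1 = γ ((T z) 0) := hz
    have hy' : (T y) 1 = γ ((T y) 0) := hy
    rw [hz', hy', h0] at h1
    apply hmn
    have h3 : ((n : ℝ) + 1)⁻¹ = ((m : ℝ) + 1)⁻¹ := by linarith
    have h4 : (n : ℝ) + 1 = m + 1 := inv_injective h3
    exact_mod_cast (by linarith : (m : ℝ) = n)
  · exact measurableSet_eq_fun hc1.measurable hcγ.measurable

open Classical in
/-- The extension of `φ` from `Ω` to the plane by the identity. -/
noncomputable def extendId (Ω : Set Plane) (φ : Plane → Plane) (x : Plane) : Plane :=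
  if x ∈ Ω then φ x else x

theorem continuous_extendId {φ : Plane → Plane} (hc : ContinuousOn φ (closure Ω))
    (hfr : ∀ x ∈ frontier Ω, φ x = x) : Continuous (extendId Ω φ) := by
  classical
  have : extendId Ω φ = (Ω.piecewise φ id) := by
    ext1 x
    by_cases hx : x ∈ Ω <;> simp [extendId, hx]
  rw [this]
  exact continuous_piecewise (by simpa using hfr) hc continuousOn_id

theorem extendId_eqOn_closure (hΩ : IsOpen Ω) {φ : Plane → Plane}
    (hfr : ∀ x ∈ frontier Ω, φ x = x) : EqOn φ (extendId Ω φ) (closure Ω) := by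
  intro x hx
  by_cases h : x ∈ Ω
  · simp [extendId, h]
  · simp only [extendId, h, if_false]
    exact hfr x (hΩ.frontier_eq ▸ ⟨hx, h⟩)

/-- Local Lipschitz bounds add up along a segment in `Ω`, whose far endpoint may lie on the
boundary. -/
theorem norm_sub_le_of_segment {Φ : Plane → Plane} (hΦ : Continuous Φ) {M : NNReal}
    (hloc : ∀ x ∈ Ω, ∃ ε > 0, LipschitzOnWith M Φ (Metric.ball x ε)) {x y : Plane}
    (h : ∀ t ∈ Ico (0 : ℝ) 1, x + t • (y - x) ∈ Ω) : ‖Φ y - Φ x‖ ≤ M * ‖y - x‖ := by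
  set f : ℝ → Plane := fun t => x + t • (y - x) with hf
  have hfc : Continuous f := by fun_prop
  set S : Set ℝ := {t | ‖Φ (f t) - Φ x‖ ≤ M * (t * ‖y - x‖)} with hS
  have hSc : IsClosed S := isClosed_le (by fun_prop) (by fun_prop)
  have key : Icc (0 : ℝ) 1 ⊆ S := by
    refine IsClosed.Icc_subset_of_forall_mem_nhdsWithin (hSc.inter isClosed_Icc) ?_ ?_
    · simp [hS, hf]
    · rintro t ⟨htS, ht⟩
      obtain ⟨ε, hε, hlip⟩ := hloc _ (h t ht)
      have hnear : ∀ᶠ s in 𝓝[>] t, f s ∈ Metric.ball (f t) ε :=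
        (hfc.tendsto t).eventually (Metric.ball_mem_nhds _ hε) |>.filter_mono nhdsWithin_le_nhds
      filter_upwards [hnear, self_mem_nhdsWithin] with s hs hst
      have h1 := hlip.norm_sub_le hs (Metric.mem_ball_self hε)
      have h2 : f s - f t = (s - t) • (y - x) := by simp only [hf]; module
      rw [h2, norm_smul, Real.norm_of_nonneg (sub_nonneg.2 (le_of_lt hst))] at h1
      have htS' : ‖Φ (f t) - Φ x‖ ≤ M * (t * ‖y - x‖) := htS
      calc ‖Φ (f s) - Φ x‖ ≤ ‖Φ (f s) - Φ (f t)‖ + ‖Φ (f t) - Φ x‖ :=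
          norm_sub_le_norm_sub_add_norm_sub _ _ _
        _ ≤ M * ((s - t) * ‖y - x‖) + M * (t * ‖y - x‖) := add_le_add h1 htS'
        _ = _ := by ring
  have := key (right_mem_Icc.2 zero_le_one)
  simpa [hS, hf] using this

/-- A map that is continuous up to the boundary, fixes the boundary and is locally Lipschitz in
`Ω` with a uniform constant extends by the identity to a globally Lipschitz map. -/
theorem lipschitzWith_of_locally_lipschitz (hΩ : IsOpen Ω) {Φ : Plane → Plane} (hΦ : Continuous Φ)
    (hid : ∀ x, x ∉ Ω → Φ x = x) {M : NNReal} (hM : 1 ≤ M)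
    (hloc : ∀ x ∈ Ω, ∃ ε > 0, LipschitzOnWith M Φ (Metric.ball x ε)) : LipschitzWith M Φ := by
  have hout : ∀ x y, y ∉ Ω → ‖Φ y - Φ x‖ ≤ M * ‖y - x‖ := by
    intro x y hy
    have hcp : IsCompact (Icc (0 : ℝ) 1 ∩ {t | x + t • (y - x) ∉ Ω}) :=
      isCompact_Icc.inter_right
        (hΩ.isClosed_compl.preimage (by fun_prop : Continuous fun t : ℝ => x + t • (y - x)))
    -- the first point of the segment outside `Ω`
    obtain ⟨t, ⟨ht, htΩ⟩, hmin⟩ := hcp.exists_isLeast ⟨1, by simpa using hy⟩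
    set z := x + t • (y - x) with hz
    have h1 : ‖Φ z - Φ x‖ ≤ M * ‖z - x‖ := by
      by_cases ht0 : t = 0
      · have hzx' : z = x := by rw [hz, ht0]; simp
        simp [hzx']
      refine norm_sub_le_of_segment hΦ hloc fun s hs => ?_
      by_contra hcon
      have hzx : x + s • (z - x) = x + (s * t) • (y - x) := by rw [hz]; module
      rw [hzx] at hcon
      have := hmin ⟨⟨mul_nonneg hs.1 ht.1, by nlinarith [hs.1, hs.2, ht.1, ht.2]⟩, hcon⟩
      have ht0' : 0 < t := lt_of_le_of_ne ht.1 (Ne.symm ht0)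
      nlinarith [hs.2]
    have h2 : ‖Φ y - Φ z‖ ≤ M * ‖y - z‖ := by
      rw [hid y hy, hid z htΩ]
      exact le_mul_of_one_le_left (norm_nonneg _) (by exact_mod_cast hM)
    have e1 : ‖z - x‖ = t * ‖y - x‖ := by
      rw [hz, add_sub_cancel_left, norm_smul, Real.norm_of_nonneg ht.1]
    have e2 : ‖y - z‖ = (1 - t) * ‖y - x‖ := by
      rw [hz, show y - (x + t • (y - x)) = (1 - t) • (y - x) by module, norm_smul,
        Real.norm_of_nonneg (sub_nonneg.2 ht.2)]
    calc ‖Φ y - Φ x‖ ≤ ‖Φ y - Φ z‖ + ‖Φ z - Φ x‖ := norm_sub_le_norm_sub_add_norm_sub _ _ _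
      _ ≤ M * ‖y - z‖ + M * ‖z - x‖ := add_le_add h2 h1
      _ = M * ‖y - x‖ := by rw [e1, e2]; ring
  refine LipschitzWith.of_dist_le_mul fun y x => ?_
  rw [dist_eq_norm, dist_eq_norm]
  by_cases h : ∀ t ∈ Ico (0 : ℝ) 1, x + t • (y - x) ∈ Ω
  · exact norm_sub_le_of_segment hΦ hloc h
  · push Not at h
    obtain ⟨t, ht, htΩ⟩ := h
    set z := x + t • (y - x) with hz
    have e1 : ‖z - x‖ = t * ‖y - x‖ := by
      rw [hz, add_sub_cancel_left, norm_smul, Real.norm_of_nonneg ht.1]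
    have e2 : ‖z - y‖ = (1 - t) * ‖y - x‖ := by
      rw [hz, show x + t • (y - x) - y = -((1 - t) • (y - x)) by module, norm_neg, norm_smul,
        Real.norm_of_nonneg (sub_nonneg.2 ht.2.le)]
    calc ‖Φ y - Φ x‖ ≤ ‖Φ y - Φ z‖ + ‖Φ z - Φ x‖ := norm_sub_le_norm_sub_add_norm_sub _ _ _
      _ ≤ M * ‖z - y‖ + M * ‖z - x‖ := by
        rw [norm_sub_rev (Φ y)]; exact add_le_add (hout y z htΩ) (hout x z htΩ)
      _ = M * ‖y - x‖ := by rw [e1, e2]; ring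

end Geometry

/-! ### Classical derivatives of smooth functions -/

section Smooth

theorem contDiff_pderiv {f : Plane → ℝ} (hf : ContDiff ℝ ∞ f) (i : Fin 2) :
    ContDiff ℝ ∞ (pderiv i f) :=
  (hf.fderiv_right (m := ∞) (by norm_cast)).clm_apply contDiff_const

theorem contDiff_pderiv_iterate {f : Plane → ℝ} (hf : ContDiff ℝ ∞ f) (i : Fin 2) (n : ℕ) :
    ContDiff ℝ ∞ ((pderiv i)^[n] f) := by
  induction n with
  | zero => exact hf
  | succ n ih => rw [Function.iterate_succ_apply']; exact contDiff_pderiv ih i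

theorem contDiff_mderiv {f : Plane → ℝ} (hf : ContDiff ℝ ∞ f) (β : Fin 2 → ℕ) :
    ContDiff ℝ ∞ (mderiv β f) :=
  contDiff_pderiv_iterate (contDiff_pderiv_iterate hf 1 _) 0 _

theorem hasCompactSupport_pderiv {f : Plane → ℝ} (hf : HasCompactSupport f) (i : Fin 2) :
    HasCompactSupport (pderiv i f) :=
  hf.fderiv_apply (𝕜 := ℝ) _

theorem hasCompactSupport_pderiv_iterate {f : Plane → ℝ} (hf : HasCompactSupport f) (i : Fin 2)
    (n : ℕ) : HasCompactSupport ((pderiv i)^[n] f) := by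
  induction n with
  | zero => exact hf
  | succ n ih => rw [Function.iterate_succ_apply']; exact hasCompactSupport_pderiv ih i

theorem pderiv_comm {f : Plane → ℝ} (hf : ContDiff ℝ ∞ f) (i j : Fin 2) :
    pderiv i (pderiv j f) = pderiv j (pderiv i f) := by
  ext x
  have h2 : ∀ k : Fin 2, ∀ v, fderiv ℝ (pderiv k f) x v
      = fderiv ℝ (fderiv ℝ f) x v (EuclideanSpace.single k 1) := by
    intro k v
    have hd : DifferentiableAt ℝ (fderiv ℝ f) x :=
      (hf.fderiv_right (m := ∞) (by norm_cast)).differentiable (by simp) x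
    have := hd.hasFDerivAt.clm_apply (hasFDerivAt_const (EuclideanSpace.single k (1 : ℝ)) x)
    change fderiv ℝ (fun y => fderiv ℝ f y (EuclideanSpace.single k 1)) x v = _
    rw [this.fderiv]
    simp
  have hs : IsSymmSndFDerivAt ℝ f x := hf.contDiffAt.isSymmSndFDerivAt (by
    rw [minSmoothness_of_isRCLikeNormedField]; exact WithTop.coe_le_coe.2 (le_top : (2 : ℕ∞) ≤ ⊤))
  change fderiv ℝ (pderiv j f) x _ = fderiv ℝ (pderiv i f) x _
  rw [h2, h2, hs.eq]

theorem pderiv_mderiv {f : Plane → ℝ} (hf : ContDiff ℝ ∞ f) (i : Fin 2) (β : Fin 2 → ℕ) :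
    pderiv i (mderiv β f) = mderiv (β + Pi.single i 1) f := by
  have hcomm : ∀ n g, ContDiff ℝ ∞ g → 
      pderiv 1 ((pderiv 0)^[n] g) = (pderiv 0)^[n] (pderiv 1 g) := by
    intro n
    induction n with
    | zero => intro g _; rfl
    | succ n ih =>
      intro g hg
      rw [Function.iterate_succ_apply, ih _ (contDiff_pderiv hg 0), pderiv_comm hg,
        Function.iterate_succ_apply]
  fin_cases i
  · simp only [mderiv, Fin.zero_eta, Pi.add_apply, Pi.single_eq_same, ne_eq, one_ne_zero,
      not_false_eq_true, Pi.single_eq_of_ne, add_zero, Function.iterate_succ_apply']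
  · simp only [mderiv, Fin.mk_one, Pi.add_apply, Pi.single_eq_same, ne_eq, zero_ne_one,
      not_false_eq_true, Pi.single_eq_of_ne, add_zero]
    rw [hcomm _ _ (contDiff_pderiv_iterate hf 1 _), Function.iterate_succ_apply']

theorem mderiv_single (f : Plane → ℝ) (i : Fin 2) : mderiv (Pi.single i 1) f = pderiv i f := by
  fin_cases i <;> simp [mderiv]

theorem fderiv_apply_eq (f : Plane → ℝ) (x v : Plane) :
    fderiv ℝ f x v = v 0 * pderiv 0 f x + v 1 * pderiv 1 f x := by
  conv_lhs => rw [eq_basisVec_sum v]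
  simp [pderiv, basisVec]

theorem pderiv_reflect {k : Plane → ℝ} (hk : ContDiff ℝ ∞ k) (i : Fin 2) (c : ℝ) (x : Plane) :
    pderiv i (fun t => c * k (x - t)) = fun t => (-c) * pderiv i k (x - t) := by
  ext t
  have h := ((hk.differentiable (by simp)) (x - t)).hasFDerivAt
  have h2 : HasFDerivAt (fun t : Plane => x - t) (-ContinuousLinearMap.id ℝ Plane) t :=
    (hasFDerivAt_id t).const_sub x
  have h3 := (h.comp t h2).const_mul c
  change fderiv ℝ (fun t => c * k (x - t)) t _ = _
  rw [show (fun t => c * k (x - t)) = fun t => c * (k ∘ fun t => x - t) t from rfl, h3.fderiv]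
  simp [pderiv]

theorem pderiv_iterate_reflect {k : Plane → ℝ} (hk : ContDiff ℝ ∞ k) (i : Fin 2) (c : ℝ)
    (x : Plane) (n : ℕ) : (pderiv i)^[n] (fun t => c * k (x - t))
      = fun t => ((-1) ^ n * c) * (pderiv i)^[n] k (x - t) := by
  induction n with
  | zero => simp
  | succ n ih =>
    rw [Function.iterate_succ_apply', ih, pderiv_reflect (contDiff_pderiv_iterate hk i n),
      Function.iterate_succ_apply']
    ext t; ring

theorem mderiv_reflect {k : Plane → ℝ} (hk : ContDiff ℝ ∞ k) (β : Fin 2 → ℕ) (x : Plane) :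
    mderiv β (fun t => k (x - t)) = fun t => (-1) ^ order β * mderiv β k (x - t) := by
  have h := pderiv_iterate_reflect hk 1 1 x (β 1)
  simp only [one_mul] at h
  rw [mderiv, h, pderiv_iterate_reflect (contDiff_pderiv_iterate hk 1 _)]
  ext t
  rw [order, pow_add, mderiv]
  ring

end Smooth

/-! ### Mollification -/

section Convolution

open scoped Convolution
open ContinuousLinearMap (lsmul)

/-- Convolution of real-valued functions on the plane. -/
noncomputable def conv (f k : Plane → ℝ) : Plane → ℝ := f ⋆[lsmul ℝ ℝ, volume] k

theorem conv_apply (f k : Plane → ℝ) (x : Plane) : conv f k x = ∫ t, f t * k (x - t) := rfl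

theorem conv_comm (f k : Plane → ℝ) : conv f k = conv k f := by
  ext x
  rw [conv, convolution_lsmul_swap, conv_apply]
  congr 1; ext t; simp [mul_comm]

variable {f k : Plane → ℝ}

theorem contDiff_conv (hf : LocallyIntegrable f) (hk : ContDiff ℝ ∞ k)
    (hkc : HasCompactSupport k) : ContDiff ℝ ∞ (conv f k) :=
  hkc.contDiff_convolution_right (n := ⊤) _ hf hk

theorem pderiv_conv (hf : LocallyIntegrable f) (hk : ContDiff ℝ ∞ k)
    (hkc : HasCompactSupport k) (i : Fin 2) : pderiv i (conv f k) = conv f (pderiv i k) := by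
  ext x
  have h := hkc.hasFDerivAt_convolution_right (lsmul ℝ ℝ) hf (hk.of_le (by simp)) x
  change fderiv ℝ (conv f k) x _ = _
  rw [conv, h.fderiv, convolution_precompR_apply _ hf (hkc.fderiv (𝕜 := ℝ))
    (hk.continuous_fderiv (by simp))]
  rfl

theorem pderiv_iterate_conv (hf : LocallyIntegrable f) (hk : ContDiff ℝ ∞ k)
    (hkc : HasCompactSupport k) (i : Fin 2) (n : ℕ) :
    (pderiv i)^[n] (conv f k) = conv f ((pderiv i)^[n] k) := by
  induction n with
  | zero => rfl
  | succ n ih =>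
    rw [Function.iterate_succ_apply', ih, pderiv_conv hf (contDiff_pderiv_iterate hk i n)
      (hasCompactSupport_pderiv_iterate hkc i n), Function.iterate_succ_apply']

theorem mderiv_conv (hf : LocallyIntegrable f) (hk : ContDiff ℝ ∞ k)
    (hkc : HasCompactSupport k) (β : Fin 2 → ℕ) : mderiv β (conv f k) = conv f (mderiv β k) := by
  rw [mderiv, pderiv_iterate_conv hf hk hkc, pderiv_iterate_conv hf
    (contDiff_pderiv_iterate hk 1 _) (hasCompactSupport_pderiv_iterate hkc 1 _), mderiv]

theorem lintegral_enorm_conv_le (hf : Integrable f) (hk : Continuous k) :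
    ∫⁻ x, ‖conv f k x‖ₑ ≤ (∫⁻ x, ‖f x‖ₑ) * ∫⁻ x, ‖k x‖ₑ := by
  calc ∫⁻ x, ‖conv f k x‖ₑ ≤ ∫⁻ x, ∫⁻ t, ‖f t‖ₑ * ‖k (x - t)‖ₑ := by
        refine lintegral_mono fun x => ?_
        rw [conv_apply]
        refine (enorm_integral_le_lintegral_enorm _).trans (lintegral_mono fun t => ?_)
        rw [enorm_mul]
    _ = ∫⁻ t, ∫⁻ x, ‖f t‖ₑ * ‖k (x - t)‖ₑ := by
        refine lintegral_lintegral_swap ?_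
        exact (hf.aestronglyMeasurable.enorm.comp_snd).mul
          (Continuous.aemeasurable (by fun_prop))
    _ = ∫⁻ t, ‖f t‖ₑ * ∫⁻ x, ‖k x‖ₑ := by
        refine lintegral_congr fun t => ?_
        rw [lintegral_const_mul' _ _ enorm_ne_top,
          lintegral_sub_right_eq_self (fun x => ‖k x‖ₑ) t]
    _ = _ := lintegral_mul_const'' _ hf.aestronglyMeasurable.enorm

/-- A smooth even mollifier supported in the closed ball of radius `r`. -/
structure IsMollifier (k : Plane → ℝ) (r : ℝ) : Prop where
  contDiff : ContDiff ℝ ∞ k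
  nonneg : ∀ x, 0 ≤ k x
  even : ∀ x, k (-x) = k x
  integral_eq_one : ∫ x, k x = 1
  eq_zero : ∀ x, r < ‖x‖ → k x = 0

namespace IsMollifier

variable {r : ℝ} (hk : IsMollifier k r)
include hk

theorem hasCompactSupport : HasCompactSupport k :=
  HasCompactSupport.intro (isCompact_closedBall (0 : Plane) r) fun x hx =>
    hk.eq_zero x (by simpa using hx)

theorem integrable : Integrable k :=
  hk.contDiff.continuous.integrable_of_hasCompactSupport hk.hasCompactSupport

theorem lintegral_enorm : ∫⁻ x, ‖k x‖ₑ = 1 := by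
  rw [← ofReal_integral_norm_eq_lintegral_enorm hk.integrable]
  simp_rw [Real.norm_of_nonneg (hk.nonneg _), hk.integral_eq_one, ENNReal.ofReal_one]

theorem lintegral_enorm_conv_le (hf : Integrable f) : ∫⁻ x, ‖conv f k x‖ₑ ≤ ∫⁻ x, ‖f x‖ₑ := by
  have := TDM.lintegral_enorm_conv_le hf hk.contDiff.continuous
  rwa [hk.lintegral_enorm, mul_one] at this

theorem abs_conv_le {χ : Plane → ℝ} (h1 : ∀ x, |χ x| ≤ 1) (x : Plane) :
    |conv χ k x| ≤ 1 := by
  rw [conv_comm, conv_apply, ← Real.norm_eq_abs]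
  refine (norm_integral_le_of_norm_le hk.integrable (.of_forall fun t => ?_)).trans_eq
    hk.integral_eq_one
  rw [norm_mul, Real.norm_of_nonneg (hk.nonneg t), Real.norm_eq_abs]
  exact mul_le_of_le_one_right (hk.nonneg t) (h1 _)

end IsMollifier

/-- There are mollifiers with radii tending to zero for which the mollifications converge almost
everywhere, and at every point of continuity. -/
theorem exists_isMollifier_seq :
    ∃ (k : ℕ → Plane → ℝ) (r : ℕ → ℝ), (∀ n, IsMollifier (k n) (r n)) ∧
    Tendsto r atTop (𝓝 0) ∧
    (∀ f, LocallyIntegrable f → ∀ᵐ x : Plane, Tendsto (fun n => conv f (k n) x) atTop (𝓝 (f x))) ∧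
    ∀ f x, AEStronglyMeasurable f volume → ContinuousAt f x →
      Tendsto (fun n => conv f (k n) x) atTop (𝓝 (f x)) := by
  let φ : ℕ → ContDiffBump (0 : Plane) := fun n =>
    { rIn := 1 / ((n : ℝ) + 1) / 2, rOut := 1 / ((n : ℝ) + 1)
      rIn_pos := by positivity
      rIn_lt_rOut := half_lt_self (by positivity) }
  have hr : Tendsto (fun n => (φ n).rOut) atTop (𝓝 0) := tendsto_one_div_add_atTop_nhds_zero_nat
  refine ⟨fun n => (φ n).normed volume, fun n => (φ n).rOut, fun n => ?_, hr, fun f hf => ?_,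
    fun f x hfm hfx => ?_⟩
  · refine ⟨(φ n).contDiff_normed, (φ n).nonneg_normed, (φ n).normed_neg, (φ n).integral_normed,
      fun x hx => ?_⟩
    by_contra h
    have : x ∈ Function.support ((φ n).normed volume) := h
    rw [(φ n).support_normed_eq] at this
    simp at this
    linarith
  · filter_upwards [ContDiffBump.ae_convolution_tendsto_right_of_locallyIntegrable
      (φ := φ) (K := 2) hr (.of_forall fun n => by simp [φ]; linarith) hf] with x hx
    simp_rw [conv_comm f]
    exact hx
  · simp_rw [conv_comm f]
    exact ContDiffBump.convolution_tendsto_right (φ := φ) (g := fun _ => f) hr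
      (.of_forall fun _ => hfm) (hfx.tendsto.comp tendsto_snd) tendsto_const_nhds

end Convolution

/-! ### Interior approximation -/

section Erosion

variable {Ω : Set Plane} {r : ℝ}

/-- The points of `Ω` at distance at least `r` from the complement. -/
def erosion (Ω : Set Plane) (r : ℝ) : Set Plane := {x | r ≤ Metric.infDist x Ωᶜ}

theorem isClosed_erosion : IsClosed (erosion Ω r) :=
  isClosed_le continuous_const (Metric.continuous_infDist_pt _)

theorem mem_of_mem_erosion {x y : Plane} (hx : x ∈ erosion Ω r) (hxy : dist x y < r) : y ∈ Ω := by
  by_contra hy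
  exact absurd (Metric.infDist_le_dist_of_mem (show y ∈ Ωᶜ from hy)) (not_le.2 (hxy.trans_le hx))

theorem erosion_subset (hr : 0 < r) : erosion Ω r ⊆ Ω := fun x hx =>
  mem_of_mem_erosion hx (by simpa using hr)

theorem mem_erosion_of_dist_le {r' : ℝ} {x y : Plane} (hx : x ∈ erosion Ω r)
    (hxy : dist x y ≤ r - r') : y ∈ erosion Ω r' := by
  have h1 : r ≤ Metric.infDist x Ωᶜ := hx
  have h2 := Metric.infDist_le_infDist_add_dist (s := Ωᶜ) (x := x) (y := y)
  change r' ≤ _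
  linarith

theorem isCompact_erosion (hΩb : Bornology.IsBounded Ω) (hr : 0 < r) : IsCompact (erosion Ω r) :=
  Metric.isCompact_of_isClosed_isBounded isClosed_erosion (hΩb.subset (erosion_subset hr))

theorem exists_subset_erosion (hΩ : IsOpen Ω) (hΩb : Bornology.IsBounded Ω) {K : Set Plane}
    (hK : IsCompact K) (hKΩ : K ⊆ Ω) : ∃ r > 0, K ⊆ erosion Ω r := by
  rcases K.eq_empty_or_nonempty with h | h
  · exact ⟨1, one_pos, by simp [h]⟩
  have hne : (Ωᶜ).Nonempty := by
    by_contra hcon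
    rw [not_nonempty_iff_eq_empty, compl_empty_iff] at hcon
    rw [hcon] at hΩb
    exact NormedSpace.unbounded_univ ℝ Plane hΩb
  obtain ⟨x, hx, hmin⟩ := hK.exists_isMinOn h (Metric.continuous_infDist_pt Ωᶜ).continuousOn
  refine ⟨Metric.infDist x Ωᶜ, ?_, fun y hy => hmin hy⟩
  exact (hΩ.isClosed_compl.notMem_iff_infDist_pos hne).1 fun h => h (hKΩ hx)

/-- Mollification commutes with weak derivatives, away from the boundary. -/
theorem mderiv_conv_eq_of_hasWeakDeriv (hΩ : IsOpen Ω) {β : Fin 2 → ℕ} {u g k : Plane → ℝ} {ρ : ℝ}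
    (hu : IntegrableOn u Ω) (hg : HasWeakDeriv Ω β u g) (hk : IsMollifier k ρ) (hρ : ρ < r)
    {x : Plane} (hx : x ∈ erosion Ω r) :
    mderiv β (conv (Ω.indicator u) k) x = conv (Ω.indicator g) k x := by
  have hui : Integrable (Ω.indicator u) := (integrable_indicator_iff hΩ.measurableSet).2 hu
  have hconv : ∀ f k' : Plane → ℝ, conv (Ω.indicator f) k' x = ∫ t in Ω, f t * k' (x - t) := by
    intro f k'
    rw [conv_apply, ← integral_indicator hΩ.measurableSet]
    congr 1; ext t
    by_cases ht : t ∈ Ω <;> simp [ht]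
  have hsupp : tsupport (fun t => k (x - t)) ⊆ Metric.closedBall x ρ := by
    refine closure_minimal (fun t ht => ?_) Metric.isClosed_closedBall
    by_contra hcon
    refine ht (hk.eq_zero _ ?_)
    rw [Metric.mem_closedBall, not_le, dist_comm, dist_eq_norm] at hcon
    exact hcon
  have htest : IsTest Ω (fun t => k (x - t)) := by
    refine ⟨hk.contDiff.comp (contDiff_const.sub contDiff_id), ?_, fun t ht => ?_⟩
    · exact (isCompact_closedBall x ρ).of_isClosed_subset (isClosed_tsupport _) hsupp
    · have := hsupp ht
      rw [Metric.mem_closedBall, dist_comm] at this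
      exact mem_of_mem_erosion hx (this.trans_lt hρ)
  have h := hg.2.2 _ htest
  rw [mderiv_reflect hk.contDiff] at h
  rw [mderiv_conv hui.locallyIntegrable hk.contDiff hk.hasCompactSupport, hconv, hconv]
  have e : ∀ t, u t * ((-1) ^ order β * mderiv β k (x - t))
      = (-1) ^ order β * (u t * mderiv β k (x - t)) := fun t => by ring
  simp_rw [e] at h
  rw [integral_const_mul] at h
  exact mul_left_cancel₀ (pow_ne_zero _ (by norm_num)) h

end Erosion

/-! ### Bounds along lines and on parallelograms -/

section Line

theorem enorm_sub_le_lintegral_deriv {k k' : ℝ → ℝ} (h : ∀ t, HasDerivAt k (k' t) t)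
    (hc : Continuous k') : ‖k 1 - k 0‖ₑ ≤ ∫⁻ t in Icc (0 : ℝ) 1, ‖k' t‖ₑ := by
  rw [← intervalIntegral.integral_eq_sub_of_hasDerivAt (fun t _ => h t)
    (hc.intervalIntegrable _ _), intervalIntegral.integral_of_le zero_le_one,
    ← integral_Icc_eq_integral_Ioc]
  exact enorm_integral_le_lintegral_enorm _

theorem enorm_le_lintegral_add_deriv {k k' : ℝ → ℝ} (h : ∀ t, HasDerivAt k (k' t) t)
    (hc : Continuous k') : ‖k 0‖ₑ ≤ ∫⁻ t in Icc (0 : ℝ) 1, (‖k t‖ₑ + ‖k' t‖ₑ) := by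
  have hkc : Continuous k := continuous_iff_continuousAt.2 fun t => (h t).continuousAt
  have h1 : ∀ t, HasDerivAt (fun t => (1 - t) * k t) (-k t + (1 - t) * k' t) t := fun t => by
    have : HasDerivAt (fun t => (1 - t) * k t) (-1 * k t + (1 - t) * k' t) t :=
      ((hasDerivAt_id' t).const_sub 1).mul (h t)
    simpa using this
  have h2 := enorm_sub_le_lintegral_deriv h1 (by fun_prop)
  simp only [sub_self, zero_mul, sub_zero, one_mul, zero_sub, enorm_neg] at h2
  refine h2.trans (setLIntegral_mono' measurableSet_Icc fun t ht => ?_)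
  refine (enorm_add_le _ _).trans ?_
  rw [enorm_neg, enorm_mul]
  gcongr
  refine mul_le_of_le_one_left zero_le ?_
  rw [Real.enorm_eq_ofReal (by linarith [ht.2])]
  exact ENNReal.ofReal_le_one.2 (by linarith [ht.1])

variable {f : Plane → ℝ}

theorem hasDerivAt_comp_line (hf : ContDiff ℝ ∞ f) (x v : Plane) (t : ℝ) :
    HasDerivAt (fun t : ℝ => f (x + t • v)) (fderiv ℝ f (x + t • v) v) t := by
  have h1 := ((hf.differentiable (by simp)) (x + t • v)).hasFDerivAt
  have h2 : HasDerivAt (fun t : ℝ => x + t • v) v t := by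
    simpa using ((hasDerivAt_id t).smul_const v).const_add x
  exact h1.comp_hasDerivAt t h2

theorem continuous_fderiv_apply (hf : ContDiff ℝ ∞ f) (v : Plane) :
    Continuous fun x => fderiv ℝ f x v :=
  (hf.continuous_fderiv (by simp)).clm_apply continuous_const

theorem contDiff_fderiv_apply (hf : ContDiff ℝ ∞ f) (v : Plane) :
    ContDiff ℝ ∞ fun x => fderiv ℝ f x v :=
  (hf.fderiv_right (m := ∞) (by norm_cast)).clm_apply contDiff_const

theorem enorm_shift_sub_le (hf : ContDiff ℝ ∞ f) (x v : Plane) :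
    ‖f (x + v) - f x‖ₑ ≤ ∫⁻ t in Icc (0 : ℝ) 1, ‖fderiv ℝ f (x + t • v) v‖ₑ := by
  simpa using enorm_sub_le_lintegral_deriv (hasDerivAt_comp_line hf x v)
    ((continuous_fderiv_apply hf v).comp (by fun_prop))

theorem enorm_le_lintegral_line (hf : ContDiff ℝ ∞ f) (x v : Plane) :
    ‖f x‖ₑ ≤ ∫⁻ t in Icc (0 : ℝ) 1, (‖f (x + t • v)‖ₑ + ‖fderiv ℝ f (x + t • v) v‖ₑ) := by
  simpa using enorm_le_lintegral_add_deriv (hasDerivAt_comp_line hf x v)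
    ((continuous_fderiv_apply hf v).comp (by fun_prop))

end Line

section Parallelogram

variable {v w : Plane}

/-- Linear coordinates of the plane with respect to two independent vectors. -/
theorem exists_lintegral_coordinates (hvw : LinearIndependent ℝ ![v, w]) :
    ∃ C : ℝ≥0∞, C ≠ ⊤ ∧ C ≠ 0 ∧ ∀ G : Plane → ℝ≥0∞, Measurable G →
      ∫⁻ s : ℝ, ∫⁻ t : ℝ, G (s • v + t • w) = C * ∫⁻ y, G y := by
  let A : (ℝ × ℝ) →ₗ[ℝ] Plane :=
    (LinearMap.fst ℝ ℝ ℝ).smulRight v + (LinearMap.snd ℝ ℝ ℝ).smulRight w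
  have hA : ∀ q, A q = q.1 • v + q.2 • w := fun q => rfl
  have hinj : Function.Injective A := by
    rw [← LinearMap.ker_eq_bot, LinearMap.ker_eq_bot']
    intro q hq
    rw [hA] at hq
    have := (LinearIndependent.pair_iff.1 hvw) _ _ hq
    exact Prod.ext this.1 this.2
  let e : (ℝ × ℝ) ≃ₗ[ℝ] Plane := LinearEquiv.ofInjectiveOfFinrankEq A hinj (by simp)
  let e' : (ℝ × ℝ) ≃L[ℝ] Plane := e.toContinuousLinearEquiv
  have he' : ∀ q, e' q = q.1 • v + q.2 • w := fun q => hA q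
  have : (Measure.map e' volume).IsAddHaarMeasure := e'.isAddHaarMeasure_map _
  have hm := Measure.isAddLeftInvariant_eq_smul (Measure.map e' volume) (volume : Measure Plane)
  refine ⟨(Measure.addHaarScalarFactor (Measure.map e' volume) (volume : Measure Plane) : NNReal),
    ENNReal.coe_ne_top, ?_, fun G hG => ?_⟩
  · intro h0
    rw [ENNReal.coe_eq_zero] at h0
    exact (Measure.addHaarScalarFactor_pos_of_isAddHaarMeasure (Measure.map e' volume)
      (volume : Measure Plane)).ne' h0
  · have h1 : ∫⁻ y, G y ∂(Measure.map e' volume) = ∫⁻ s : ℝ, ∫⁻ t : ℝ, G (s • v + t • w) := by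
      rw [lintegral_map hG e'.continuous.measurable, Measure.volume_eq_prod, lintegral_prod]
      · rfl
      · exact (hG.comp e'.continuous.measurable).aemeasurable
    rw [← h1]
    refine (congrArg (fun μ => ∫⁻ y, G y ∂μ) hm).trans ?_
    rw [lintegral_smul_measure]
    rfl

/-- A smooth function is bounded by its mixed derivatives up to order two on a parallelogram. -/
theorem enorm_le_of_parallelogram {f : Plane → ℝ} (hf : ContDiff ℝ ∞ f) {C : ℝ≥0∞}
    (hC : ∀ G : Plane → ℝ≥0∞, Measurable G →
      ∫⁻ s : ℝ, ∫⁻ t : ℝ, G (s • v + t • w) = C * ∫⁻ y, G y)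
    {U : Set Plane} (hU : MeasurableSet U) {x : Plane}
    (hx : ∀ s ∈ Icc (0 : ℝ) 1, ∀ t ∈ Icc (0 : ℝ) 1, x + s • v + t • w ∈ U) :
    ‖f x‖ₑ ≤ C * ∫⁻ y in U, ((‖f y‖ₑ + ‖fderiv ℝ f y w‖ₑ) +
      (‖fderiv ℝ f y v‖ₑ + ‖fderiv ℝ (fun z => fderiv ℝ f z v) y w‖ₑ)) := by
  set G : Plane → ℝ≥0∞ := fun y => (‖f y‖ₑ + ‖fderiv ℝ f y w‖ₑ) +
      (‖fderiv ℝ f y v‖ₑ + ‖fderiv ℝ (fun z => fderiv ℝ f z v) y w‖ₑ) with hG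
  have hfv := contDiff_fderiv_apply hf v
  have hGm : Measurable G := by
    have h1 := hf.continuous.measurable
    have h2 := (continuous_fderiv_apply hf w).measurable
    have h3 := (continuous_fderiv_apply hf v).measurable
    have h4 := (continuous_fderiv_apply hfv w).measurable
    exact (h1.enorm.add h2.enorm).add (h3.enorm.add h4.enorm)
  calc ‖f x‖ₑ ≤ ∫⁻ s in Icc (0 : ℝ) 1, (‖f (x + s • v)‖ₑ + ‖fderiv ℝ f (x + s • v) v‖ₑ) :=
        enorm_le_lintegral_line hf x v
    _ ≤ ∫⁻ s in Icc (0 : ℝ) 1, ∫⁻ t in Icc (0 : ℝ) 1, G (x + s • v + t • w) := by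
        refine lintegral_mono fun s => ?_
        have e1 := enorm_le_lintegral_line hf (x + s • v) w
        have e2 := enorm_le_lintegral_line hfv (x + s • v) w
        refine (add_le_add e1 e2).trans_eq ?_
        rw [← lintegral_add_left]
        have h1 := hf.continuous
        have h2 := (continuous_fderiv_apply hf w)
        exact Measurable.add (Continuous.measurable (by fun_prop)).enorm
          (h2.comp (by fun_prop : Continuous fun t : ℝ => x + s • v + t • w)).measurable.enorm
    _ ≤ ∫⁻ s : ℝ, ∫⁻ t : ℝ, (fun y => U.indicator G (x + y)) (s • v + t • w) := by
        rw [← lintegral_indicator measurableSet_Icc]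
        refine lintegral_mono fun s => ?_
        by_cases hs : s ∈ Icc (0 : ℝ) 1
        swap
        · rw [indicator_of_notMem hs]; exact zero_le
        rw [indicator_of_mem hs, ← lintegral_indicator measurableSet_Icc]
        refine lintegral_mono fun t => ?_
        by_cases ht : t ∈ Icc (0 : ℝ) 1
        swap
        · rw [indicator_of_notMem ht]; exact zero_le
        rw [indicator_of_mem ht]
        simp only [← add_assoc]
        rw [indicator_of_mem (hx s hs t ht)]
    _ = C * ∫⁻ y, U.indicator G (x + y) :=
        hC _ ((hGm.indicator hU).comp (measurable_const_add x))
    _ = C * ∫⁻ y in U, G y := by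
        rw [lintegral_add_left_eq_self (fun y => U.indicator G y) x, lintegral_indicator hU]

/-- The Gagliardo–Nirenberg argument in the skew coordinates `s v + t w`: the function is bounded
at each point by a line integral in the direction `v`, which depends on `t` only, and by one in the
direction `w`, which depends on `s` only. The constant `C` is the Jacobian of the coordinates. -/
theorem lintegral_sq_le_of_parallelogram {f : Plane → ℝ} (hf : ContDiff ℝ ∞ f) {C : ℝ≥0∞}
    (hCt : C ≠ ⊤) (hC0 : C ≠ 0)
    (hC : ∀ G : Plane → ℝ≥0∞, Measurable G →
      ∫⁻ s : ℝ, ∫⁻ t : ℝ, G (s • v + t • w) = C * ∫⁻ y, G y)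
    {U V : Set Plane} (hU : MeasurableSet U) (hV : MeasurableSet V)
    (hv : ∀ x ∈ V, ∀ s ∈ Icc (0 : ℝ) 1, x + s • v ∈ U)
    (hw : ∀ x ∈ V, ∀ t ∈ Icc (0 : ℝ) 1, x + t • w ∈ U) :
    ∫⁻ x in V, ‖f x‖ₑ ^ 2 ≤ C * (∫⁻ y in U, (‖f y‖ₑ + ‖fderiv ℝ f y v‖ₑ)) *
      ∫⁻ y in U, (‖f y‖ₑ + ‖fderiv ℝ f y w‖ₑ) := by
  have hGm : ∀ z, Measurable (U.indicator fun y => ‖f y‖ₑ + ‖fderiv ℝ f y z‖ₑ) := fun z =>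
    (hf.continuous.measurable.enorm.add (continuous_fderiv_apply hf z).measurable.enorm).indicator
      hU
  set g : Plane → Plane → ℝ≥0∞ := fun z => U.indicator fun y => ‖f y‖ₑ + ‖fderiv ℝ f y z‖ₑ with hg
  set a : ℝ → ℝ≥0∞ := fun t => ∫⁻ s : ℝ, g v (s • v + t • w) with ha
  set b : ℝ → ℝ≥0∞ := fun s => ∫⁻ t : ℝ, g w (s • v + t • w) with hb
  have hline : ∀ (z : Plane) (x : Plane), (∀ s ∈ Icc (0 : ℝ) 1, x + s • z ∈ U) →
      ‖f x‖ₑ ≤ ∫⁻ s : ℝ, g z (x + s • z) := by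
    intro z x hx
    refine (enorm_le_lintegral_line hf x z).trans ?_
    rw [← lintegral_indicator measurableSet_Icc]
    refine lintegral_mono fun s => ?_
    by_cases hs : s ∈ Icc (0 : ℝ) 1
    · rw [indicator_of_mem hs, hg]
      simp only
      rw [indicator_of_mem (hx s hs)]
    · rw [indicator_of_notMem hs]; exact zero_le
  have hmap : ∀ z, Measurable fun q : ℝ × ℝ => g z (q.1 • v + q.2 • w) := fun z =>
    (hGm z).comp (Continuous.measurable (by fun_prop))
  have ham : Measurable a := (hmap v).lintegral_prod_left'
  have hbm : Measurable b := (hmap w).lintegral_prod_right'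
  have hpt : ∀ s t : ℝ, V.indicator (fun x => ‖f x‖ₑ ^ 2) (s • v + t • w) ≤ b s * a t := by
    intro s t
    by_cases hx : s • v + t • w ∈ V
    swap
    · rw [indicator_of_notMem hx]; exact zero_le
    rw [indicator_of_mem hx, sq]
    refine mul_le_mul' ?_ ?_
    · refine (hline w _ (hw _ hx)).trans_eq ?_
      rw [hb]
      simp only
      rw [← lintegral_add_left_eq_self (fun t' => g w (s • v + t' • w)) t]
      refine lintegral_congr fun τ => ?_
      congr 1; module
    · refine (hline v _ (hv _ hx)).trans_eq ?_
      rw [ha]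
      simp only
      rw [← lintegral_add_left_eq_self (fun s' => g v (s' • v + t • w)) s]
      refine lintegral_congr fun τ => ?_
      congr 1; module
  have hab : C * ∫⁻ x in V, ‖f x‖ₑ ^ 2 ≤ (∫⁻ s, b s) * ∫⁻ t, a t := by
    rw [← lintegral_indicator hV,
      ← hC _ ((hf.continuous.measurable.enorm.pow_const 2).indicator hV)]
    calc _ ≤ ∫⁻ s : ℝ, ∫⁻ t : ℝ, b s * a t :=
          lintegral_mono fun s => lintegral_mono fun t => hpt s t
      _ = ∫⁻ s : ℝ, b s * ∫⁻ t : ℝ, a t := lintegral_congr fun s => lintegral_const_mul _ ham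
      _ = _ := lintegral_mul_const _ hbm
  have hbC : ∫⁻ s, b s = C * ∫⁻ y in U, (‖f y‖ₑ + ‖fderiv ℝ f y w‖ₑ) := by
    rw [← lintegral_indicator hU]; exact hC _ (hGm w)
  have haC : ∫⁻ t, a t = C * ∫⁻ y in U, (‖f y‖ₑ + ‖fderiv ℝ f y v‖ₑ) := by
    rw [← lintegral_indicator hU, ← hC _ (hGm v), ha, lintegral_lintegral_swap]
    exact ((hmap v).comp measurable_swap).aemeasurable
  rw [hbC, haC, mul_assoc, mul_comm (∫⁻ y in U, (‖f y‖ₑ + ‖fderiv ℝ f y w‖ₑ))] at hab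
  refine ((ENNReal.mul_le_mul_iff_right hC0 hCt).1 hab).trans_eq ?_
  ring

end Parallelogram

/-! ### Weak derivatives -/

section WeakDerivative

variable {Ω : Set Plane}

theorem HasWeakDeriv.ae_eq (hΩ : IsOpen Ω) {β : Fin 2 → ℕ} {f g g' : Plane → ℝ}
    (hg : HasWeakDeriv Ω β f g) (hg' : HasWeakDeriv Ω β f g') :
    g =ᵐ[volume.restrict Ω] g' := by
  have h := hΩ.ae_eq_zero_of_integral_contDiff_smul_eq_zero (f := g - g') (μ := volume)
    (hg.2.1.sub hg'.2.1) fun η hη hηc hηΩ => by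
      have ht : IsTest Ω η := ⟨hη, hηc, hηΩ⟩
      have hint : ∀ {q : Plane → ℝ}, LocallyIntegrableOn q Ω → Integrable (fun x => q x * η x) := by
        intro q hq
        have h1 : IntegrableOn q (tsupport η) := hq.integrableOn_compact_subset hηΩ hηc
        have h2 : IntegrableOn (fun x => q x * η x) (tsupport η) :=
          h1.mul_continuousOn hη.continuous.continuousOn hηc
        refine (integrableOn_iff_integrable_of_support_subset fun x hx => ?_).1 h2
        exact subset_tsupport _ fun h0 => hx (by simp [h0])
      have hset : ∀ q : Plane → ℝ, ∫ x, q x * η x = ∫ x in Ω, q x * η x := by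
        intro q
        refine (setIntegral_eq_integral_of_forall_compl_eq_zero fun x hx => ?_).symm
        rw [image_eq_zero_of_notMem_tsupport fun h => hx (hηΩ h), mul_zero]
      have e : ∀ x, η x • (g - g') x = g x * η x - g' x * η x := fun x => by
        simp only [Pi.sub_apply, smul_eq_mul]; ring
      simp_rw [e]
      rw [integral_sub (hint hg.2.1) (hint hg'.2.1), hset, hset]
      have h1 := (hg.2.2 η ht).symm.trans (hg'.2.2 η ht)
      rw [mul_left_cancel₀ (pow_ne_zero _ (by norm_num)) h1, sub_self]
  rw [EventuallyEq, ae_restrict_iff' hΩ.measurableSet]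
  filter_upwards [h] with x hx hxΩ
  have := hx hxΩ
  simp only [Pi.sub_apply] at this
  linarith

theorem HasWeakDeriv.weakDeriv_ae_eq (hΩ : IsOpen Ω) {β : Fin 2 → ℕ} {f g : Plane → ℝ}
    (hg : HasWeakDeriv Ω β f g) : weakDeriv Ω β f =ᵐ[volume.restrict Ω] g := by
  have h : ∃ g, HasWeakDeriv Ω β f g := ⟨g, hg⟩
  rw [weakDeriv, dif_pos h]
  exact HasWeakDeriv.ae_eq hΩ h.choose_spec hg

theorem memLp_weakDeriv (hΩ : IsOpen Ω) {m : ℕ} {f : Plane → ℝ} (hf : MemSobolev Ω m f)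
    {β : Fin 2 → ℕ} (hβ : order β ≤ m) : MemLp (weakDeriv Ω β f) 2 (volume.restrict Ω) := by
  obtain ⟨g, hg, hw⟩ := hf β hβ
  exact hg.ae_eq (hw.weakDeriv_ae_eq hΩ).symm

theorem integrable_normSqDm (hΩ : IsOpen Ω) {m : ℕ} {φ : Plane → Plane}
    (hφ : ∀ i : Fin 2, MemSobolev Ω m (fun x => φ x i)) :
    Integrable (normSqDm Ω m φ) (volume.restrict Ω) := by
  refine integrable_finsetSum _ fun i _ => integrable_finsetSum _ fun j hj => ?_
  refine (memLp_weakDeriv hΩ (hφ i) ?_).integrable_sq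
  have := Finset.mem_range.1 hj
  simp only [order, Matrix.cons_val_zero, Matrix.cons_val_one]
  omega

/-- The weak partial derivatives of a Lipschitz function are its pointwise ones. -/
theorem hasWeakDeriv_of_lipschitzWith (hΩ : IsOpen Ω) {f h : Plane → ℝ} {L : NNReal}
    (hf : LipschitzWith L f) (hfh : EqOn h f Ω) (j : Fin 2) :
    HasWeakDeriv Ω (Pi.single j 1) h fun x => lineDeriv ℝ f x (basisVec j) := by
  have hloc : LocallyIntegrable (fun x => lineDeriv ℝ f x (basisVec j)) :=
    hf.locallyIntegrable_lineDeriv _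
  have hcont : ContinuousOn h Ω := hf.continuous.continuousOn.congr hfh
  refine ⟨hcont.locallyIntegrableOn hΩ.measurableSet, hloc.locallyIntegrableOn _,
    fun η hη => ?_⟩
  obtain ⟨D, hD⟩ := ContDiff.lipschitzWith_of_hasCompactSupport hη.2.1 hη.1 (by simp)
  have h1 := hf.integral_lineDeriv_mul_eq hD hη.2.1 (basisVec j) (μ := volume)
  have hline : ∀ x, lineDeriv ℝ η x (-(basisVec j)) = - pderiv j η x := fun x => by
    rw [((hη.1.differentiable (by simp)) x).lineDeriv_eq_fderiv, map_neg]; rfl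
  have hzero : ∀ x, x ∉ Ω → pderiv j η x = 0 := by
    intro x hx
    have h0 : η =ᶠ[𝓝 x] fun _ => 0 := notMem_tsupport_iff_eventuallyEq.1 fun h => hx (hη.2.2 h)
    simp [pderiv, h0.fderiv_eq]
  have hord : order (Pi.single j 1) = 1 := by fin_cases j <;> simp [order]
  rw [mderiv_single, hord, pow_one, neg_one_mul]
  rw [setIntegral_congr_fun hΩ.measurableSet (g := fun x => f x * pderiv j η x)
      fun x hx => by simp only [hfh hx],
    setIntegral_eq_integral_of_forall_compl_eq_zero fun x hx => by rw [hzero x hx, mul_zero],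
    setIntegral_eq_integral_of_forall_compl_eq_zero fun x hx => by
      rw [image_eq_zero_of_notMem_tsupport fun h => hx (hη.2.2 h), mul_zero], h1, ← integral_neg]
  congr 1
  ext x
  rw [hline]; ring

theorem jacobian_det_ae_eq (hΩ : IsOpen Ω) {φ Φ : Plane → Plane} {L : NNReal}
    (hΦ : LipschitzWith L Φ) (h : EqOn φ Φ Ω) :
    ∀ᵐ x ∂(volume.restrict Ω), (jacobian Ω φ x).det = (fderiv ℝ Φ x).det := by
  have hi : ∀ i : Fin 2, LipschitzWith L (fun x => Φ x i) := fun i => by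
    have := (LipschitzWith.of_dist_le_mul (K := 1) (f := fun x : Plane => x i) fun x y => by
      rw [NNReal.coe_one, one_mul, dist_eq_norm, dist_eq_norm]
      exact abs_apply_le_norm (x - y) i).comp hΦ
    simpa [Function.comp_def] using this
  have hw : ∀ i j : Fin 2, weakDeriv Ω (Pi.single j 1) (fun y => φ y i)
      =ᵐ[volume.restrict Ω] fun x => lineDeriv ℝ (fun y => Φ y i) x (basisVec j) := fun i j =>
    (hasWeakDeriv_of_lipschitzWith hΩ (hi i) (fun x hx => by rw [h hx]) j).weakDeriv_ae_eq hΩ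
  filter_upwards [hw 0 0, hw 0 1, hw 1 0, hw 1 1, ae_restrict_of_ae hΦ.ae_differentiableAt]
    with x h00 h01 h10 h11 hd
  have hline : ∀ i j : Fin 2, lineDeriv ℝ (fun y => Φ y i) x (basisVec j)
      = fderiv ℝ Φ x (basisVec j) i := by
    intro i j
    have h1 : HasFDerivAt (fun y => Φ y i)
        ((EuclideanSpace.proj i : Plane →L[ℝ] ℝ).comp (fderiv ℝ Φ x)) x :=
      (EuclideanSpace.proj i : Plane →L[ℝ] ℝ).hasFDerivAt.comp x hd.hasFDerivAt
    rw [(h1.hasLineDerivAt _).lineDeriv]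
    rfl
  rw [Matrix.det_fin_two, continuousLinearMap_det_eq]
  simp only [jacobian, Matrix.of_apply]
  rw [h00, h01, h10, h11, hline, hline, hline, hline]

end WeakDerivative

/-! ### Admissible deformations are Lipschitz -/

section SobolevEmbedding

variable {Ω : Set Plane}

theorem fderiv_mderiv_apply {f : Plane → ℝ} (hf : ContDiff ℝ ∞ f) (β : Fin 2 → ℕ) (y v : Plane) :
    fderiv ℝ (mderiv β f) y v = v 0 * mderiv (β + Pi.single 0 1) f y
      + v 1 * mderiv (β + Pi.single 1 1) f y := by
  rw [fderiv_apply_eq, pderiv_mderiv hf, pderiv_mderiv hf]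

theorem lintegral_fderiv_mderiv_le {f : Plane → ℝ} (hf : ContDiff ℝ ∞ f) {U : Set Plane}
    {N : (Fin 2 → ℕ) → ℝ≥0∞} (β : Fin 2 → ℕ) (v : Plane)
    (hN : ∀ i : Fin 2, ∫⁻ y in U, ‖mderiv (β + Pi.single i 1) f y‖ₑ ≤ N (β + Pi.single i 1)) :
    ∫⁻ y in U, ‖fderiv ℝ (mderiv β f) y v‖ₑ
      ≤ ‖v 0‖ₑ * N (β + Pi.single 0 1) + ‖v 1‖ₑ * N (β + Pi.single 1 1) := by
  have hm : ∀ β, Measurable fun y => ‖mderiv β f y‖ₑ := fun β =>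
    (contDiff_mderiv hf β).continuous.measurable.enorm
  calc ∫⁻ y in U, ‖fderiv ℝ (mderiv β f) y v‖ₑ
      ≤ ∫⁻ y in U, (‖v 0‖ₑ * ‖mderiv (β + Pi.single 0 1) f y‖ₑ
        + ‖v 1‖ₑ * ‖mderiv (β + Pi.single 1 1) f y‖ₑ) := by
        refine lintegral_mono fun y => ?_
        rw [fderiv_mderiv_apply hf, ← enorm_mul, ← enorm_mul]
        exact enorm_add_le _ _
    _ = ‖v 0‖ₑ * (∫⁻ y in U, ‖mderiv (β + Pi.single 0 1) f y‖ₑ)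
        + ‖v 1‖ₑ * ∫⁻ y in U, ‖mderiv (β + Pi.single 1 1) f y‖ₑ := by
        rw [lintegral_add_left ((hm _).const_mul _), lintegral_const_mul _ (hm _),
          lintegral_const_mul _ (hm _)]
    _ ≤ _ := by gcongr <;> exact hN _

theorem lintegral_fderiv_fderiv_mderiv_le {f : Plane → ℝ} (hf : ContDiff ℝ ∞ f) {U : Set Plane}
    {N : (Fin 2 → ℕ) → ℝ≥0∞} (β : Fin 2 → ℕ) (v w : Plane)
    (hN : ∀ i j : Fin 2, ∫⁻ y in U, ‖mderiv (β + Pi.single i 1 + Pi.single j 1) f y‖ₑ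
      ≤ N (β + Pi.single i 1 + Pi.single j 1)) :
    ∫⁻ y in U, ‖fderiv ℝ (fun z => fderiv ℝ (mderiv β f) z v) y w‖ₑ
      ≤ ‖v 0‖ₑ * (‖w 0‖ₑ * N (β + Pi.single 0 1 + Pi.single 0 1)
          + ‖w 1‖ₑ * N (β + Pi.single 0 1 + Pi.single 1 1))
        + ‖v 1‖ₑ * (‖w 0‖ₑ * N (β + Pi.single 1 1 + Pi.single 0 1)
          + ‖w 1‖ₑ * N (β + Pi.single 1 1 + Pi.single 1 1)) := by
  have hm : ∀ β, Measurable fun y => ‖fderiv ℝ (mderiv β f) y w‖ₑ := fun β =>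
    (continuous_fderiv_apply (contDiff_mderiv hf β) w).measurable.enorm
  have hd : ∀ β y, HasFDerivAt (mderiv β f) (fderiv ℝ (mderiv β f) y) y := fun β y =>
    (((contDiff_mderiv hf β).differentiable (by simp)) y).hasFDerivAt
  have e : ∀ y, fderiv ℝ (fun z => fderiv ℝ (mderiv β f) z v) y w
      = v 0 * fderiv ℝ (mderiv (β + Pi.single 0 1) f) y w
        + v 1 * fderiv ℝ (mderiv (β + Pi.single 1 1) f) y w := by
    intro y
    simp_rw [fderiv_mderiv_apply hf β _ v]
    rw [(((hd _ y).const_mul (v 0)).fun_add ((hd _ y).const_mul (v 1))).fderiv]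
    simp
  calc _ ≤ ∫⁻ y in U, (‖v 0‖ₑ * ‖fderiv ℝ (mderiv (β + Pi.single 0 1) f) y w‖ₑ
        + ‖v 1‖ₑ * ‖fderiv ℝ (mderiv (β + Pi.single 1 1) f) y w‖ₑ) := by
        refine lintegral_mono fun y => ?_
        rw [e, ← enorm_mul, ← enorm_mul]
        exact enorm_add_le _ _
    _ = ‖v 0‖ₑ * (∫⁻ y in U, ‖fderiv ℝ (mderiv (β + Pi.single 0 1) f) y w‖ₑ)
        + ‖v 1‖ₑ * ∫⁻ y in U, ‖fderiv ℝ (mderiv (β + Pi.single 1 1) f) y w‖ₑ := by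
        rw [lintegral_add_left ((hm _).const_mul _), lintegral_const_mul _ (hm _),
          lintegral_const_mul _ (hm _)]
    _ ≤ _ := by
        gcongr
        · exact lintegral_fderiv_mderiv_le hf _ w fun j => hN 0 j
        · exact lintegral_fderiv_mderiv_le hf _ w fun j => hN 1 j

/-- The parallelogram `x + [0,1] v + [0,1] w`, for `x` near an interior point, stays away from the
boundary. -/
theorem exists_ball_parallelogram_subset_erosion (hΩ : IsOpen Ω) (hΩb : Bornology.IsBounded Ω)
    {p v w x₀ : Plane} {r₀ : ℝ}
    (hcone : ∀ x ∈ Ω ∩ Metric.ball p r₀, ∀ s ∈ Icc (0 : ℝ) 1, ∀ t ∈ Icc (0 : ℝ) 1,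
      x + s • v + t • w ∈ Ω) (hx₀ : x₀ ∈ Ω ∩ Metric.ball p r₀) :
    ∃ ε > 0, ∃ r > 0, Metric.ball x₀ ε ⊆ Ω ∧
      ∀ x ∈ Metric.ball x₀ ε, ∀ s ∈ Icc (0 : ℝ) 1, ∀ t ∈ Icc (0 : ℝ) 1,
        x + s • v + t • w ∈ erosion Ω r := by
  obtain ⟨ε, hε, hball⟩ := Metric.nhds_basis_closedBall.mem_iff.1
    ((hΩ.inter Metric.isOpen_ball).mem_nhds hx₀)
  have hK : IsCompact ((fun q : Plane × ℝ × ℝ => q.1 + q.2.1 • v + q.2.2 • w) ''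
      (Metric.closedBall x₀ ε ×ˢ (Icc (0 : ℝ) 1 ×ˢ Icc (0 : ℝ) 1))) :=
    ((isCompact_closedBall x₀ ε).prod (isCompact_Icc.prod isCompact_Icc)).image (by fun_prop)
  obtain ⟨r, hr, hKr⟩ := exists_subset_erosion hΩ hΩb hK (by
    rintro _ ⟨⟨x, s, t⟩, ⟨hx, hs, ht⟩, rfl⟩
    exact hcone x (hball hx) s hs t ht)
  exact ⟨ε, hε, r, hr, (Metric.ball_subset_closedBall.trans hball).trans inter_subset_left,
    fun x hx s hs t ht => hKr ⟨(x, s, t), ⟨Metric.ball_subset_closedBall hx, hs, ht⟩, rfl⟩⟩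

/-- A continuous function in `W^{3,2}` is locally Lipschitz near a boundary point, with a constant
that depends only on the cone at that point. -/
theorem exists_locally_lipschitz_near (hΩ : IsOpen Ω) (hΩb : Bornology.IsBounded Ω)
    {u : Plane → ℝ} (hu : MemSobolev Ω 3 u) (huc : ContinuousOn u Ω)
    {p v w : Plane} {r₀ : ℝ} (hvw : LinearIndependent ℝ ![v, w])
    (hcone : ∀ x ∈ Ω ∩ Metric.ball p r₀, ∀ s ∈ Icc (0 : ℝ) 1, ∀ t ∈ Icc (0 : ℝ) 1,
      x + s • v + t • w ∈ Ω) :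
    ∃ M : NNReal, ∀ x ∈ Ω ∩ Metric.ball p r₀, ∃ ε > 0, LipschitzOnWith M u (Metric.ball x ε) := by
  have hfin : IsFiniteMeasure (volume.restrict Ω) := ⟨by simpa using hΩb.measure_lt_top⟩
  have hex : ∀ β : Fin 2 → ℕ, ∃ g : Plane → ℝ, order β ≤ 3 →
      MemLp g 2 (volume.restrict Ω) ∧ HasWeakDeriv Ω β u g := fun β => by
    by_cases h : order β ≤ 3
    · obtain ⟨g, hg⟩ := hu β h
      exact ⟨g, fun _ => hg⟩
    · exact ⟨0, fun h' => absurd h' h⟩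
  choose g hg using hex
  have hgi : ∀ β, order β ≤ 3 → IntegrableOn (g β) Ω := fun β hβ =>
    (hg β hβ).1.integrable (by norm_num)
  set N : (Fin 2 → ℕ) → ℝ≥0∞ := fun β => ∫⁻ y in Ω, ‖g β y‖ₑ with hNdef
  have hNfin : ∀ β, order β ≤ 3 → N β ≠ ⊤ := fun β hβ => (hgi β hβ).2.ne
  have hui : IntegrableOn u Ω := by
    obtain ⟨g0, hg0, hw⟩ := hu 0 (by simp [order])
    have h0 : HasWeakDeriv Ω 0 u u := ⟨hw.1, hw.1, fun η hη => by simp [mderiv, order]⟩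
    exact ((hg0.integrable (by norm_num)).congr (hw.ae_eq hΩ h0))
  obtain ⟨C, hCt, -, hC⟩ := exists_lintegral_coordinates hvw
  obtain ⟨k, ρ, hk, hρ, -, hlim⟩ := exists_isMollifier_seq
  have hind : Integrable (Ω.indicator u) := (integrable_indicator_iff hΩ.measurableSet).2 hui
  set f : ℕ → Plane → ℝ := fun n => conv (Ω.indicator u) (k n) with hf
  have hfs : ∀ n, ContDiff ℝ ∞ (f n) := fun n =>
    contDiff_conv hind.locallyIntegrable (hk n).contDiff (hk n).hasCompactSupport
  -- the mollifications inherit the `L¹` bounds of the weak derivatives away from the boundary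
  have hbound : ∀ n r, ρ n < r → ∀ β, order β ≤ 3 →
      ∫⁻ y in erosion Ω r, ‖mderiv β (f n) y‖ₑ ≤ N β := by
    intro n r hnr β hβ
    calc ∫⁻ y in erosion Ω r, ‖mderiv β (f n) y‖ₑ
        = ∫⁻ y in erosion Ω r, ‖conv (Ω.indicator (g β)) (k n) y‖ₑ :=
          setLIntegral_congr_fun isClosed_erosion.measurableSet fun y hy => by
            simp only [hf]
            rw [mderiv_conv_eq_of_hasWeakDeriv hΩ hui (hg β hβ).2 (hk n) hnr hy]
      _ ≤ ∫⁻ y, ‖conv (Ω.indicator (g β)) (k n) y‖ₑ := setLIntegral_le_lintegral _ _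
      _ ≤ ∫⁻ y, ‖Ω.indicator (g β) y‖ₑ := (hk n).lintegral_enorm_conv_le
          ((integrable_indicator_iff hΩ.measurableSet).2 (hgi β hβ))
      _ = N β := by
          simp_rw [enorm_indicator_eq_indicator_enorm]
          rw [lintegral_indicator hΩ.measurableSet]
  -- the constant controlling the `j`-th partial derivative
  set P : Fin 2 → ℝ≥0∞ := fun j => C * ((N (Pi.single j 1)
      + (‖w 0‖ₑ * N (Pi.single j 1 + Pi.single 0 1) + ‖w 1‖ₑ * N (Pi.single j 1 + Pi.single 1 1)))
    + ((‖v 0‖ₑ * N (Pi.single j 1 + Pi.single 0 1) + ‖v 1‖ₑ * N (Pi.single j 1 + Pi.single 1 1))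
      + (‖v 0‖ₑ * (‖w 0‖ₑ * N (Pi.single j 1 + Pi.single 0 1 + Pi.single 0 1)
          + ‖w 1‖ₑ * N (Pi.single j 1 + Pi.single 0 1 + Pi.single 1 1))
        + ‖v 1‖ₑ * (‖w 0‖ₑ * N (Pi.single j 1 + Pi.single 1 1 + Pi.single 0 1)
          + ‖w 1‖ₑ * N (Pi.single j 1 + Pi.single 1 1 + Pi.single 1 1))))) with hP
  have ho1 : ∀ j : Fin 2, order (Pi.single j 1) ≤ 3 := by intro j; fin_cases j <;> simp [order]
  have ho2 : ∀ j i : Fin 2, order (Pi.single j 1 + Pi.single i 1) ≤ 3 := by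
    intro j i; fin_cases j <;> fin_cases i <;> simp [order]
  have ho3 : ∀ j i l : Fin 2, order (Pi.single j 1 + Pi.single i 1 + Pi.single l 1) ≤ 3 := by
    intro j i l; fin_cases j <;> fin_cases i <;> fin_cases l <;> simp [order]
  have hPt : ∀ j, P j ≠ ⊤ := by
    intro j
    have n1 := hNfin _ (ho1 j)
    have n2 := fun i => hNfin _ (ho2 j i)
    have n3 := fun i l => hNfin _ (ho3 j i l)
    have m2 : ∀ (c : ℝ) i, ‖c‖ₑ * N (Pi.single j 1 + Pi.single i 1) ≠ ⊤ := fun c i =>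
      ENNReal.mul_ne_top enorm_ne_top (n2 i)
    have m3 : ∀ (c : ℝ) i l, ‖c‖ₑ * N (Pi.single j 1 + Pi.single i 1 + Pi.single l 1) ≠ ⊤ :=
      fun c i l => ENNReal.mul_ne_top enorm_ne_top (n3 i l)
    refine ENNReal.mul_ne_top hCt (ENNReal.add_ne_top.2 ⟨ENNReal.add_ne_top.2 ⟨n1, ?_⟩,
      ENNReal.add_ne_top.2 ⟨?_, ENNReal.add_ne_top.2 ⟨?_, ?_⟩⟩⟩)
    · exact ENNReal.add_ne_top.2 ⟨m2 _ _, m2 _ _⟩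
    · exact ENNReal.add_ne_top.2 ⟨m2 _ _, m2 _ _⟩
    · exact ENNReal.mul_ne_top enorm_ne_top (ENNReal.add_ne_top.2 ⟨m3 _ _ _, m3 _ _ _⟩)
    · exact ENNReal.mul_ne_top enorm_ne_top (ENNReal.add_ne_top.2 ⟨m3 _ _ _, m3 _ _ _⟩)
  refine ⟨(P 0).toNNReal + (P 1).toNNReal, fun x₀ hx₀ => ?_⟩
  obtain ⟨ε, hε, r, hr, hεΩ, hpar⟩ := exists_ball_parallelogram_subset_erosion hΩ hΩb hcone hx₀
  refine ⟨ε, hε, ?_⟩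
  have hpd : ∀ n, ρ n < r → ∀ x ∈ Metric.ball x₀ ε, ∀ j, ‖pderiv j (f n) x‖ₑ ≤ P j := by
    intro n hn x hx j
    rw [← mderiv_single]
    refine (enorm_le_of_parallelogram (contDiff_mderiv (hfs n) _) hC
      isClosed_erosion.measurableSet (hpar x hx)).trans ?_
    have hs := contDiff_mderiv (hfs n) (Pi.single j 1)
    have m1 : Measurable fun y => ‖mderiv (Pi.single j 1) (f n) y‖ₑ :=
      hs.continuous.measurable.enorm
    have m2 : ∀ z, Measurable fun y => ‖fderiv ℝ (mderiv (Pi.single j 1) (f n)) y z‖ₑ := fun z =>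
      (continuous_fderiv_apply hs z).measurable.enorm
    have m12 : Measurable fun y => ‖mderiv (Pi.single j 1) (f n) y‖ₑ
        + ‖fderiv ℝ (mderiv (Pi.single j 1) (f n)) y w‖ₑ := m1.add (m2 w)
    rw [lintegral_add_left m12, lintegral_add_left m1, lintegral_add_left (m2 v)]
    simp only [hP]
    gcongr
    · exact hbound n r hn _ (ho1 j)
    · exact lintegral_fderiv_mderiv_le (hfs n) _ w fun i => hbound n r hn _ (ho2 j i)
    · exact lintegral_fderiv_mderiv_le (hfs n) _ v fun i => hbound n r hn _ (ho2 j i)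
    · exact lintegral_fderiv_fderiv_mderiv_le (hfs n) _ v w
        fun i l => hbound n r hn _ (ho3 j i l)
  have hlipn : ∀ n, ρ n < r →
      LipschitzOnWith ((P 0).toNNReal + (P 1).toNNReal) (f n) (Metric.ball x₀ ε) := by
    intro n hn
    refine Convex.lipschitzOnWith_of_nnnorm_fderiv_le
      (fun x _ => ((hfs n).differentiable (by simp)) x) (fun x hx => ?_) (convex_ball x₀ ε)
    rw [← NNReal.coe_le_coe, coe_nnnorm]
    refine ContinuousLinearMap.opNorm_le_bound _ (by positivity) fun z => ?_
    have hj : ∀ j, |pderiv j (f n) x| ≤ (P j).toNNReal := fun j => by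
      have := ENNReal.toNNReal_mono (hPt j) (hpd n hn x hx j)
      rw [toNNReal_enorm, ← NNReal.coe_le_coe, coe_nnnorm] at this
      exact this
    rw [fderiv_apply_eq, Real.norm_eq_abs, NNReal.coe_add]
    calc |z 0 * pderiv 0 (f n) x + z 1 * pderiv 1 (f n) x|
        ≤ |z 0| * |pderiv 0 (f n) x| + |z 1| * |pderiv 1 (f n) x| := by
          rw [← abs_mul, ← abs_mul]; exact abs_add_le _ _
      _ ≤ ‖z‖ * (P 0).toNNReal + ‖z‖ * (P 1).toNNReal := by
          gcongr
          · exact abs_apply_le_norm z 0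
          · exact hj 0
          · exact abs_apply_le_norm z 1
          · exact hj 1
      _ = _ := by ring
  have hlimx : ∀ x ∈ Metric.ball x₀ ε, Tendsto (fun n => f n x) atTop (𝓝 (u x)) := by
    intro x hx
    have hev : Ω.indicator u =ᶠ[𝓝 x] u := by
      filter_upwards [hΩ.mem_nhds (hεΩ hx)] with y hy
      rw [indicator_of_mem hy]
    have hca : ContinuousAt (Ω.indicator u) x :=
      (huc.continuousAt (hΩ.mem_nhds (hεΩ hx))).congr hev.symm
    have := hlim _ x hind.aestronglyMeasurable hca
    rwa [indicator_of_mem (hεΩ hx)] at this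
  refine LipschitzOnWith.of_dist_le_mul fun x hx y hy => ?_
  refine le_of_tendsto ((hlimx x hx).dist (hlimx y hy)) ?_
  filter_upwards [(tendsto_order.1 hρ).2 r hr] with n hn
  exact (hlipn n hn).dist_le_mul x hx y hy

/-- The embedding of `W^{3,2}` into `W^{1,∞}` on a bounded Lipschitz domain. -/
theorem exists_locally_lipschitz (hΩ : IsOpen Ω) (hΩb : Bornology.IsBounded Ω)
    (hlip : HasLipschitzBoundary Ω) {u : Plane → ℝ} (hu : MemSobolev Ω 3 u)
    (huc : ContinuousOn u Ω) :
    ∃ M : NNReal, ∀ x ∈ Ω, ∃ ε > 0, LipschitzOnWith M u (Metric.ball x ε) := by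
  have hloc : ∀ p ∈ closure Ω, ∃ r > 0, ∃ M : NNReal, ∀ x ∈ Ω ∩ Metric.ball p r,
      ∃ ε > 0, LipschitzOnWith M u (Metric.ball x ε) := by
    intro p hp
    obtain ⟨r, hr, v, w, hvw, hcone⟩ := hlip.exists_parallelogram hΩ hp
    obtain ⟨M, hM⟩ := exists_locally_lipschitz_near hΩ hΩb hu huc hvw hcone
    exact ⟨r, hr, M, hM⟩
  choose! r hr M hM using hloc
  obtain ⟨t, ht, hcov⟩ := hΩb.isCompact_closure.elim_nhds_subcover (fun p => Metric.ball p (r p))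
    fun p hp => Metric.ball_mem_nhds p (hr p hp)
  refine ⟨t.sup M, fun x hx => ?_⟩
  obtain ⟨p, hpt, hxp⟩ := mem_iUnion₂.1 (hcov (subset_closure hx))
  obtain ⟨ε, hε, h⟩ := hM p (ht p hpt) x ⟨hx, hxp⟩
  exact ⟨ε, hε, h.weaken (Finset.le_sup hpt)⟩

theorem MemSobolev.mono {m n : ℕ} (hmn : m ≤ n) {u : Plane → ℝ} (hu : MemSobolev Ω n u) :
    MemSobolev Ω m u := fun β hβ => hu β (hβ.trans hmn)

/-- An admissible deformation is Lipschitz, because `m ≥ 3`, and so is its extension by the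
identity, because it fixes the boundary. -/
theorem IsAdmissible.exists_lipschitzWith_extendId (hΩ : IsOpen Ω) (hΩb : Bornology.IsBounded Ω)
    (hlip : HasLipschitzBoundary Ω) {m : ℕ} (hm : 2 < m) {φ : Plane → Plane}
    (hφ : IsAdmissible Ω m φ) : ∃ L, LipschitzWith L (extendId Ω φ) := by
  have hc : ContinuousOn φ Ω := hφ.continuousOn.mono subset_closure
  have hex : ∀ i : Fin 2, ∃ M : NNReal, ∀ x ∈ Ω, ∃ ε > 0,
      LipschitzOnWith M (fun x => φ x i) (Metric.ball x ε) := fun i =>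
    exists_locally_lipschitz hΩ hΩb hlip ((hφ.memSobolev i).mono hm)
      ((EuclideanSpace.proj i : Plane →L[ℝ] ℝ).continuous.comp_continuousOn hc)
  choose M hM using hex
  refine ⟨max 1 (M 0 + M 1), lipschitzWith_of_locally_lipschitz hΩ
    (continuous_extendId hφ.continuousOn hφ.eq_on_frontier) (fun x hx => by simp [extendId, hx])
    (le_max_left _ _) fun x hx => ?_⟩
  obtain ⟨ε0, hε0, h0⟩ := hM 0 x hx
  obtain ⟨ε1, hε1, h1⟩ := hM 1 x hx
  obtain ⟨ε2, hε2, h2⟩ := Metric.isOpen_iff.1 hΩ x hx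
  refine ⟨min ε2 (min ε0 ε1), by positivity, ?_⟩
  refine LipschitzOnWith.of_dist_le_mul fun y hy z hz => ?_
  have hin : ∀ {y}, y ∈ Metric.ball x (min ε2 (min ε0 ε1)) → y ∈ Metric.ball x ε0 ∧
      y ∈ Metric.ball x ε1 ∧ extendId Ω φ y = φ y := fun {y} hy =>
    ⟨Metric.ball_subset_ball ((min_le_right _ _).trans (min_le_left _ _)) hy,
      Metric.ball_subset_ball ((min_le_right _ _).trans (min_le_right _ _)) hy, by
        have : y ∈ Ω := h2 (Metric.ball_subset_ball (min_le_left _ _) hy)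
        simp [extendId, this]⟩
  rw [(hin hy).2.2, (hin hz).2.2, dist_eq_norm]
  have e0 := h0.dist_le_mul y (hin hy).1 z (hin hz).1
  have e1 := h1.dist_le_mul y (hin hy).2.1 z (hin hz).2.1
  rw [Real.dist_eq] at e0 e1
  calc ‖φ y - φ z‖ ≤ |(φ y - φ z) 0| + |(φ y - φ z) 1| := norm_le_add_abs _
    _ ≤ M 0 * dist y z + M 1 * dist y z := add_le_add e0 e1
    _ = ((M 0 + M 1 : NNReal) : ℝ) * dist y z := by push_cast; ring
    _ ≤ _ := by
      gcongr
      exact le_max_right _ _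

end SobolevEmbedding

/-! ### Functions of bounded variation -/

section TotalVariation

variable {Ω : Set Plane}

/-- The bound `TV(u) ≤ T`, as an estimate between real numbers; it is meant for integrable `u`. -/
def TVLe (Ω : Set Plane) (u : Plane → ℝ) (T : ℝ) : Prop :=
  ∀ η : Plane → Plane, IsTest Ω η → (∀ x, ‖η x‖ ≤ 1) → ∫ x in Ω, u x * divergence η x ≤ T

theorem tvLe_of_TV_le {u : Plane → ℝ} {T : ℝ} (hT : 0 ≤ T) (h : TV Ω u ≤ ENNReal.ofReal T) :
    TVLe Ω u T := fun η hη h1 => by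
  have h2 : ENNReal.ofReal (∫ x in Ω, u x * divergence η x) ≤ TV Ω u :=
    le_iSup_of_le η (le_iSup_of_le hη (le_iSup_of_le h1 le_rfl))
  exact (ENNReal.ofReal_le_ofReal_iff hT).1 (h2.trans h)

theorem divergence_smul_const {c : Plane → ℝ} (z : Plane) :
    divergence (fun x => c x • z) = fun x => fderiv ℝ c x z := by
  ext x
  have h : ∀ i : Fin 2, pderiv i (fun y => c y * z i) x = z i * pderiv i c x := by
    intro i
    simp only [pderiv]
    have : (fun y => c y * z i) = z i • c := by ext y; simp [mul_comm]
    rw [this, fderiv_const_smul_field]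
    rfl
  simp only [divergence, Fin.sum_univ_two, PiLp.smul_apply, smul_eq_mul, h]
  rw [fderiv_apply_eq]

/-- A scalar test function gives rise to the vector fields in a constant direction. -/
theorem TVLe.integral_le {u : Plane → ℝ} {T : ℝ} (h : TVLe Ω u T) {c : Plane → ℝ}
    (hc : IsTest Ω c) (h1 : ∀ x, |c x| ≤ 1) (z : Plane) :
    ∫ x in Ω, u x * fderiv ℝ c x z ≤ ‖z‖ * T := by
  rcases eq_or_ne z 0 with rfl | hz
  · simp
  have hz' : 0 < ‖z‖ := norm_pos_iff.2 hz
  have ht : IsTest Ω fun x => c x • (‖z‖⁻¹ • z) := by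
    refine ⟨hc.1.smul contDiff_const, hc.2.1.smul_right, ?_⟩
    exact (closure_mono (Function.support_smul_subset_left _ _)).trans hc.2.2
  have h2 := h _ ht fun x => by
    rw [norm_smul, norm_smul, norm_inv, norm_norm, inv_mul_cancel₀ hz'.ne', mul_one]
    exact h1 x
  rw [divergence_smul_const] at h2
  have e : ∀ x, u x * fderiv ℝ c x (‖z‖⁻¹ • z) = ‖z‖⁻¹ * (u x * fderiv ℝ c x z) := fun x => by
    rw [map_smul, smul_eq_mul]; ring
  simp_rw [e] at h2
  rw [integral_const_mul, inv_mul_le_iff₀ hz'] at h2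
  exact h2

theorem integral_divergence_eq_zero (hΩ : IsOpen Ω) {η : Plane → Plane} (hη : IsTest Ω η) :
    ∫ x in Ω, divergence η x = 0 := by
  have hi : ∀ i : Fin 2, IsTest Ω (fun x => η x i) := fun i =>
    ⟨(EuclideanSpace.proj i : Plane →L[ℝ] ℝ).contDiff.comp hη.1,
      hη.2.1.comp_left (g := fun x : Plane => x i) rfl,
      (closure_mono (Function.support_comp_subset (g := fun x : Plane => x i) rfl η)).trans hη.2.2⟩
  have hz : ∀ i : Fin 2, ∫ x in Ω, pderiv i (fun y => η y i) x = 0 := by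
    intro i
    have h := (hasWeakDeriv_of_lipschitzWith hΩ (LipschitzWith.const (1 : ℝ))
      (h := fun _ => 1) (fun x _ => rfl) i).2.2 _ (hi i)
    rw [mderiv_single] at h
    simpa [lineDeriv] using h
  have hint : ∀ i : Fin 2, IntegrableOn (pderiv i (fun y => η y i)) Ω := fun i =>
    ((contDiff_pderiv (hi i).1 i).continuous.integrable_of_hasCompactSupport
      (hasCompactSupport_pderiv (hi i).2.1 i)).integrableOn
  simp only [divergence, Fin.sum_univ_two]
  rw [integral_add (hint 0) (hint 1), hz, hz, add_zero]

theorem continuous_divergence {η : Plane → Plane} (hη : ContDiff ℝ ∞ η) :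
    Continuous (divergence η) := by
  have hi : ∀ i : Fin 2, ContDiff ℝ ∞ (fun x => η x i) := fun i =>
    (EuclideanSpace.proj i : Plane →L[ℝ] ℝ).contDiff.comp hη
  exact continuous_finsetSum _ fun i _ => (contDiff_pderiv (hi i) i).continuous

theorem divergence_eq_zero_of_notMem_tsupport {η : Plane → Plane} {x : Plane}
    (hx : x ∉ tsupport η) : divergence η x = 0 := by
  have h0 : η =ᶠ[𝓝 x] fun _ => 0 := notMem_tsupport_iff_eventuallyEq.1 hx
  refine Finset.sum_eq_zero fun i _ => ?_
  have h1 : (fun y => η y i) =ᶠ[𝓝 x] fun _ => 0 := by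
    filter_upwards [h0] with y hy
    rw [hy]; rfl
  simp [pderiv, h1.fderiv_eq]

theorem exists_bound_divergence {η : Plane → Plane} (hη : IsTest Ω η) :
    ∃ D, ∀ x, ‖divergence η x‖ ≤ D :=
  HasCompactSupport.exists_bound_of_continuous
    (HasCompactSupport.intro hη.2.1 fun _ hx => divergence_eq_zero_of_notMem_tsupport hx)
    (continuous_divergence hη.1)

theorem integrable_mul_divergence {u : Plane → ℝ} (hu : IntegrableOn u Ω) {η : Plane → Plane}
    (hη : IsTest Ω η) : IntegrableOn (fun x => u x * divergence η x) Ω := by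
  obtain ⟨D, hD⟩ := exists_bound_divergence hη
  exact hu.mul_bdd (c := D) (continuous_divergence hη.1).aestronglyMeasurable (.of_forall hD)

/-- Constants have no variation, since divergences of test fields have integral zero. -/
theorem TVLe.sub_const (hΩ : IsOpen Ω) (hΩb : Bornology.IsBounded Ω) {u : Plane → ℝ} {T : ℝ}
    (hu : IntegrableOn u Ω) (h : TVLe Ω u T) (c : ℝ) : TVLe Ω (fun x => u x - c) T := by
  intro η hη h1
  have hc : IntegrableOn (fun _ : Plane => c) Ω := integrableOn_const hΩb.measure_lt_top.ne
  simp_rw [sub_mul]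
  rw [integral_sub (integrable_mul_divergence hu hη) (integrable_mul_divergence hc hη),
    integral_const_mul, integral_divergence_eq_zero hΩ hη, mul_zero, sub_zero]
  exact h η hη h1

theorem fderiv_conv_apply {f k : Plane → ℝ} (hf : LocallyIntegrable f) (hk : ContDiff ℝ ∞ k)
    (hkc : HasCompactSupport k) (x z : Plane) :
    fderiv ℝ (conv f k) x z = conv f (fun y => fderiv ℝ k y z) x := by
  have h := hkc.hasFDerivAt_convolution_right (ContinuousLinearMap.lsmul ℝ ℝ) hf
    (hk.of_le (by simp)) x
  rw [conv, h.fderiv, convolution_precompR_apply _ hf (hkc.fderiv (𝕜 := ℝ))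
    (hk.continuous_fderiv (by simp))]
  rfl

/-- Mollification by an even kernel is self-adjoint, so that a derivative of the mollification can
be moved to the mollification of a test function. -/
theorem integral_fderiv_conv_mul (hΩ : IsOpen Ω) {u k χ : Plane → ℝ} {ρ : ℝ}
    (hu : IntegrableOn u Ω) (hk : IsMollifier k ρ) (hχ : ContDiff ℝ ∞ χ)
    (hχc : HasCompactSupport χ) (z : Plane) :
    ∫ x, fderiv ℝ (conv (Ω.indicator u) k) x z * χ x
      = - ∫ x in Ω, u x * fderiv ℝ (conv χ k) x z := by
  set f := Ω.indicator u with hf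
  have hfi : Integrable f := (integrable_indicator_iff hΩ.measurableSet).2 hu
  have hχi : Integrable χ := hχ.continuous.integrable_of_hasCompactSupport hχc
  set D : Plane → ℝ := fun y => fderiv ℝ k y z with hD
  have hDc : Continuous D := continuous_fderiv_apply hk.contDiff z
  have hodd : ∀ y, D (-y) = - D y := by
    intro y
    have h1 := ((hk.contDiff.differentiable (by simp)) (-y)).hasFDerivAt
    have h2 : HasFDerivAt (fun y : Plane => k (-y)) ((fderiv ℝ k (-y)).comp
        (-ContinuousLinearMap.id ℝ Plane)) y := h1.comp y (hasFDerivAt_id y).neg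
    have h3 : (fun y : Plane => k (-y)) = k := funext hk.even
    rw [h3] at h2
    simp only [hD]
    rw [h2.fderiv]
    simp
  obtain ⟨M, hM⟩ := hDc.bounded_above_of_compact_support
    (hk.hasCompactSupport.fderiv_apply (𝕜 := ℝ) z)
  have hprod : Integrable (Function.uncurry fun x t => f t * D (x - t) * χ x)
      (volume.prod volume) := by
    have h1 : Integrable (fun q : Plane × Plane => χ q.1 * f q.2) (volume.prod volume) :=
      hχi.mul_prod hfi
    have h2 := h1.mul_bdd (c := M) (g := fun q : Plane × Plane => D (q.1 - q.2))
      (hDc.comp (continuous_fst.sub continuous_snd)).aestronglyMeasurable (.of_forall fun q => hM _)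
    refine h2.congr (.of_forall fun q => ?_)
    simp only [Function.uncurry]
    ring
  calc ∫ x, fderiv ℝ (conv f k) x z * χ x
      = ∫ x, ∫ t, f t * D (x - t) * χ x := by
        congr 1; ext x
        rw [fderiv_conv_apply hfi.locallyIntegrable hk.contDiff hk.hasCompactSupport, conv_apply,
          ← integral_mul_const]
    _ = ∫ t, ∫ x, f t * D (x - t) * χ x := integral_integral_swap hprod
    _ = ∫ t, -(f t * fderiv ℝ (conv χ k) t z) := by
        congr 1; ext t
        rw [fderiv_conv_apply hχi.locallyIntegrable hk.contDiff hk.hasCompactSupport, conv_apply,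
          ← integral_const_mul, ← integral_neg]
        congr 1; ext x
        have : D (x - t) = - D (t - x) := by rw [← hodd, neg_sub]
        rw [this]
        simp only [hD]
        ring
    _ = _ := by
        rw [integral_neg, ← integral_indicator hΩ.measurableSet]
        congr 2; ext t
        by_cases ht : t ∈ Ω <;> simp [hf, ht]

theorem exists_smooth_cutoff {s t : Set Plane} (hs : IsClosed s) (hst : s ⊆ interior t) :
    ∃ χ : Plane → ℝ, ContDiff ℝ ∞ χ ∧ (∀ x ∈ s, χ x = 1) ∧ (∀ x ∉ t, χ x = 0) ∧
      ∀ x, χ x ∈ Icc (0 : ℝ) 1 := by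
  obtain ⟨χ, h1, h0, h⟩ := exists_contMDiffMap_one_nhds_of_subset_interior (n := (⊤ : ℕ∞))
    (modelWithCornersSelf ℝ Plane) hs hst
  exact ⟨χ, χ.contMDiff.contDiff, fun x hx => h1.self_of_nhdsSet x hx, h0, h⟩

/-- Mollification does not increase the total variation: the directional derivative in direction
`z` is tested with the direction `z` itself. -/
theorem TVLe.lintegral_fderiv_conv_le (hΩ : IsOpen Ω) (hΩb : Bornology.IsBounded Ω)
    {u k : Plane → ℝ} {T ρ r : ℝ} (hu : IntegrableOn u Ω) (hT : TVLe Ω u T)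
    (hk : IsMollifier k ρ) (hr : 0 < r) (hρ : ρ < r / 2) (z : Plane) :
    ∫⁻ x in erosion Ω r, ‖fderiv ℝ (conv (Ω.indicator u) k) x z‖ₑ ≤ ENNReal.ofReal (‖z‖ * T) := by
  have hfi : Integrable (Ω.indicator u) := (integrable_indicator_iff hΩ.measurableSet).2 hu
  have hfs : ContDiff ℝ ∞ (conv (Ω.indicator u) k) :=
    contDiff_conv hfi.locallyIntegrable hk.contDiff hk.hasCompactSupport
  set h : Plane → ℝ := fun x => fderiv ℝ (conv (Ω.indicator u) k) x z with hh
  have hhs : ContDiff ℝ ∞ h := contDiff_fderiv_apply hfs z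
  have hEc := isCompact_erosion hΩb hr
  have hfinE : volume (erosion Ω r) ≠ ⊤ := hEc.measure_lt_top.ne
  obtain ⟨χ₀, hχ₀s, hχ₀1, hχ₀0, hχ₀⟩ := exists_smooth_cutoff (s := erosion Ω r)
    (t := erosion Ω (r / 2)) isClosed_erosion (by
      have hsub : {x | r / 2 < Metric.infDist x Ωᶜ} ⊆ interior (erosion Ω (r / 2)) :=
        interior_maximal (fun x (hx : r / 2 < Metric.infDist x Ωᶜ) => hx.le)
          (isOpen_lt continuous_const (Metric.continuous_infDist_pt _))
      exact fun x hx => hsub (lt_of_lt_of_le (by linarith) (show r ≤ Metric.infDist x Ωᶜ from hx)))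
  have hreal : ∀ ε > 0, ∫ x in erosion Ω r, (|h x| - ε) ≤ ‖z‖ * T := by
    intro ε hε
    have hpos : ∀ x, 0 < h x ^ 2 + ε ^ 2 := fun x => by positivity
    -- a smooth substitute for the sign of `h`, cut off near the boundary
    set χ : Plane → ℝ := fun x => χ₀ x * (h x / √(h x ^ 2 + ε ^ 2)) with hχ
    have hχs : ContDiff ℝ ∞ χ := hχ₀s.mul (hhs.div
      (((hhs.pow 2).add contDiff_const).sqrt fun x => (hpos x).ne')
      fun x => (Real.sqrt_pos.2 (hpos x)).ne')
    have hχz : ∀ x ∉ erosion Ω (r / 2), χ x = 0 := fun x hx => by simp [hχ, hχ₀0 x hx]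
    have hχc : HasCompactSupport χ := HasCompactSupport.intro
      (isCompact_erosion hΩb (by positivity)) hχz
    have hχ1 : ∀ x, |χ x| ≤ 1 := by
      intro x
      have h1 : |h x| ≤ √(h x ^ 2 + ε ^ 2) := Real.abs_le_sqrt (by nlinarith [sq_nonneg ε])
      rw [hχ]
      simp only
      rw [abs_mul, abs_div, abs_of_nonneg (hχ₀ x).1, abs_of_nonneg (Real.sqrt_nonneg _)]
      exact mul_le_one₀ (hχ₀ x).2 (by positivity)
        ((div_le_one (Real.sqrt_pos.2 (hpos x))).2 h1)
    have hχi : Integrable χ := hχs.continuous.integrable_of_hasCompactSupport hχc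
    have hcz : ∀ y, y ∉ erosion Ω (r / 2 - ρ) → conv χ k y = 0 := by
      intro y hy
      rw [conv_apply]
      refine integral_eq_zero_of_ae (.of_forall fun t => ?_)
      simp only [Pi.zero_apply, mul_eq_zero]
      by_contra hcon
      push Not at hcon
      have h1 : t ∈ erosion Ω (r / 2) := by
        by_contra ht; exact hcon.1 (hχz t ht)
      have h2 : ‖y - t‖ ≤ ρ := by
        by_contra ht; exact hcon.2 (hk.eq_zero _ (not_le.1 ht))
      exact hy (mem_erosion_of_dist_le h1 (by rw [dist_comm, dist_eq_norm]; linarith))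
    have htest : IsTest Ω (conv χ k) := by
      refine ⟨contDiff_conv hχi.locallyIntegrable hk.contDiff hk.hasCompactSupport,
        HasCompactSupport.intro (isCompact_erosion hΩb (by linarith)) hcz, ?_⟩
      refine (closure_minimal (fun y hy => ?_) isClosed_erosion).trans
        (erosion_subset (r := r / 2 - ρ) (by linarith))
      by_contra hcon
      exact hy (hcz y hcon)
    have h1 := hT.integral_le (c := conv χ k) htest (hk.abs_conv_le hχ1) (-z)
    have h2 := integral_fderiv_conv_mul hΩ hu hk hχs hχc z
    have h3 : ∫ x, h x * χ x ≤ ‖z‖ * T := by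
      rw [hh, h2, ← integral_neg, ← norm_neg z]
      refine le_trans (le_of_eq ?_) h1
      congr 1; ext x
      rw [map_neg]; ring
    have hnn : ∀ x, 0 ≤ h x * χ x := fun x => by
      have : h x * χ x = χ₀ x * (h x ^ 2 / √(h x ^ 2 + ε ^ 2)) := by simp only [hχ]; ring
      rw [this]
      exact mul_nonneg (hχ₀ x).1 (by positivity)
    have hhχ : Integrable fun x => h x * χ x :=
      (hhs.continuous.mul hχs.continuous).integrable_of_hasCompactSupport hχc.mul_left
    refine le_trans ?_ ((setIntegral_le_integral (s := erosion Ω r) hhχ (.of_forall hnn)).trans h3)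
    refine setIntegral_mono_on ?_ hhχ.integrableOn isClosed_erosion.measurableSet fun x hx => ?_
    · exact (Continuous.continuousOn (by have := hhs.continuous; fun_prop)).integrableOn_compact hEc
    · have e : h x * χ x = |h x| ^ 2 / √(h x ^ 2 + ε ^ 2) := by
        simp only [hχ, hχ₀1 x hx, sq_abs]; ring
      rw [e, le_div_iff₀ (Real.sqrt_pos.2 (hpos x))]
      have h4 : √(h x ^ 2 + ε ^ 2) ≤ |h x| + ε := by
        rw [Real.sqrt_le_left (by positivity), ← sq_abs (h x)]
        nlinarith [abs_nonneg (h x)]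
      have h5 : 0 ≤ √(h x ^ 2 + ε ^ 2) := Real.sqrt_nonneg _
      have h6 : ε ≤ √(h x ^ 2 + ε ^ 2) := Real.le_sqrt_of_sq_le (by nlinarith [sq_nonneg (h x)])
      rcases le_total ε |h x| with h7 | h7
      · nlinarith [abs_nonneg (h x)]
      · nlinarith [abs_nonneg (h x), sq_nonneg |h x|]
  have hhi : IntegrableOn (fun x => |h x|) (erosion Ω r) :=
    hhs.continuous.abs.continuousOn.integrableOn_compact hEc
  have hle : ∫ x in erosion Ω r, |h x| ≤ ‖z‖ * T := by
    refine le_of_forall_pos_le_add fun δ hδ => ?_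
    set V := volume.real (erosion Ω r) with hV
    have hV0 : 0 ≤ V := measureReal_nonneg
    have h1 := hreal (δ / (V + 1)) (by positivity)
    rw [integral_sub hhi (integrableOn_const hfinE), setIntegral_const, smul_eq_mul, ← hV] at h1
    have h2 : V * (δ / (V + 1)) ≤ δ := by
      rw [mul_div_assoc', div_le_iff₀ (by positivity)]; nlinarith
    linarith
  have h8 := ofReal_integral_norm_eq_lintegral_enorm
    (hhs.continuous.continuousOn.integrableOn_compact hEc (μ := volume))
  rw [← h8]
  exact ENNReal.ofReal_le_ofReal hle

end TotalVariation

/-! ### Shift estimates, the Gagliardo–Nirenberg inequality and local Poincaré inequalities -/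

section Poincare

variable {Ω : Set Plane}

/-- Fatou's lemma, combined with an exhaustion of `V` by sets whose translates by `P` keep a
distance from the boundary of `Ω`. -/
theorem setLIntegral_le_of_tendsto_of_erosion (hΩ : IsOpen Ω) (hΩb : Bornology.IsBounded Ω)
    {V P : Set Plane} (hV : MeasurableSet V) (hP : IsCompact P)
    (hVP : ∀ x ∈ V, ∀ z ∈ P, x + z ∈ Ω) {G : ℕ → Plane → ℝ≥0∞} {g : Plane → ℝ≥0∞}
    (hG : ∀ n, Measurable (G n)) (hlim : ∀ᵐ x, x ∈ V → Tendsto (fun n => G n x) atTop (𝓝 (g x)))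
    {B : ℝ≥0∞} (hB : ∀ r > 0, ∀ᶠ n in atTop, ∀ W, MeasurableSet W → W ⊆ V →
      (∀ x ∈ W, ∀ z ∈ P, x + z ∈ erosion Ω r) → ∫⁻ x in W, G n x ≤ B) :
    ∫⁻ x in V, g x ≤ B := by
  set S : ℕ → Set Plane := fun j => V ∩ {x | ∀ z ∈ P, x + z ∈ erosion Ω (1 / ((j : ℝ) + 1))}
    with hS
  have hSm : ∀ j, MeasurableSet (S j) := by
    intro j
    refine hV.inter (IsClosed.measurableSet ?_)
    simp only [ofPred_forall]
    exact isClosed_biInter fun z _ => isClosed_erosion.preimage (by fun_prop)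
  have hmono : Monotone S := by
    intro i j hij x hx
    refine ⟨hx.1, fun z hz => ?_⟩
    have h : 1 / ((i : ℝ) + 1) ≤ Metric.infDist (x + z) Ωᶜ := hx.2 z hz
    refine le_trans (b := 1 / ((i : ℝ) + 1)) ?_ h
    exact one_div_le_one_div_of_le (by positivity) (by exact_mod_cast Nat.succ_le_succ hij)
  have hU : V = ⋃ j, S j := by
    refine Subset.antisymm (fun x hx => ?_) (iUnion_subset fun j => inter_subset_left)
    obtain ⟨r, hr, hsub⟩ := exists_subset_erosion hΩ hΩb
      (hP.image (f := fun z => x + z) (by fun_prop))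
      (by rintro _ ⟨z, hz, rfl⟩; exact hVP x hx z hz)
    obtain ⟨j, hj⟩ := exists_nat_one_div_lt hr
    exact mem_iUnion.2 ⟨j, hx, fun z hz => hj.le.trans (hsub ⟨z, hz, rfl⟩)⟩
  rw [hU, setLIntegral_iUnion_of_directed _ hmono.directed_le]
  refine iSup_le fun j => ?_
  calc ∫⁻ x in S j, g x = ∫⁻ x in S j, liminf (fun n => G n x) atTop := by
        refine setLIntegral_congr_fun_ae (hSm j) ?_
        filter_upwards [hlim] with x hx hxS
        exact (hx hxS.1).liminf_eq.symm
    _ ≤ liminf (fun n => ∫⁻ x in S j, G n x) atTop := lintegral_liminf_le hG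
    _ ≤ B := by
        refine liminf_le_of_frequently_le' (Eventually.frequently ?_)
        filter_upwards [hB (1 / ((j : ℝ) + 1)) (by positivity)] with n hn
        exact hn _ (hSm j) inter_subset_left fun x hx => hx.2

/-- Difference quotients of a function of bounded variation are bounded by its variation. -/
theorem TVLe.lintegral_shift_sub_le (hΩ : IsOpen Ω) (hΩb : Bornology.IsBounded Ω)
    {u : Plane → ℝ} {T : ℝ} (hu : IntegrableOn u Ω) (hT : TVLe Ω u T) {V : Set Plane}
    (hV : MeasurableSet V) {z : Plane} (hz : ∀ x ∈ V, ∀ s ∈ Icc (0 : ℝ) 1, x + s • z ∈ Ω) :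
    ∫⁻ x in V, ‖u (x + z) - u x‖ₑ ≤ ENNReal.ofReal (‖z‖ * T) := by
  have hfi : Integrable (Ω.indicator u) := (integrable_indicator_iff hΩ.measurableSet).2 hu
  obtain ⟨k, ρ, hk, hρ, hlim, -⟩ := exists_isMollifier_seq
  set f : ℕ → Plane → ℝ := fun n => conv (Ω.indicator u) (k n) with hf
  have hfs : ∀ n, ContDiff ℝ ∞ (f n) := fun n =>
    contDiff_conv hfi.locallyIntegrable (hk n).contDiff (hk n).hasCompactSupport
  have hae := hlim _ hfi.locallyIntegrable
  have hae' := (measurePreserving_add_right volume z).quasiMeasurePreserving.ae hae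
  refine setLIntegral_le_of_tendsto_of_erosion hΩ hΩb hV
    (P := (fun s : ℝ => s • z) '' Icc 0 1) (isCompact_Icc.image (by fun_prop))
    (by rintro x hx _ ⟨s, hs, rfl⟩; exact hz x hx s hs)
    (G := fun n x => ‖f n (x + z) - f n x‖ₑ)
    (fun n => Continuous.measurable (by have := (hfs n).continuous; fun_prop)) ?_ fun r hr => ?_
  · filter_upwards [hae, hae'] with x h1 h2 hx
    have m0 : x ∈ Ω := by simpa using hz x hx 0 (by simp)
    have m1 : x + z ∈ Ω := by simpa using hz x hx 1 (by simp)
    rw [indicator_of_mem m0] at h1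
    rw [indicator_of_mem m1] at h2
    exact (h2.sub h1).enorm
  · filter_upwards [(tendsto_order.1 hρ).2 (r / 2) (by positivity)] with n hn W hW _ hWP
    have hdm : Measurable fun x => ‖fderiv ℝ (f n) x z‖ₑ :=
      (continuous_fderiv_apply (hfs n) z).measurable.enorm
    calc ∫⁻ x in W, ‖f n (x + z) - f n x‖ₑ
        ≤ ∫⁻ x in W, ∫⁻ s in Icc (0 : ℝ) 1, ‖fderiv ℝ (f n) (x + s • z) z‖ₑ :=
          lintegral_mono fun x => enorm_shift_sub_le (hfs n) x z
      _ = ∫⁻ s in Icc (0 : ℝ) 1, ∫⁻ x in W, ‖fderiv ℝ (f n) (x + s • z) z‖ₑ := by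
          refine lintegral_lintegral_swap (Measurable.aemeasurable ?_)
          exact hdm.comp (f := fun q : Plane × ℝ => q.1 + q.2 • z)
            (Continuous.measurable (by fun_prop))
      _ ≤ ∫⁻ s in Icc (0 : ℝ) 1, ENNReal.ofReal (‖z‖ * T) := by
          refine setLIntegral_mono measurable_const fun s hs => ?_
          refine le_trans ?_ (hT.lintegral_fderiv_conv_le hΩ hΩb hu (hk n) hr hn z)
          rw [← lintegral_indicator hW, ← lintegral_indicator isClosed_erosion.measurableSet,
            ← lintegral_add_right_eq_self ((erosion Ω r).indicator _) (s • z)]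
          refine lintegral_mono fun x => ?_
          by_cases hx : x ∈ W
          · rw [indicator_of_mem hx, indicator_of_mem (hWP x hx _ ⟨s, hs, rfl⟩)]
          · rw [indicator_of_notMem hx]; exact zero_le
      _ = ENNReal.ofReal (‖z‖ * T) := by simp

/-- The Gagliardo–Nirenberg inequality for functions of bounded variation. -/
theorem TVLe.lintegral_sq_le (hΩ : IsOpen Ω) (hΩb : Bornology.IsBounded Ω)
    {v w : Plane} (hvw : LinearIndependent ℝ ![v, w]) {V : Set Plane} (hV : MeasurableSet V)
    (hcone : ∀ x ∈ V, ∀ s ∈ Icc (0 : ℝ) 1, ∀ t ∈ Icc (0 : ℝ) 1, x + s • v + t • w ∈ Ω) :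
    ∃ C : NNReal, ∀ (u : Plane → ℝ) (T : ℝ), IntegrableOn u Ω → TVLe Ω u T →
      ∫⁻ x in V, ‖u x‖ₑ ^ 2 ≤ C * ((∫⁻ x in Ω, ‖u x‖ₑ) + ENNReal.ofReal T) ^ 2 := by
  obtain ⟨C, hCt, hC0, hC⟩ := exists_lintegral_coordinates hvw
  lift C to NNReal using hCt
  refine ⟨C * (1 + ‖v‖₊) * (1 + ‖w‖₊), fun u T hu hT => ?_⟩
  have hfi : Integrable (Ω.indicator u) := (integrable_indicator_iff hΩ.measurableSet).2 hu
  obtain ⟨k, ρ, hk, hρ, hlim, -⟩ := exists_isMollifier_seq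
  set f : ℕ → Plane → ℝ := fun n => conv (Ω.indicator u) (k n) with hf
  have hfs : ∀ n, ContDiff ℝ ∞ (f n) := fun n =>
    contDiff_conv hfi.locallyIntegrable (hk n).contDiff (hk n).hasCompactSupport
  have hae := hlim _ hfi.locallyIntegrable
  set a := ∫⁻ x in Ω, ‖u x‖ₑ with ha
  have hbd : ∀ n r, 0 < r → ρ n < r / 2 → ∀ z, ∫⁻ y in erosion Ω r,
      (‖f n y‖ₑ + ‖fderiv ℝ (f n) y z‖ₑ) ≤ (1 + ‖z‖₊) * (a + ENNReal.ofReal T) := by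
    intro n r hr hn z
    rw [lintegral_add_left (hfs n).continuous.measurable.enorm]
    have h1 : ∫⁻ y in erosion Ω r, ‖f n y‖ₑ ≤ a := by
      refine (setLIntegral_le_lintegral _ _).trans (((hk n).lintegral_enorm_conv_le hfi).trans ?_)
      simp_rw [enorm_indicator_eq_indicator_enorm]
      rw [lintegral_indicator hΩ.measurableSet]
    have h2 := hT.lintegral_fderiv_conv_le hΩ hΩb hu (hk n) hr hn z
    rw [ENNReal.ofReal_mul (norm_nonneg z), ofReal_norm, enorm_eq_nnnorm] at h2
    calc _ ≤ a + ‖z‖₊ * ENNReal.ofReal T := add_le_add h1 h2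
      _ ≤ (a + ENNReal.ofReal T) + ‖z‖₊ * (a + ENNReal.ofReal T) := by
          gcongr <;> simp
      _ = _ := by ring
  refine setLIntegral_le_of_tendsto_of_erosion hΩ hΩb hV
    (P := (fun q : ℝ × ℝ => q.1 • v + q.2 • w) '' (Icc 0 1 ×ˢ Icc 0 1))
    ((isCompact_Icc.prod isCompact_Icc).image (by fun_prop))
    (by rintro x hx _ ⟨q, ⟨h1, h2⟩, rfl⟩; rw [← add_assoc]; exact hcone x hx _ h1 _ h2)
    (G := fun n x => ‖f n x‖ₑ ^ 2) (fun n => (hfs n).continuous.measurable.enorm.pow_const 2)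
    ?_ fun r hr => ?_
  · filter_upwards [hae] with x h1 hx
    have m0 : x ∈ Ω := by simpa using hcone x hx 0 (by simp) 0 (by simp)
    rw [indicator_of_mem m0] at h1
    exact ((ENNReal.continuous_pow 2).tendsto _).comp h1.enorm
  · filter_upwards [(tendsto_order.1 hρ).2 (r / 2) (by positivity)] with n hn W hW _ hWP
    refine (lintegral_sq_le_of_parallelogram (hfs n) ENNReal.coe_ne_top hC0 hC
      (isClosed_erosion (Ω := Ω) (r := r)).measurableSet hW
      (fun x hx s hs => ?_) fun x hx t ht => ?_).trans ?_
    · simpa using hWP x hx _ ⟨(s, 0), ⟨hs, by simp⟩, rfl⟩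
    · simpa using hWP x hx _ ⟨(0, t), ⟨by simp, ht⟩, rfl⟩
    · refine (mul_le_mul' (mul_le_mul' le_rfl (hbd n r hr hn v)) (hbd n r hr hn w)).trans_eq ?_
      push_cast
      ring

/-- The set `U` supports a Poincaré inequality for functions of bounded variation on `Ω`. -/
def PoincareOn (Ω U : Set Plane) : Prop :=
  ∃ C : NNReal, ∀ (u : Plane → ℝ) (T : ℝ), Measurable u → IntegrableOn u Ω → TVLe Ω u T →
    ∃ c : ℝ, ∫⁻ x in U, ‖u x - c‖ₑ ≤ C * ENNReal.ofReal T

/-- The integral of `|u y - u x|` over pairs of points of the ball is an integral over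
translations `y - x`, each of which is controlled by the variation; the constant is the value of
`u` at a point `x` that does no worse than the average. -/
theorem poincareOn_ball (hΩ : IsOpen Ω) (hΩb : Bornology.IsBounded Ω) {q : Plane} {δ : ℝ}
    (hδ : 0 < δ) (hq : Metric.ball q δ ⊆ Ω) : PoincareOn Ω (Metric.ball q δ) := by
  set U := Metric.ball q δ with hU
  have hUm : MeasurableSet U := Metric.isOpen_ball.measurableSet
  set D : NNReal := (volume (Metric.ball (0 : Plane) (2 * δ))).toNNReal with hD
  have hDe : (D : ℝ≥0∞) = volume (Metric.ball (0 : Plane) (2 * δ)) :=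
    ENNReal.coe_toNNReal measure_ball_lt_top.ne
  have hU0 : volume U ≠ 0 := (Metric.measure_ball_pos volume q hδ).ne'
  have hUt : volume U ≠ ⊤ := measure_ball_lt_top.ne
  refine ⟨(volume U).toNNReal⁻¹ * (D * (2 * δ).toNNReal), fun u T hum hu hT => ?_⟩
  have hjm : Measurable fun p : Plane × Plane => ‖u (p.2 + p.1) - u p.1‖ₑ :=
    ((hum.comp (measurable_snd.add measurable_fst)).sub (hum.comp measurable_fst)).enorm
  have hdouble : ∫⁻ x in U, ∫⁻ y in U, ‖u y - u x‖ₑ ≤ D * (2 * δ).toNNReal * ENNReal.ofReal T := by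
    calc ∫⁻ x in U, ∫⁻ y in U, ‖u y - u x‖ₑ
        = ∫⁻ x, ∫⁻ z, {p : Plane × Plane | p.1 ∈ U ∧ p.2 + p.1 ∈ U}.indicator
            (fun p => ‖u (p.2 + p.1) - u p.1‖ₑ) (x, z) := by
          rw [← lintegral_indicator hUm]
          refine lintegral_congr fun x => ?_
          by_cases hx : x ∈ U
          · rw [indicator_of_mem hx, ← lintegral_indicator hUm, ← lintegral_add_right_eq_self _ x]
            refine lintegral_congr fun z => ?_
            by_cases hz : z + x ∈ U <;> simp [hx, hz]
          · simp [hx]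
      _ = ∫⁻ z, ∫⁻ x, {p : Plane × Plane | p.1 ∈ U ∧ p.2 + p.1 ∈ U}.indicator
            (fun p => ‖u (p.2 + p.1) - u p.1‖ₑ) (x, z) := by
          refine lintegral_lintegral_swap (Measurable.aemeasurable (hjm.indicator ?_))
          exact (measurable_fst hUm).inter ((measurable_snd.add measurable_fst) hUm)
      _ ≤ ∫⁻ z in Metric.ball (0 : Plane) (2 * δ), (2 * δ).toNNReal * ENNReal.ofReal T := by
          rw [← lintegral_indicator Metric.isOpen_ball.measurableSet]
          refine lintegral_mono fun z => ?_
          by_cases hz : z ∈ Metric.ball (0 : Plane) (2 * δ)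
          · rw [indicator_of_mem hz]
            have hVm : MeasurableSet (U ∩ (fun x => z + x) ⁻¹' U) :=
              hUm.inter ((measurable_const_add z) hUm)
            have h1 := hT.lintegral_shift_sub_le hΩ hΩb hu hVm (z := z) fun x hx s hs => by
              refine hq ?_
              have := (convex_ball q δ).add_smul_sub_mem hx.1 hx.2 hs
              simpa [hU] using this
            refine le_trans (le_of_eq ?_) (h1.trans ?_)
            · rw [← lintegral_indicator hVm]
              refine lintegral_congr fun x => ?_
              by_cases hx : x ∈ U <;> by_cases hxz : z + x ∈ U <;> simp [hx, hxz, add_comm x z]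
            · rw [ENNReal.ofReal_mul (norm_nonneg z)]
              gcongr
              exact ENNReal.ofReal_le_ofReal (by simpa using (mem_ball_zero_iff.1 hz).le)
          · refine le_of_eq ?_
            rw [indicator_of_notMem hz, lintegral_eq_zero_iff']
            · refine .of_forall fun x => indicator_of_notMem (fun hx => hz ?_) _
              have h1 := Metric.mem_ball.1 hx.1
              have h2 := Metric.mem_ball.1 hx.2
              have h3 := dist_triangle_right (z + x) x q
              rw [dist_eq_norm, add_sub_cancel_right] at h3
              rw [mem_ball_zero_iff]
              simp only at h1 h2
              linarith
            · refine ((hjm.indicator ?_).comp (measurable_id.prodMk measurable_const)).aemeasurable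
              exact (measurable_fst hUm).inter ((measurable_snd.add measurable_fst) hUm)
      _ = _ := by
          rw [setLIntegral_const, ← hDe]; ring
  have hm2 : Measurable fun x => ∫⁻ y in U, ‖u y - u x‖ₑ :=
    Measurable.lintegral_prod_right
      (((hum.comp measurable_snd).sub (hum.comp measurable_fst)).enorm :
        Measurable fun p : Plane × Plane => ‖u p.2 - u p.1‖ₑ)
  obtain ⟨x, -, hx⟩ := exists_le_setLAverage hU0 hUt hm2.aemeasurable
  refine ⟨u x, hx.trans ?_⟩
  rw [setLAverage_eq, ENNReal.div_eq_inv_mul]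
  push_cast
  rw [ENNReal.coe_inv (ENNReal.toNNReal_ne_zero.2 ⟨hU0, hUt⟩), ENNReal.coe_toNNReal hUt,
    mul_assoc (volume U)⁻¹]
  exact mul_le_mul' le_rfl hdouble

/-- On overlapping sets the constants of the two inequalities are close to each other. -/
theorem PoincareOn.union {U U' : Set Plane} (h : PoincareOn Ω U) (h' : PoincareOn Ω U')
    (hfin : volume U' ≠ ⊤)
    (hpos : volume (U ∩ U') ≠ 0) : PoincareOn Ω (U ∪ U') := by
  obtain ⟨C, hC⟩ := h
  obtain ⟨C', hC'⟩ := h'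
  have hfin2 : volume (U ∩ U') ≠ ⊤ := ne_top_of_le_ne_top hfin (measure_mono inter_subset_right)
  refine ⟨C + (C' + (volume U').toNNReal * ((volume (U ∩ U')).toNNReal⁻¹ * (C + C'))),
    fun u T hum hu hT => ?_⟩
  obtain ⟨c, hc⟩ := hC u T hum hu hT
  obtain ⟨c', hc'⟩ := hC' u T hum hu hT
  refine ⟨c, ?_⟩
  have hme : ∀ c : ℝ, Measurable fun x => ‖u x - c‖ₑ := fun c => (hum.sub_const c).enorm
  have h1 : ‖c' - c‖ₑ ≤ (volume (U ∩ U'))⁻¹ * ((C + C') * ENNReal.ofReal T) := by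
    rw [mul_comm, ← ENNReal.div_eq_inv_mul.trans (mul_comm _ _),
      ENNReal.le_div_iff_mul_le (.inl hpos) (.inl hfin2), add_mul]
    calc ‖c' - c‖ₑ * volume (U ∩ U') = ∫⁻ x in U ∩ U', ‖c' - c‖ₑ := by rw [setLIntegral_const]
      _ ≤ ∫⁻ x in U ∩ U', (‖u x - c‖ₑ + ‖u x - c'‖ₑ) := by
          refine lintegral_mono fun x => ?_
          have : c' - c = (u x - c) - (u x - c') := by ring
          rw [this]
          exact enorm_sub_le
      _ = (∫⁻ x in U ∩ U', ‖u x - c‖ₑ) + ∫⁻ x in U ∩ U', ‖u x - c'‖ₑ := lintegral_add_left (hme c) _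
      _ ≤ _ := add_le_add ((lintegral_mono_set inter_subset_left).trans hc)
          ((lintegral_mono_set inter_subset_right).trans hc')
  have h2 : ∫⁻ x in U', ‖u x - c‖ₑ ≤ C' * ENNReal.ofReal T + ‖c' - c‖ₑ * volume U' := by
    calc ∫⁻ x in U', ‖u x - c‖ₑ ≤ ∫⁻ x in U', (‖u x - c'‖ₑ + ‖c' - c‖ₑ) := by
          refine lintegral_mono fun x => ?_
          have : u x - c = (u x - c') + (c' - c) := by ring
          rw [this]
          exact enorm_add_le _ _
      _ = (∫⁻ x in U', ‖u x - c'‖ₑ) + ‖c' - c‖ₑ * volume U' := by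
          rw [lintegral_add_left (hme c'), setLIntegral_const]
      _ ≤ _ := by gcongr
  calc ∫⁻ x in U ∪ U', ‖u x - c‖ₑ ≤ (∫⁻ x in U, ‖u x - c‖ₑ) + ∫⁻ x in U', ‖u x - c‖ₑ :=
        lintegral_union_le _ _ _
    _ ≤ C * ENNReal.ofReal T + (C' * ENNReal.ofReal T +
        ((volume (U ∩ U'))⁻¹ * ((C + C') * ENNReal.ofReal T)) * volume U') :=
        add_le_add hc (h2.trans (by gcongr))
    _ = _ := by
        push_cast
        rw [ENNReal.coe_inv (ENNReal.toNNReal_ne_zero.2 ⟨hpos, hfin2⟩), ENNReal.coe_toNNReal hfin,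
          ENNReal.coe_toNNReal hfin2]
        ring

end Poincare

/-! ### The Poincaré–Sobolev inequality on a connected Lipschitz domain -/

section GlobalPoincare

variable {Ω : Set Plane}

/-- The middle `p + (v + w) / 2` of the parallelogram at a point `p` of the closure of `Ω` is an
interior point of `Ω`, so that the Poincaré inequality near `p` follows from the one on a ball in
`Ω`, by a shift. -/
theorem exists_poincareOn_ball (hΩ : IsOpen Ω) (hΩb : Bornology.IsBounded Ω)
    {p v w : Plane} {r : ℝ} (hr : 0 < r) (hp : p ∈ closure Ω) (hvw : LinearIndependent ℝ ![v, w])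
    (hcone : ∀ x ∈ Ω ∩ Metric.ball p r, ∀ s ∈ Icc (0 : ℝ) 1, ∀ t ∈ Icc (0 : ℝ) 1,
      x + s • v + t • w ∈ Ω) :
    ∃ ρ > 0, ρ ≤ r ∧ PoincareOn Ω (Ω ∩ Metric.ball p ρ) := by
  let b : Module.Basis (Fin 2) ℝ Plane := basisOfLinearIndependentOfCardEqFinrank hvw (by simp)
  have hb : ⇑b = ![v, w] := coe_basisOfLinearIndependentOfCardEqFinrank hvw (by simp)
  let e := b.equivFun.toContinuousLinearEquiv
  have hrep : ∀ y : Plane, y = e y 0 • v + e y 1 • w := fun y => by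
    have := b.sum_equivFun y
    rw [Fin.sum_univ_two, hb] at this
    exact this.symm
  obtain ⟨δ, hδ, hδe⟩ : ∃ δ > 0, ∀ y : Plane, ‖y‖ < δ → ∀ i, |e y i| < 1 / 2 := by
    have h0 : Tendsto e (𝓝 0) (𝓝 0) := by simpa using e.continuous.tendsto 0
    obtain ⟨δ, hδ, h⟩ := Metric.tendsto_nhds_nhds.1 h0 (1 / 2) (by norm_num)
    refine ⟨δ, hδ, fun y hy i => ?_⟩
    have := h (by simpa using hy : dist y 0 < δ)
    rw [dist_zero_right] at this
    exact (norm_le_pi_norm (e y) i).trans_lt this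
  set z : Plane := (1 / 2 : ℝ) • v + (1 / 2 : ℝ) • w with hz
  have hball : Metric.ball (p + z) (δ / 2) ⊆ Ω := by
    intro q hq
    obtain ⟨x, hx, hxp⟩ := Metric.mem_closure_iff.1 hp (min r (δ / 2)) (by positivity)
    have h1 : ‖q - x - z‖ < δ := by
      have e1 : q - x - z = (q - (p + z)) + (p - x) := by abel
      rw [e1]
      refine (norm_add_le _ _).trans_lt ?_
      rw [← dist_eq_norm, ← dist_eq_norm]
      have := Metric.mem_ball.1 hq
      linarith [hxp.trans_le (min_le_right _ _)]
    have h2 := hδe _ h1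
    have h3 := hrep (q - x - z)
    have h4 : q = x + (1 / 2 + e (q - x - z) 0) • v + (1 / 2 + e (q - x - z) 1) • w := by
      calc q = x + z + (q - x - z) := by abel
        _ = x + z + (e (q - x - z) 0 • v + e (q - x - z) 1 • w) := congrArg (x + z + ·) h3
        _ = _ := by rw [hz]; module
    rw [h4]
    have m := fun i => abs_lt.1 (h2 i)
    exact hcone x ⟨hx, by rw [Metric.mem_ball, dist_comm]; exact hxp.trans_le (min_le_left _ _)⟩ _
      ⟨by linarith [(m 0).1], by linarith [(m 0).2]⟩ _
      ⟨by linarith [(m 1).1], by linarith [(m 1).2]⟩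
  obtain ⟨C, hC⟩ := poincareOn_ball hΩ hΩb (half_pos hδ) hball
  refine ⟨min r (δ / 2), by positivity, min_le_left _ _, ‖z‖₊ + C, fun u T hum hu hT => ?_⟩
  obtain ⟨c, hc⟩ := hC u T hum hu hT
  refine ⟨c, ?_⟩
  set U := Ω ∩ Metric.ball p (min r (δ / 2)) with hU
  have hUm : MeasurableSet U := (hΩ.inter Metric.isOpen_ball).measurableSet
  have h1 := hT.lintegral_shift_sub_le hΩ hΩb hu hUm (z := z) fun x hx s hs => by
    have := hcone x ⟨hx.1, Metric.ball_subset_ball (min_le_left _ _) hx.2⟩ (s / 2)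
      ⟨by linarith [hs.1], by linarith [hs.2]⟩ (s / 2) ⟨by linarith [hs.1], by linarith [hs.2]⟩
    convert this using 1
    rw [hz]
    module
  have h2 : ∫⁻ x in U, ‖u (x + z) - c‖ₑ ≤ ∫⁻ x in Metric.ball (p + z) (δ / 2), ‖u x - c‖ₑ := by
    rw [← lintegral_indicator hUm, ← lintegral_indicator Metric.isOpen_ball.measurableSet,
      ← lintegral_add_right_eq_self ((Metric.ball (p + z) (δ / 2)).indicator _) z]
    refine lintegral_mono fun x => ?_
    by_cases hx : x ∈ U
    · have : x + z ∈ Metric.ball (p + z) (δ / 2) := by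
        rw [Metric.mem_ball, dist_add_right]
        exact (Metric.mem_ball.1 hx.2).trans_le (min_le_right _ _)
      rw [indicator_of_mem hx, indicator_of_mem this]
    · rw [indicator_of_notMem hx]; exact zero_le
  rw [ENNReal.ofReal_mul (norm_nonneg z), ofReal_norm, enorm_eq_nnnorm] at h1
  have hsm : Measurable fun x => ‖u (x + z) - u x‖ₑ :=
    ((hum.comp (measurable_add_const z)).sub hum).enorm
  calc ∫⁻ x in U, ‖u x - c‖ₑ ≤ ∫⁻ x in U, (‖u (x + z) - u x‖ₑ + ‖u (x + z) - c‖ₑ) := by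
        refine lintegral_mono fun x => ?_
        have : u x - c = (u (x + z) - c) - (u (x + z) - u x) := by ring
        rw [this, add_comm ‖u (x + z) - u x‖ₑ]
        exact enorm_sub_le
    _ = (∫⁻ x in U, ‖u (x + z) - u x‖ₑ) + ∫⁻ x in U, ‖u (x + z) - c‖ₑ := lintegral_add_left hsm _
    _ ≤ ‖z‖₊ * ENNReal.ofReal T + C * ENNReal.ofReal T := add_le_add h1 (h2.trans hc)
    _ = _ := by push_cast; ring

theorem setLIntegral_biUnion_finset_le {ι α : Type*} [MeasurableSpace α] {μ : Measure α}
    (t : Finset ι) (s : ι → Set α) (f : α → ℝ≥0∞) :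
    ∫⁻ x in ⋃ i ∈ t, s i, f x ∂μ ≤ ∑ i ∈ t, ∫⁻ x in s i, f x ∂μ := by
  classical
  induction t using Finset.induction_on with
  | empty => simp
  | insert i t hi ih =>
    rw [Finset.set_biUnion_insert, Finset.sum_insert hi]
    exact (lintegral_union_le _ _ _).trans (by gcongr)

/-- On a connected set, local Poincaré inequalities on a finite open cover add up to a global
one. -/
theorem poincareOn_of_finset_cover (hΩc : IsConnected Ω)
    (hΩb : Bornology.IsBounded Ω) {ι : Type*} [DecidableEq ι] (t : Finset ι) {U : ι → Set Plane}
    (hUo : ∀ i, IsOpen (U i)) (hUΩ : ∀ i, U i ⊆ Ω) (hcov : Ω ⊆ ⋃ i ∈ t, U i)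
    (hU : ∀ i ∈ t, PoincareOn Ω (U i)) : PoincareOn Ω Ω := by
  classical
  obtain ⟨x₀, hx₀⟩ := hΩc.nonempty
  obtain ⟨i₀, hi₀, hxi₀⟩ := mem_iUnion₂.1 (hcov hx₀)
  set good : Finset (Finset ι) :=
    t.powerset.filter fun s => i₀ ∈ s ∧ PoincareOn Ω (⋃ i ∈ s, U i) with hgood
  have hne : good.Nonempty := ⟨{i₀}, by simp [hgood, hi₀, hU i₀ hi₀]⟩
  -- a maximal subfamily with a Poincaré inequality covers `Ω`, by connectedness
  obtain ⟨s, hs⟩ := good.exists_maximal hne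
  obtain ⟨hst, his, hsP⟩ : s ⊆ t ∧ i₀ ∈ s ∧ PoincareOn Ω (⋃ i ∈ s, U i) := by
    simpa [hgood] using hs.prop
  have hall : Ω ⊆ ⋃ i ∈ s, U i := by
    by_contra hcon
    obtain ⟨y, hy, hys⟩ := not_subset.1 hcon
    obtain ⟨j, hj, hyj⟩ := mem_iUnion₂.1 (hcov hy)
    have hjs : j ∉ s := fun h => hys (mem_iUnion₂.2 ⟨j, h, hyj⟩)
    obtain ⟨x, -, hx1, hx2⟩ := hΩc.isPreconnected (⋃ i ∈ s, U i) (⋃ i ∈ t \ s, U i)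
      (isOpen_biUnion fun i _ => hUo i) (isOpen_biUnion fun i _ => hUo i)
      (fun x hx => by
        obtain ⟨i, hi, hxi⟩ := mem_iUnion₂.1 (hcov hx)
        by_cases his : i ∈ s
        · exact .inl (mem_iUnion₂.2 ⟨i, his, hxi⟩)
        · exact .inr (mem_iUnion₂.2 ⟨i, Finset.mem_sdiff.2 ⟨hi, his⟩, hxi⟩))
      ⟨x₀, hx₀, mem_iUnion₂.2 ⟨i₀, his, hxi₀⟩⟩
      ⟨y, hy, mem_iUnion₂.2 ⟨j, Finset.mem_sdiff.2 ⟨hj, hjs⟩, hyj⟩⟩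
    obtain ⟨l, hl, hxl⟩ := mem_iUnion₂.1 hx2
    obtain ⟨hlt, hls⟩ := Finset.mem_sdiff.1 hl
    have hunion := hsP.union (hU l hlt)
      (ne_top_of_le_ne_top hΩb.measure_lt_top.ne (measure_mono (hUΩ l)))
      (((isOpen_biUnion fun i _ => hUo i).inter (hUo l)).measure_pos volume ⟨x, hx1, hxl⟩).ne'
    have hmem : insert l s ∈ good := by
      simp only [hgood, Finset.mem_filter, Finset.mem_powerset]
      refine ⟨Finset.insert_subset hlt hst, Finset.mem_insert_of_mem his, ?_⟩
      rw [Finset.set_biUnion_insert, union_comm]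
      exact hunion
    exact hls (hs.le_of_ge hmem (Finset.subset_insert l s) (Finset.mem_insert_self l s))
  rwa [Subset.antisymm (iUnion₂_subset fun i _ => hUΩ i) hall] at hsP

/-- The Poincaré–Sobolev inequality `‖u - c‖_{L²} ≤ C TV(u)` on a connected bounded Lipschitz
domain. -/
theorem exists_poincare_sobolev (hΩ : IsOpen Ω) (hΩc : IsConnected Ω)
    (hΩb : Bornology.IsBounded Ω) (hlip : HasLipschitzBoundary Ω) :
    ∃ C : NNReal, ∀ (u : Plane → ℝ) (T : ℝ), Measurable u → IntegrableOn u Ω → TVLe Ω u T →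
      ∃ c : ℝ, ∫⁻ x in Ω, ‖u x - c‖ₑ ^ 2 ≤ C * ENNReal.ofReal T ^ 2 := by
  classical
  have hloc : ∀ p ∈ closure Ω, ∃ ρ > 0, PoincareOn Ω (Ω ∩ Metric.ball p ρ) ∧
      ∃ C : NNReal, ∀ (u : Plane → ℝ) (T : ℝ), IntegrableOn u Ω → TVLe Ω u T →
        ∫⁻ x in Ω ∩ Metric.ball p ρ, ‖u x‖ₑ ^ 2
          ≤ C * ((∫⁻ x in Ω, ‖u x‖ₑ) + ENNReal.ofReal T) ^ 2 := by
    intro p hp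
    obtain ⟨r, hr, v, w, hvw, hcone⟩ := hlip.exists_parallelogram hΩ hp
    obtain ⟨ρ, hρ, hρr, hP⟩ := exists_poincareOn_ball hΩ hΩb hr hp hvw hcone
    exact ⟨ρ, hρ, hP, TVLe.lintegral_sq_le hΩ hΩb hvw (hΩ.inter Metric.isOpen_ball).measurableSet
      fun x hx => hcone x ⟨hx.1, Metric.ball_subset_ball hρr hx.2⟩⟩
  choose! ρ hρ hP C hC using hloc
  obtain ⟨t, ht, hcov⟩ := hΩb.isCompact_closure.elim_nhds_subcover (fun p => Metric.ball p (ρ p))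
    fun p hp => Metric.ball_mem_nhds p (hρ p hp)
  have hcov' : Ω ⊆ ⋃ p ∈ t, Ω ∩ Metric.ball p (ρ p) := fun x hx => by
    obtain ⟨p, hp, hxp⟩ := mem_iUnion₂.1 (hcov (subset_closure hx))
    exact mem_iUnion₂.2 ⟨p, hp, hx, hxp⟩
  obtain ⟨D, hD⟩ := poincareOn_of_finset_cover hΩc hΩb t
    (fun p => hΩ.inter Metric.isOpen_ball) (fun p => inter_subset_left) hcov'
    fun p hp => hP p (ht p hp)
  refine ⟨∑ p ∈ t, C p * (D + 1) ^ 2, fun u T hum hu hT => ?_⟩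
  obtain ⟨c, hc⟩ := hD u T hum hu hT
  refine ⟨c, ?_⟩
  have hu' : IntegrableOn (fun x => u x - c) Ω :=
    hu.sub (integrableOn_const hΩb.measure_lt_top.ne)
  calc ∫⁻ x in Ω, ‖u x - c‖ₑ ^ 2 ≤ ∫⁻ x in ⋃ p ∈ t, Ω ∩ Metric.ball p (ρ p), ‖u x - c‖ₑ ^ 2 :=
        lintegral_mono_set hcov'
    _ ≤ ∑ p ∈ t, ∫⁻ x in Ω ∩ Metric.ball p (ρ p), ‖u x - c‖ₑ ^ 2 := by
        exact setLIntegral_biUnion_finset_le t _ _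
    _ ≤ ∑ p ∈ t, C p * (D * ENNReal.ofReal T + ENNReal.ofReal T) ^ 2 := by
        refine Finset.sum_le_sum fun p hp => ?_
        refine (hC p (ht p hp) _ T hu' (hT.sub_const hΩ hΩb hu c)).trans ?_
        gcongr
    _ = _ := by
        push_cast
        rw [Finset.sum_mul]
        refine Finset.sum_congr rfl fun p _ => ?_
        ring

end GlobalPoincare

/-! ### Convex minimisation in Hilbert spaces -/

section ConvexMinimisation

variable {H H' : Type*} [NormedAddCommGroup H] [InnerProductSpace ℝ H]
  [NormedAddCommGroup H'] [InnerProductSpace ℝ H']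

/-- Decreasing nonempty closed convex bounded sets in a Hilbert space have a common point: their
elements of minimal norm form a Cauchy sequence. -/
theorem nonempty_iInter_of_closed_convex_bounded [CompleteSpace H] {C : ℕ → Set H}
    (hanti : Antitone C) (hne : ∀ n, (C n).Nonempty) (hcl : ∀ n, IsClosed (C n))
    (hcv : ∀ n, Convex ℝ (C n)) (hbdd : Bornology.IsBounded (C 0)) : (⋂ n, C n).Nonempty := by
  have hex : ∀ n, ∃ x ∈ C n, ∀ y ∈ C n, ‖x‖ ≤ ‖y‖ := by
    intro n
    obtain ⟨x, hx, hmin⟩ := exists_norm_eq_iInf_of_complete_convex (hne n) (hcl n).isComplete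
      (hcv n) (0 : H)
    refine ⟨x, hx, fun y hy => ?_⟩
    rw [zero_sub, norm_neg] at hmin
    rw [hmin]
    have hb : BddBelow (range fun w : C n => ‖(0 : H) - w‖) :=
      ⟨0, by rintro _ ⟨w, rfl⟩; exact norm_nonneg _⟩
    simpa using ciInf_le hb ⟨y, hy⟩
  choose x hx hmin using hex
  obtain ⟨M, hM⟩ := hbdd.exists_norm_le
  have hmono : Monotone fun n => ‖x n‖ ^ 2 := fun i j hij =>
    pow_le_pow_left₀ (norm_nonneg _) (hmin i _ (hanti hij (hx j))) 2
  have hbd : BddAbove (range fun n => ‖x n‖ ^ 2) := by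
    refine ⟨M ^ 2, ?_⟩
    rintro _ ⟨n, rfl⟩
    exact pow_le_pow_left₀ (norm_nonneg _) (hM _ (hanti (Nat.zero_le n) (hx n))) 2
  have hcauchy := (tendsto_atTop_ciSup hmono hbd).cauchySeq
  have hkey : ∀ i j, i ≤ j → ‖x i - x j‖ ^ 2 ≤ 2 * (‖x j‖ ^ 2 - ‖x i‖ ^ 2) := by
    intro i j hij
    have hmid : (1 / 2 : ℝ) • x i + (1 / 2 : ℝ) • x j ∈ C i :=
      hcv i (hx i) (hanti hij (hx j)) (by norm_num) (by norm_num) (by norm_num)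
    have h1 := hmin i _ hmid
    rw [← smul_add, norm_smul, Real.norm_of_nonneg (by norm_num)] at h1
    have h2 := parallelogram_law_with_norm ℝ (x i) (x j)
    nlinarith [norm_nonneg (x i), norm_nonneg (x i + x j)]
  have hcs : CauchySeq x := by
    rw [Metric.cauchySeq_iff'] at hcauchy ⊢
    intro ε hε
    obtain ⟨N, hN⟩ := hcauchy (ε ^ 2 / 2) (by positivity)
    refine ⟨N, fun n hn => ?_⟩
    have h1 := hN n hn
    rw [Real.dist_eq] at h1
    have h2 := hkey N n hn
    rw [dist_comm, dist_eq_norm]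
    refine lt_of_pow_lt_pow_left₀ 2 hε.le ?_
    linarith [le_abs_self (‖x n‖ ^ 2 - ‖x N‖ ^ 2)]
  obtain ⟨a, ha⟩ := cauchySeq_tendsto_of_complete hcs
  refine ⟨a, mem_iInter.2 fun n => (hcl n).mem_of_tendsto ha ?_⟩
  filter_upwards [eventually_ge_atTop n] with k hk using hanti hk (hx k)

/-- Lower semicontinuous convex functions with values in `[0, ∞]`. -/
structure IsConvexLsc (J : H → ℝ≥0∞) : Prop where
  lsc : LowerSemicontinuous J
  convex : ∀ x y, ∀ s t : ℝ, 0 ≤ s → 0 ≤ t → s + t = 1 →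
    J (s • x + t • y) ≤ ENNReal.ofReal s * J x + ENNReal.ofReal t * J y

namespace IsConvexLsc

theorem of_convexOn {f : H → ℝ} (hf : ConvexOn ℝ univ f) (hc : Continuous f) :
    IsConvexLsc fun x => ENNReal.ofReal (f x) where
  lsc := (ENNReal.continuous_ofReal.comp hc).lowerSemicontinuous
  convex x y s t hs ht hst := by
    refine (ENNReal.ofReal_le_ofReal (hf.2 (mem_univ x) (mem_univ y) hs ht hst)).trans ?_
    refine ENNReal.ofReal_add_le.trans_eq ?_
    simp only [smul_eq_mul]
    rw [ENNReal.ofReal_mul hs, ENNReal.ofReal_mul ht]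

theorem const (c : ℝ≥0∞) : IsConvexLsc fun _ : H => c where
  lsc := lowerSemicontinuous_const
  convex x y s t hs ht hst := by
    rw [← add_mul, ← ENNReal.ofReal_add hs ht, hst, ENNReal.ofReal_one, one_mul]

theorem add {J J' : H → ℝ≥0∞} (h : IsConvexLsc J) (h' : IsConvexLsc J') :
    IsConvexLsc fun x => J x + J' x where
  lsc := h.lsc.add h'.lsc
  convex x y s t hs ht hst :=
    (add_le_add (h.convex x y s t hs ht hst) (h'.convex x y s t hs ht hst)).trans_eq (by ring)

theorem const_mul {J : H → ℝ≥0∞} (h : IsConvexLsc J) {c : ℝ≥0∞} (hc : c ≠ ⊤) :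
    IsConvexLsc fun x => c * J x where
  lsc := (ENNReal.continuous_const_mul hc).comp_lowerSemicontinuous h.lsc
    fun _ _ hab => mul_le_mul' le_rfl hab
  convex x y s t hs ht hst :=
    (mul_le_mul' le_rfl (h.convex x y s t hs ht hst)).trans_eq (by ring)

theorem iSup {ι : Sort*} {J : ι → H → ℝ≥0∞} (h : ∀ i, IsConvexLsc (J i)) :
    IsConvexLsc fun x => ⨆ i, J i x where
  lsc := lowerSemicontinuous_iSup fun i => (h i).lsc
  convex x y s t hs ht hst := iSup_le fun i => ((h i).convex x y s t hs ht hst).trans (by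
    gcongr
    · exact le_iSup (fun i => J i x) i
    · exact le_iSup (fun i => J i y) i)

theorem comp {J : H' → ℝ≥0∞} (h : IsConvexLsc J) (L : H →L[ℝ] H') :
    IsConvexLsc fun x => J (L x) where
  lsc := h.lsc.comp L.continuous
  convex x y s t hs ht hst := by
    rw [map_add, map_smul, map_smul]
    exact h.convex _ _ s t hs ht hst

/-- The squared distance of a linear image to a point. -/
theorem sq_norm_sub (L : H →L[ℝ] H') (r : H') :
    IsConvexLsc fun x => ENNReal.ofReal (‖L x - r‖ ^ 2) := by
  refine of_convexOn ⟨convex_univ, fun x _ y _ s t hs ht hst => ?_⟩ (by fun_prop)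
  have h1 : L (s • x + t • y) - r = s • (L x - r) + t • (L y - r) := by
    have : r = s • r + t • r := by rw [← add_smul, hst, one_smul]
    rw [map_add, map_smul, map_smul]
    nth_rw 1 [this]
    module
  have h2 := (convexOn_norm (convex_univ (𝕜 := ℝ) (E := H'))).pow (fun _ _ => norm_nonneg _) 2
  change ‖L (s • x + t • y) - r‖ ^ 2 ≤ _
  rw [h1]
  exact h2.2 (mem_univ _) (mem_univ _) hs ht hst

theorem exists_minimiser [CompleteSpace H] {J : H → ℝ≥0∞} (h : IsConvexLsc J)
    (hfin : ∃ x, J x ≠ ⊤) (hbdd : ∀ c ≠ ⊤, Bornology.IsBounded {x | J x ≤ c}) :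
    ∃ x, ∀ y, J x ≤ J y := by
  obtain ⟨x₀, hx₀⟩ := hfin
  have hm : ⨅ x, J x < ⊤ := (iInf_le J x₀).trans_lt hx₀.lt_top
  obtain ⟨c, hc, hcm, hlim⟩ := exists_seq_strictAnti_tendsto' hm
  obtain ⟨x, hx⟩ := nonempty_iInter_of_closed_convex_bounded (C := fun n => {x | J x ≤ c n})
    (fun i j hij x hx => le_trans hx (hc.antitone hij))
    (fun n => by
      obtain ⟨x, hx⟩ := iInf_lt_iff.1 (hcm n).1
      exact ⟨x, hx.le⟩)
    (fun n => h.lsc.isClosed_preimage (c n))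
    (fun n x hx y hy s t hs ht hst => by
      refine (h.convex x y s t hs ht hst).trans ?_
      refine (add_le_add (mul_le_mul' le_rfl hx) (mul_le_mul' le_rfl hy)).trans_eq ?_
      rw [← add_mul, ← ENNReal.ofReal_add hs ht, hst, ENNReal.ofReal_one, one_mul])
    (hbdd _ (hcm 0).2.ne)
  exact ⟨x, fun y => (ge_of_tendsto' hlim fun n => mem_iInter.1 hx n).trans (iInf_le J y)⟩

/-- A convex function plus the squared norm of an injective affine map has a unique minimiser, as
soon as its sublevel sets are bounded. -/
theorem existsUnique_minimiser [CompleteSpace H] {F : H → ℝ≥0∞} (hF : IsConvexLsc F)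
    (L : H →L[ℝ] H') (r : H') (hL : ∀ x, L x = 0 → x = 0) {b : ℝ≥0∞} (hb0 : b ≠ 0) (hbt : b ≠ ⊤)
    (hfin : ∃ x, F x ≠ ⊤)
    (hbdd : ∀ c ≠ ⊤, Bornology.IsBounded {x | F x + b * ENNReal.ofReal (‖L x - r‖ ^ 2) ≤ c}) :
    ∃! x, ∀ y, F x + b * ENNReal.ofReal (‖L x - r‖ ^ 2)
      ≤ F y + b * ENNReal.ofReal (‖L y - r‖ ^ 2) := by
  set J : H → ℝ≥0∞ := fun x => F x + b * ENNReal.ofReal (‖L x - r‖ ^ 2) with hJ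
  obtain ⟨x₀, hx₀⟩ := hfin
  have hJ₀ : J x₀ ≠ ⊤ :=
    ENNReal.add_ne_top.2 ⟨hx₀, ENNReal.mul_ne_top hbt ENNReal.ofReal_ne_top⟩
  obtain ⟨x, hx⟩ := (hF.add ((sq_norm_sub L r).const_mul hbt)).exists_minimiser ⟨x₀, hJ₀⟩ hbdd
  refine ⟨x, hx, fun y hy => ?_⟩
  have hxy : J x = J y := le_antisymm (hx y) (hy x)
  have hJx : J x ≠ ⊤ := ne_top_of_le_ne_top hJ₀ (hx x₀)
  -- at the midpoint the squared norm gains `d`, by the parallelogram law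
  set z := (1 / 2 : ℝ) • x + (1 / 2 : ℝ) • y with hz
  set d := ‖L x - L y‖ ^ 2 / 4 with hd
  have hd0 : 0 ≤ d := by positivity
  have hpar : ‖L z - r‖ ^ 2 + d = 1 / 2 * ‖L x - r‖ ^ 2 + 1 / 2 * ‖L y - r‖ ^ 2 := by
    have h1 := parallelogram_law_with_norm ℝ (L x - r) (L y - r)
    have h2 : L z - r = (1 / 2 : ℝ) • ((L x - r) + (L y - r)) := by
      rw [hz, map_add, map_smul, map_smul]; module
    have h3 : (L x - r) - (L y - r) = L x - L y := by abel
    rw [h3] at h1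
    rw [h2, norm_smul, Real.norm_of_nonneg (by norm_num), hd]
    nlinarith
  have hJz : J z + b * ENNReal.ofReal d ≤ J x := by
    have h1 : F z + b * ENNReal.ofReal (‖L z - r‖ ^ 2 + d) ≤
        ENNReal.ofReal (1 / 2) * J x + ENNReal.ofReal (1 / 2) * J y := by
      rw [hpar, ENNReal.ofReal_add (by positivity) (by positivity),
        ENNReal.ofReal_mul (by norm_num), ENNReal.ofReal_mul (by norm_num)]
      refine (add_le_add (hF.convex x y (1 / 2) (1 / 2) (by norm_num) (by norm_num)
        (by norm_num)) le_rfl).trans_eq ?_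
      simp only [hJ]
      ring
    rw [ENNReal.ofReal_add (by positivity) hd0, mul_add, ← add_assoc, ← hxy, ← add_mul,
      ← ENNReal.ofReal_add (by norm_num) (by norm_num), add_halves,
      ENNReal.ofReal_one, one_mul] at h1
    exact h1
  have h0 : b * ENNReal.ofReal d = 0 := by
    by_contra hne
    exact absurd (hJz.trans (hx z)) (not_le.2 (ENNReal.lt_add_right
      (ne_top_of_le_ne_top hJx (le_self_add.trans hJz)) hne))
  have h1 : d ≤ 0 := ENNReal.ofReal_eq_zero.1 ((mul_eq_zero.1 h0).resolve_left hb0)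
  have h2 : ‖L x - L y‖ ^ 2 = 0 := by linarith [le_antisymm h1 hd0]
  rw [sq_eq_zero_iff, norm_eq_zero, ← map_sub] at h2
  exact (sub_eq_zero.1 (hL _ h2)).symm

end IsConvexLsc

end ConvexMinimisation

/-! ### The reconstruction functional -/

section Coercivity

variable {Ω : Set Plane}

theorem L2.enorm_sq (f : L2 Ω) : ‖f‖ₑ ^ 2 = ∫⁻ x in Ω, ‖f x‖ₑ ^ 2 := by
  rw [Lp.enorm_def, eLpNorm_eq_lintegral_rpow_enorm_toReal (by norm_num) (by norm_num)]
  simp only [ENNReal.toReal_ofNat, one_div, ENNReal.rpow_ofNat]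
  rw [← ENNReal.rpow_ofNat, ← ENNReal.rpow_mul]
  norm_num

theorem L2.integrableOn (hΩb : Bornology.IsBounded Ω) (f : L2 Ω) : IntegrableOn f Ω := by
  have : IsFiniteMeasure (volume.restrict Ω) := ⟨by simpa using hΩb.measure_lt_top⟩
  exact (Lp.memLp f).integrable (by norm_num)

/-- The total variation is a supremum of continuous linear functionals on `L²`. -/
theorem isConvexLsc_TV (hΩb : Bornology.IsBounded Ω) :
    IsConvexLsc fun I : L2 Ω => TV Ω I := by
  have : IsFiniteMeasure (volume.restrict Ω) := ⟨by simpa using hΩb.measure_lt_top⟩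
  refine .iSup fun η => .iSup fun hη => .iSup fun _ => ?_
  obtain ⟨D, hD⟩ := exists_bound_divergence hη
  have hmem : MemLp (divergence η) 2 (volume.restrict Ω) :=
    MemLp.of_bound (continuous_divergence hη.1).aestronglyMeasurable D (.of_forall hD)
  have hℓ : ∀ I : L2 Ω, ∫ x in Ω, I x * divergence η x = innerSL ℝ (hmem.toLp _) I := by
    intro I
    rw [innerSL_apply_apply, L2.inner_def]
    refine integral_congr_ae ?_
    filter_upwards [hmem.coeFn_toLp] with x hx
    rw [hx]
    rfl
  simp_rw [hℓ]
  exact .of_convexOn ((innerSL ℝ (hmem.toLp _)).toLinearMap.convexOn convex_univ)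
    (innerSL ℝ (hmem.toLp _)).continuous

theorem TV_zero : TV Ω (0 : L2 Ω) = 0 := by
  simp only [TV, ENNReal.iSup_eq_zero, ENNReal.ofReal_eq_zero]
  intro η _ _
  refine le_of_eq (integral_eq_zero_of_ae ?_)
  filter_upwards [Lp.coeFn_zero ℝ 2 (volume.restrict Ω)] with x hx
  rw [hx]
  simp

/-- The reconstruction functional controls the `L²` norm: by the Poincaré–Sobolev inequality the
total variation controls the distance to the constants, and `A` is injective on the constants. -/
theorem exists_norm_le_of_TV_le (hΩ : IsOpen Ω) (hΩc : IsConnected Ω)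
    (hΩb : Bornology.IsBounded Ω) (hlip : HasLipschitzBoundary Ω)
    {Y : Type*} [NormedAddCommGroup Y] [InnerProductSpace ℝ Y] (A : L2 Ω →L[ℝ] Y)
    (hA : ∀ (c : ℝ) (f : L2 Ω), c ≠ 0 → (∀ᵐ x ∂(volume.restrict Ω), f x = c) → A f ≠ 0)
    {T M : ℝ} (hT0 : 0 ≤ T) :
    ∃ N, ∀ I : L2 Ω, TV Ω I ≤ ENNReal.ofReal T → ‖A I‖ ≤ M → ‖I‖ ≤ N := by
  have : IsFiniteMeasure (volume.restrict Ω) := ⟨by simpa using hΩb.measure_lt_top⟩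
  obtain ⟨C, hC⟩ := exists_poincare_sobolev hΩ hΩc hΩb hlip
  set e := Lp.constL 2 (volume.restrict Ω) ℝ (E := ℝ) with he
  have hec : ∀ c : ℝ, ∀ᵐ x ∂(volume.restrict Ω), (e c : L2 Ω) x = c := fun c =>
    Lp.coeFn_const (p := 2) (μ := volume.restrict Ω) c
  have hA1 : 0 < ‖A (e 1)‖ := norm_pos_iff.2 (hA 1 _ one_ne_zero (hec 1))
  set S := √(C * T ^ 2) with hS
  refine ⟨S + (M + ‖A‖ * S) / ‖A (e 1)‖ * ‖e 1‖, fun I hTV hAI => ?_⟩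
  obtain ⟨c, hc⟩ := hC I T (Lp.stronglyMeasurable I).measurable (L2.integrableOn hΩb I)
    (tvLe_of_TV_le hT0 hTV)
  have hnorm : ‖I - e c‖ ≤ S := by
    have h1 : ‖I - e c‖ₑ ^ 2 ≤ ENNReal.ofReal (C * T ^ 2) := by
      rw [L2.enorm_sq]
      refine (lintegral_congr_ae ?_).trans_le (hc.trans_eq ?_)
      · filter_upwards [Lp.coeFn_sub I (e c), hec c] with x h1 h2
        rw [h1, Pi.sub_apply, h2]
      · rw [ENNReal.ofReal_mul NNReal.zero_le_coe, ENNReal.ofReal_pow hT0,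
          ENNReal.ofReal_coe_nnreal]
    rw [← ofReal_norm, ← ENNReal.ofReal_pow (norm_nonneg _),
      ENNReal.ofReal_le_ofReal_iff (by positivity)] at h1
    exact Real.le_sqrt_of_sq_le h1
  have hce : e c = c • e 1 := by rw [← map_smul, smul_eq_mul, mul_one]
  have h2 : |c| * ‖A (e 1)‖ ≤ M + ‖A‖ * S := by
    calc |c| * ‖A (e 1)‖ = ‖A I - A (I - e c)‖ := by
          rw [map_sub, sub_sub_cancel, hce, map_smul, norm_smul, Real.norm_eq_abs]
      _ ≤ ‖A I‖ + ‖A (I - e c)‖ := norm_sub_le _ _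
      _ ≤ M + ‖A‖ * S := add_le_add hAI ((A.le_opNorm _).trans (by gcongr))
  calc ‖I‖ = ‖(I - e c) + e c‖ := by rw [sub_add_cancel]
    _ ≤ ‖I - e c‖ + ‖e c‖ := norm_add_le _ _
    _ ≤ _ := by
      rw [hce, norm_smul, Real.norm_eq_abs]
      gcongr
      · rwa [← hce]
      · rwa [le_div_iff₀ hA1]

end Coercivity

/-! ### Transport defects along a path of images -/

section PathOperator

variable {E : Type*} [NormedAddCommGroup E] [InnerProductSpace ℝ E] {K : ℕ}

/-- The linear part `I ↦ (T_k I_k - I_{k+1})_k` of the transport defects along a path, where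
`I_K = 0`. -/
noncomputable def pathL (T : Fin K → E →L[ℝ] E) :
    (PiLp 2 fun _ : Fin K => E) →L[ℝ] PiLp 2 fun _ : Fin K => E :=
  (PiLp.continuousLinearEquiv 2 ℝ fun _ : Fin K => E).symm.toContinuousLinearMap ∘L
    ContinuousLinearMap.pi fun k => T k ∘L PiLp.proj 2 (fun _ => E) k -
      if h : (k : ℕ) + 1 < K then PiLp.proj 2 (fun _ => E) ⟨k + 1, h⟩ else 0

/-- The constant part of the transport defects: the last image of the path is `R`. -/
noncomputable def pathEnd (K : ℕ) (R : E) : PiLp 2 fun _ : Fin K => E :=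
  WithLp.toLp 2 fun k => if (k : ℕ) + 1 < K then 0 else R

theorem pathL_apply (T : Fin K → E →L[ℝ] E) (I : PiLp 2 fun _ : Fin K => E) (k : Fin K) :
    pathL T I k = T k (I k) - if h : (k : ℕ) + 1 < K then I ⟨k + 1, h⟩ else 0 := by
  by_cases h : (k : ℕ) + 1 < K <;> simp [pathL, h]

theorem pathL_sub_pathEnd_apply (T : Fin K → E →L[ℝ] E) (R : E)
    (I : PiLp 2 fun _ : Fin K => E) (k : Fin K) :
    (pathL T I - pathEnd K R) k =
      T k (I k) - if h : (k : ℕ) + 1 < K then I ⟨k + 1, h⟩ else R := by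
  rw [PiLp.sub_apply, pathL_apply]
  by_cases h : (k : ℕ) + 1 < K <;> simp [pathEnd, h]

/-- Without transport defects the images vanish one after the other, starting from the last. -/
theorem pathL_injective {T : Fin K → E →L[ℝ] E} (hT : ∀ k x, T k x = 0 → x = 0)
    {I : PiLp 2 fun _ : Fin K => E} (h : pathL T I = 0) : I = 0 := by
  have hk : ∀ n, ∀ k : Fin K, (k : ℕ) + n + 1 = K → I k = 0 := by
    intro n
    induction n with
    | zero =>
      intro k hk
      have h1 := pathL_apply T I k
      rw [h, dif_neg (by omega), sub_zero] at h1
      exact hT k _ h1.symm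
    | succ n ih =>
      intro k hk
      have h1 := pathL_apply T I k
      rw [h, dif_pos (by omega), ih ⟨k + 1, by omega⟩ (by simp only; omega), sub_zero] at h1
      exact hT k _ h1.symm
  ext k
  exact hk (K - 1 - k) k (by omega)

/-- A path is determined, with bounds, by its first image and its transport defects. -/
theorem exists_norm_le_of_norm_pathL_le (T : Fin K → E →L[ℝ] E) (R : E) (hK : 0 < K) (N M : ℝ) :
    ∃ B, ∀ I : PiLp 2 fun _ : Fin K => E, ‖I ⟨0, hK⟩‖ ≤ N → ‖pathL T I - pathEnd K R‖ ≤ M →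
      ‖I‖ ≤ B := by
  have hk : ∀ n (hn : n < K), ∃ B, ∀ I : PiLp 2 fun _ : Fin K => E, ‖I ⟨0, hK⟩‖ ≤ N →
      ‖pathL T I - pathEnd K R‖ ≤ M → ‖I ⟨n, hn⟩‖ ≤ B := by
    intro n
    induction n with
    | zero => exact fun hn => ⟨N, fun I h _ => h⟩
    | succ n ih =>
      intro hn
      obtain ⟨B, hB⟩ := ih (by omega)
      refine ⟨‖T ⟨n, by omega⟩‖ * B + M, fun I h0 hM => ?_⟩
      have h1 := pathL_sub_pathEnd_apply T R I ⟨n, by omega⟩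
      rw [dif_pos hn] at h1
      have h2 : I ⟨n + 1, hn⟩ = T ⟨n, by omega⟩ (I ⟨n, by omega⟩)
          - (pathL T I - pathEnd K R) ⟨n, by omega⟩ := by rw [h1]; abel
      rw [h2]
      refine (norm_sub_le _ _).trans (add_le_add ?_ ((PiLp.norm_apply_le _ _).trans hM))
      exact ((T _).le_opNorm _).trans (mul_le_mul_of_nonneg_left (hB I h0 hM) (norm_nonneg _))
  choose B hB using fun k : Fin K => hk k k.2
  refine ⟨√(∑ k, B k ^ 2), fun I h0 hM => ?_⟩
  rw [PiLp.norm_eq_of_L2]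
  exact Real.sqrt_le_sqrt (Finset.sum_le_sum fun k _ =>
    pow_le_pow_left₀ (norm_nonneg _) (hB k I h0 hM) 2)

end PathOperator

/-! ### The energy for fixed deformations -/

section Energy

variable {Ω : Set Plane} {K : ℕ}

theorem extend_castSucc (I : Fin K → L2 Ω) (R : L2 Ω) (k : Fin K) :
    extend I R k.castSucc = I k := Fin.snoc_castSucc (α := fun _ => L2 Ω) _ _ _

theorem extend_succ (I : Fin K → L2 Ω) (R : L2 Ω) (k : Fin K) :
    extend I R k.succ = if h : (k : ℕ) + 1 < K then I ⟨k + 1, h⟩ else R := by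
  by_cases h : (k : ℕ) + 1 < K
  · rw [dif_pos h]
    exact extend_castSucc I R ⟨k + 1, h⟩
  · rw [dif_neg h]
    have : k.succ = Fin.last K := Fin.ext (by simp; omega)
    rw [this]
    exact Fin.snoc_last (α := fun _ => L2 Ω) _ _

theorem extend_zero (hK : 0 < K) (I : Fin K → L2 Ω) (R : L2 Ω) : extend I R 0 = I ⟨0, hK⟩ :=
  extend_castSucc I R ⟨0, hK⟩

theorem lintegral_matching_eq {φ : Plane → Plane} {T : L2 Ω →L[ℝ] L2 Ω}
    (hT : ∀ I : L2 Ω, T I =ᵐ[volume.restrict Ω] compInv Ω I φ) (I I' : L2 Ω) :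
    ∫⁻ x in Ω, ENNReal.ofReal (|compInv Ω I φ x - I' x| ^ 2)
      = ENNReal.ofReal (‖T I - I'‖ ^ 2) := by
  rw [ENNReal.ofReal_pow (norm_nonneg _), ofReal_norm, L2.enorm_sq]
  refine lintegral_congr_ae ?_
  filter_upwards [hT I, Lp.coeFn_sub (T I) I'] with x h1 h2
  rw [h2, Pi.sub_apply, h1, ENNReal.ofReal_pow (abs_nonneg _), ← Real.enorm_eq_ofReal_abs]

/-- For fixed deformations, the path energy is the squared distance in `L²(Ω)^K` of a linear image
of the images to a fixed point, up to a constant. -/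
theorem pathEnergy_eq (hΩ : IsOpen Ω) {W : Matrix (Fin 2) (Fin 2) ℝ → ℝ≥0∞} {ν : ℝ} {m : ℕ}
    {R : L2 Ω} {φ : Fin K → Plane → Plane} (hφ : ∀ k, IsAdmissible Ω m (φ k))
    {T : Fin K → L2 Ω →L[ℝ] L2 Ω}
    (hT : ∀ k, ∀ I : L2 Ω, T k I =ᵐ[volume.restrict Ω] compInv Ω I (φ k))
    (I : PiLp 2 fun _ : Fin K => L2 Ω) :
    pathEnergy Ω W ν m R I φ =
      (∑ k, ((∫⁻ x in Ω, W (jacobian Ω (φ k) x)) +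
        ∫⁻ x in Ω, ENNReal.ofReal (ν * normSqDm Ω m (φ k) x))) +
      ENNReal.ofReal (‖pathL T I - pathEnd K R‖ ^ 2) := by
  have hmeas : ∀ k, ∀ J J' : L2 Ω, AEMeasurable
      (fun x => ENNReal.ofReal (|compInv Ω J (φ k) x - J' x| ^ 2)) (volume.restrict Ω) := by
    intro k J J'
    have h1 : AEMeasurable (compInv Ω J (φ k)) (volume.restrict Ω) :=
      (Lp.aestronglyMeasurable (T k J)).aemeasurable.congr (hT k J)
    exact ((h1.sub (Lp.aestronglyMeasurable J').aemeasurable).abs.pow_const 2).ennreal_ofReal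
  have hreg : ∀ k, AEMeasurable (fun x => ENNReal.ofReal (ν * normSqDm Ω m (φ k) x))
      (volume.restrict Ω) := fun k =>
    ((integrable_normSqDm hΩ (hφ k).memSobolev).aemeasurable.const_mul ν).ennreal_ofReal
  rw [PiLp.norm_sq_eq_of_L2, ENNReal.ofReal_sum_of_nonneg fun k _ => by positivity,
    ← Finset.sum_add_distrib]
  refine Finset.sum_congr rfl fun k _ => ?_
  rw [lintegral_add_right' _ (hmeas k _ _), lintegral_add_right' _ (hreg k),
    lintegral_matching_eq (hT k), pathL_sub_pathEnd_apply, extend_castSucc, extend_succ]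

end Energy

end TDM

theorem lemma3p3
    (Ω : Set TDM.Plane) (hΩ_open : IsOpen Ω) (hΩ_conn : IsConnected Ω)
    (hΩ_bdd : Bornology.IsBounded Ω) (hΩ_lip : TDM.HasLipschitzBoundary Ω)
    {Y : Type*} [NormedAddCommGroup Y] [InnerProductSpace ℝ Y] [CompleteSpace Y]
    (A : TDM.L2 Ω →L[ℝ] Y)
    (hA : ∀ (c : ℝ) (f : TDM.L2 Ω), c ≠ 0 → (∀ᵐ x ∂(volume.restrict Ω), f x = c) → A f ≠ 0)
    (B : Y) (R : TDM.L2 Ω)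
    (W : Matrix (Fin 2) (Fin 2) ℝ → ℝ≥0∞) (hW : LowerSemicontinuous W)
    (α β ν : ℝ) (hα : 0 < α) (hβ : 0 < β) (hν : 0 < ν)
    (m : ℕ) (hm : 2 < m) (K : ℕ) (hK : 1 ≤ K)
    (φ : Fin K → TDM.Plane → TDM.Plane) (hφ : ∀ k, TDM.IsAdmissible Ω m (φ k))
    (hWφ : ∀ k, (∫⁻ x in Ω, W (TDM.jacobian Ω (φ k) x)) < ⊤) :
    ∃! I : Fin K → TDM.L2 Ω, ∀ I' : Fin K → TDM.L2 Ω,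
      TDM.totalEnergy Ω A B W α β ν m R I φ ≤ TDM.totalEnergy Ω A B W α β ν m R I' φ := by
  classical
  have hK0 : 0 < K := hK
  have hfr : volume (frontier Ω) = 0 := hΩ_lip.volume_frontier hΩ_open
  -- the transport operators `I ↦ I ∘ φ_k⁻¹`
  have hTex : ∀ k, ∃ T : TDM.L2 Ω →L[ℝ] TDM.L2 Ω,
      (∀ I : TDM.L2 Ω, T I =ᵐ[volume.restrict Ω] TDM.compInv Ω I (φ k)) ∧
        ∀ I, T I = 0 → I = 0 := by
    intro k
    obtain ⟨L, hL⟩ := (hφ k).exists_lipschitzWith_extendId hΩ_open hΩ_bdd hΩ_lip hm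
    have hid : ∀ x, x ∉ Ω → TDM.extendId Ω (φ k) x = x := fun x hx => by
      simp [TDM.extendId, hx]
    have heq := TDM.extendId_eqOn_closure hΩ_open (hφ k).eq_on_frontier
    refine ⟨TDM.compInvL hΩ_bdd hL hid, fun I => ?_, fun I hI => ?_⟩
    · rw [TDM.compInv_congr heq]
      exact TDM.coeFn_compInvL hΩ_bdd hL hid I
    · refine TDM.compInvL_injective hΩ_open hΩ_bdd hfr hL hid ?_ hI
      filter_upwards [(hφ k).det_pos,
        TDM.jacobian_det_ae_eq hΩ_open hL (heq.mono subset_closure)] with x h1 h2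
      rwa [← h2]
  choose T hT hTinj using hTex
  set κ : ℝ≥0∞ := ∑ k, ((∫⁻ x in Ω, W (TDM.jacobian Ω (φ k) x)) +
    ∫⁻ x in Ω, ENNReal.ofReal (ν * TDM.normSqDm Ω m (φ k) x)) with hκ
  have hκt : κ ≠ ⊤ := ENNReal.sum_ne_top.2 fun k _ => ENNReal.add_ne_top.2 ⟨(hWφ k).ne,
    ((TDM.integrable_normSqDm hΩ_open (hφ k).memSobolev).const_mul ν).lintegral_lt_top.ne⟩
  set i₀ : Fin K := ⟨0, hK0⟩ with hi₀
  set F : (PiLp 2 fun _ : Fin K => TDM.L2 Ω) → ℝ≥0∞ := fun I =>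
    (ENNReal.ofReal (1 / 2) * ENNReal.ofReal (‖A (I i₀) - B‖ ^ 2) +
      ENNReal.ofReal α * TDM.TV Ω (I i₀)) + ENNReal.ofReal β * κ with hF
  have hJ : ∀ I : PiLp 2 fun _ : Fin K => TDM.L2 Ω,
      TDM.totalEnergy Ω A B W α β ν m R I φ = F I +
        ENNReal.ofReal β * ENNReal.ofReal (‖TDM.pathL T I - TDM.pathEnd K R‖ ^ 2) := by
    intro I
    rw [TDM.totalEnergy, TDM.reconstructionEnergy, TDM.pathEnergy_eq hΩ_open hφ hT,
      TDM.extend_zero hK0, mul_add, ← add_assoc, ENNReal.ofReal_mul (by norm_num)]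
  have hFc : TDM.IsConvexLsc F := by
    refine .add (.add (.const_mul ?_ ENNReal.ofReal_ne_top)
      (.const_mul ?_ ENNReal.ofReal_ne_top)) (.const _)
    · exact .sq_norm_sub (A ∘L PiLp.proj 2 (fun _ => TDM.L2 Ω) i₀) B
    · exact (TDM.isConvexLsc_TV hΩ_bdd).comp (PiLp.proj 2 (fun _ => TDM.L2 Ω) i₀)
  have hα' : ENNReal.ofReal α ≠ 0 := (ENNReal.ofReal_pos.2 hα).ne'
  have hβ' : ENNReal.ofReal β ≠ 0 := (ENNReal.ofReal_pos.2 hβ).ne'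
  have hbound : ∀ c ≠ ⊤, Bornology.IsBounded {I : PiLp 2 fun _ : Fin K => TDM.L2 Ω | F I +
      ENNReal.ofReal β * ENNReal.ofReal (‖TDM.pathL T I - TDM.pathEnd K R‖ ^ 2) ≤ c} := by
    intro c hc
    have hdiv : ∀ {a x : ℝ≥0∞}, a ≠ 0 → a ≠ ⊤ → a * x ≤ c →
        x ≤ ENNReal.ofReal (c / a).toReal := by
      intro a x h0 ht hx
      rw [ENNReal.ofReal_toReal (ENNReal.div_ne_top hc h0),
        ENNReal.le_div_iff_mul_le (.inl h0) (.inl ht), mul_comm]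
      exact hx
    have hsq : ∀ {a : ℝ≥0∞} {y : ℝ}, 0 ≤ y → a ≠ 0 → a ≠ ⊤ → a * ENNReal.ofReal (y ^ 2) ≤ c →
        y ≤ √(c / a).toReal := fun hy h0 ht hx => Real.le_sqrt_of_sq_le
      ((ENNReal.ofReal_le_ofReal_iff ENNReal.toReal_nonneg).1 (hdiv h0 ht hx))
    obtain ⟨N, hN⟩ := TDM.exists_norm_le_of_TV_le hΩ_open hΩ_conn hΩ_bdd hΩ_lip A hA
      (T := (c / ENNReal.ofReal α).toReal)
      (M := √(c / ENNReal.ofReal (1 / 2)).toReal + ‖B‖) ENNReal.toReal_nonneg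
    obtain ⟨D, hD⟩ := TDM.exists_norm_le_of_norm_pathL_le T R hK0 N
      √(c / ENNReal.ofReal β).toReal
    refine isBounded_iff_forall_norm_le.2 ⟨D, fun I hI => ?_⟩
    have hI' : F I + ENNReal.ofReal β *
      ENNReal.ofReal (‖TDM.pathL T I - TDM.pathEnd K R‖ ^ 2) ≤ c := hI
    have h1 : F I ≤ c := le_self_add.trans hI'
    have h2 := (le_self_add (b := ENNReal.ofReal β * κ)).trans h1
    refine hD I (hN _ (hdiv hα' ENNReal.ofReal_ne_top (le_add_self.trans h2)) ?_)
      (hsq (norm_nonneg _) hβ' ENNReal.ofReal_ne_top (le_add_self.trans hI'))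
    have h3 := hsq (norm_nonneg _) (by simp) ENNReal.ofReal_ne_top (le_self_add.trans h2)
    linarith [norm_sub_norm_le (A (I i₀)) B]
  have hF0 : F 0 ≠ ⊤ := by
    have h0 : TDM.TV Ω ((0 : PiLp 2 fun _ : Fin K => TDM.L2 Ω) i₀) = 0 := TDM.TV_zero
    simp only [hF, h0, mul_zero, add_zero]
    exact ENNReal.add_ne_top.2 ⟨ENNReal.mul_ne_top ENNReal.ofReal_ne_top ENNReal.ofReal_ne_top,
      ENNReal.mul_ne_top ENNReal.ofReal_ne_top hκt⟩
  obtain ⟨I, hI, huniq⟩ := hFc.existsUnique_minimiser (TDM.pathL T) (TDM.pathEnd K R)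
    (fun _ => TDM.pathL_injective hTinj) hβ' ENNReal.ofReal_ne_top
    ⟨0, hF0⟩ hbound
  simp_rw [← hJ] at hI huniq
  exact ⟨I.ofLp, fun I' => hI (WithLp.toLp 2 I'), fun I' hI' =>
    congrArg WithLp.ofLp (huniq (WithLp.toLp 2 I') fun y => hI' y.ofLp)⟩
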